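/- **Setting.** Fix an infinite set $\mathcal N$ of names. The terms of the synchronous choice-free $\pi$-calculus, with a success constant $\surd$ added, are $P ::= \mathbf 0 \mid \surd \mid \bar xy.P \mid x(z).P \mid P|P \mid (\nu z)P \mid {!P}$; in $x(z).P$ and $(\nu z)P$ the name $z$ is bound in $P$. Write $\mathrm{fn}(P)$, $\mathrm{bn}(P)$ for the sets of free and bound names of $P$, $\mathrm n(P)=\mathrm{fn}(P)\cup\mathrm{bn}(P)$, and $P\{y/z\}$ for $P$ with every free occurrence of $z$ replaced by $y$. *Structural congruence* $\equiv$ is the smallest congruence with (1) $P|(Q|R)\equiv(P|Q)|R$, (2) $P|Q\equiv Q|P$, (3) $P|\mathbf 0\equiv P$, (4) $!P\equiv P|{!P}$, (5) $(\nu z)\mathbf 0\equiv\mathbf 0$, (6) $(\nu z)(\nu u)P\equiv(\nu u)(\nu z)P$, (7) $(\nu w)(P|Q)\equiv P|(\nu w)Q$, (8) $(\nu z)P\equiv(\nu w)P\{w/z\}$, (9) $x(z).P\equiv x(w).P\{w/z\}$, where $w\notin\mathrm n(P)$ in (7)–(9). Write $\equiv_{\rm S}$ for the congruence generated by all rules except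 (4), and $=_\alpha$ for the one generated by (8) and (9). *Reduction* $\longmapsto$ is generated by $\bar xy.P\,|\,x(z).Q\longmapsto P\,|\,Q\{y/z\}$ if $y\notin\mathrm{bn}(Q)$, and closed under $\_|Q$, under $(\nu z)\_$ and under $\equiv$ on both sides; $\Longmapsto$ is its reflexive-transitive closure. $P{\downarrow}$ means that $P$ has an occurrence of $\surd$ that is not under a prefix; $P{\Downarrow}$ means $P\Longmapsto P'$ for some $P'{\downarrow}$; $P\longmapsto^\omega$ means that there is an infinite reduction sequence from $P$. The asynchronous calculus $\mathrm{a}\pi$ is the sublanguage in which every output prefix has the form $\bar xy.\mathbf 0$, written $\bar xy$, with the same relations. *Inert reduction* $\equiv\!\Rrightarrow$ is the smallest relation on $\mathrm a\pi$ with $(\nu v)(\bar vy\,|\,P\,|\,v(z).Q)\equiv\!\Rrightarrow P\,|\,Q\{y/z\}$ whenever $v\notin\mathrm{fn}(P)\cup\mathrm{fn}(Q\{y/z\})$ and $y\notin \mathrm{bn}(Q)$, and closed under $\_|R$, $(\nu w)\_$ and $\equiv$ on both sides. A term is *plain* if it is a parallel composition of terms of the forms $\bar xy.R$, $x(z).R$,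 $\surd$, $\mathbf 0$, $!R$. For a finite set $\tilde w=\{w_1,\dots,w_n\}$, $(\tilde w)P$ is $(\nu w_1)\cdots(\nu w_n)P$ in some order. The *Honda–Tokoro encoding* $[\![\cdot]\!]$ from $\pi$ to $\mathrm a\pi$ is $[\![\bar xy.P]\!]=x(u).(\bar uy\,|\,[\![P]\!])$ with $u\notin\mathrm{fn}(P)\cup\{x,y\}$, and $[\![x(z).P]\!]=(\nu u)(\bar xu\,|\,u(z).[\![P]\!])$ with $u\notin\mathrm{fn}(P)\cup\{x\}$, and it commutes with $\mathbf 0,\surd,|,\nu,!$. Here $u$ is given by an arbitrary fixed choice function of the prefix and the set $\mathrm{fn}(P)$. **Theorem.** For every such choice of fresh names: 1. *(Operational completeness in two steps.)* If $S\longmapsto S'$ then $[\![S]\!]\longmapsto T$ for some $T$ with $T\equiv\!\Rrightarrow[\![S']\!]$ and $T\longmapsto[\![S']\!]$. 2. *(Decomposition.)* If $[\![S]\!]\equiv_{\rm S}(\tilde w)(U\,|\,\bar xu\,|\,x(r).R)$ with $U$ plain and $\tilde w\subseteq\mathrm{fn}(U\,|\,\bar xu\,|\,x(r).R)$, then there are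 $\pi$-terms $V,R_1,R_2$, an $\mathrm a\pi$-term $W$, names $y,z$ and finite sets of names $\tilde s,\tilde t$ such that $S\equiv_{\rm S}(\tilde s)(V\,|\,\bar xy.R_1\,|\,x(z).R_2)$, $\tilde w=\tilde s\uplus\tilde t\uplus\{u\}$, $U\equiv_{\rm S}W\,|\,u(z).[\![R_2]\!]$, $u\notin\mathrm{fn}([\![R_2]\!])\setminus\{z\}$, $[\![V]\!]\equiv_{\rm S}(\tilde t)W$, $r\ne y$, $R\equiv_{\rm S}\bar ry\,|\,[\![R_1]\!]$ and $r\notin\mathrm{fn}([\![R_1]\!])$. 3. *(One-step soundness.)* If $[\![S]\!]\longmapsto T$ with $T$ in $\mathrm a\pi$, then there is $S'$ with $S\longmapsto S'$, $T\longmapsto[\![S']\!]$ and $T\equiv\!\Rrightarrow[\![S']\!]$. 4. *(Renaming.)* $[\![S\sigma]\!]=_\alpha[\![S]\!]\sigma$ for every $S$ and every $\sigma:\mathcal N\to\mathcal N$, injective or not, where $P\sigma$ is the capture-avoiding renaming of the free names of $P$. 5. *(Validity.)* With the identity $\mathcal N\to\mathcal N$ as renaming policy, and with structural congruence $\equiv$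 as the semantic equivalence $\asymp$ of $\mathrm a\pi$, the encoding satisfies the five criteria of Gorla: * *compositionality*: for every $k$-ary operator $\mathtt{op}$ of $\pi$ and every $N\subseteq\mathcal N$ there is a $k$-ary $\mathrm a\pi$-context $C$, in which each hole occurs exactly once, such that $[\![\mathtt{op}(S_1,\dots,S_k)]\!]=C[[\![S_1]\!];\dots;[\![S_k]\!]]$ (holes are filled literally, so that binders of $C$ bind in the inserted terms) for all $S_1,\dots,S_k$ with $\mathrm{fn}(S_1)\cup\dots\cup\mathrm{fn}(S_k)=N$; * *name invariance*: $[\![S\sigma]\!]=_\alpha[\![S]\!]\sigma$ if $\sigma$ is injective, and $[\![S\sigma]\!]\asymp[\![S]\!]\sigma$ otherwise; * *operational correspondence*: if $S\Longmapsto S'$ then $[\![S]\!]\Longmapsto\asymp[\![S']\!]$; and if $[\![S]\!]\Longmapsto T$ then there is $S'$ with $S\Longmapsto S'$ and $T\Longmapsto\asymp[\![S']\!]$; * *divergence reflection*: if $[\![S]\!]\longmapsto^\omega$ then $S\longmapsto^\omega$; * *success sensitiveness*: $S{\Downarrow}$ iff $[\![S]\!]{\Downarrow}$. -/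

import Mathlib

namespace HondaTokoro

/-! ### The synchronous choice-free pi-calculus, extended with the success constant -/

/-- Terms of the synchronous pi-calculus over a set of names, with the success constant `tick`. -/
inductive Proc (Name : Type*) where
  | nil : Proc Name
  | tick : Proc Name
  | out (x y : Name) (P : Proc Name) : Proc Name
  | inp (x z : Name) (P : Proc Name) : Proc Name
  | par (P Q : Proc Name) : Proc Name
  | nu (z : Name) (P : Proc Name) : Proc Name
  | bang (P : Proc Name) : Proc Name

namespace Proc

variable {Name : Type*} [DecidableEq Name]

/-- Free names. -/
def fn : Proc Name → Finset Name
  | nil => ∅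
  | tick => ∅
  | out x y P => {x, y} ∪ P.fn
  | inp x z P => {x} ∪ P.fn.erase z
  | par P Q => P.fn ∪ Q.fn
  | nu z P => P.fn.erase z
  | bang P => P.fn

/-- Bound names (all names occurring as a binder). -/
def bn : Proc Name → Finset Name
  | nil => ∅
  | tick => ∅
  | out _ _ P => P.bn
  | inp _ z P => {z} ∪ P.bn
  | par P Q => P.bn ∪ Q.bn
  | nu z P => {z} ∪ P.bn
  | bang P => P.bn

/-- All names occurring in a term. -/
def names (P : Proc Name) : Finset Name := P.fn ∪ P.bn

/-- `P.subst y z` is `P{y/z}`: every free occurrence of `z` is replaced by `y`, and nothing else is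
changed. Side conditions exclude capture wherever it is used. -/
def subst (y z : Name) : Proc Name → Proc Name
  | nil => nil
  | tick => tick
  | out a b P => out (if a = z then y else a) (if b = z then y else b) (P.subst y z)
  | inp a b P => inp (if a = z then y else a) b (if b = z then P else P.subst y z)
  | par P Q => par (P.subst y z) (Q.subst y z)
  | nu b P => nu b (if b = z then P else P.subst y z)
  | bang P => bang (P.subst y z)

/-- `(w₁)⋯(wₙ)P`. -/
def nus (ws : List Name) (P : Proc Name) : Proc Name := ws.foldr nu P

end Proc

/-- A name outside a given finite set. -/
noncomputable def freshName {Name : Type*} [Infinite Name] (s : Finset Name) : Name :=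
  Classical.choose (Infinite.exists_notMem_finset s)

/-- `P.ren σ` is `Pσ`: the simultaneous capture-avoiding renaming of the free names of `P`. -/
noncomputable def Proc.ren {Name : Type*} [DecidableEq Name] [Infinite Name] :
    Proc Name → (Name → Name) → Proc Name
  | .nil, _ => .nil
  | .tick, _ => .tick
  | .out x y P, σ => .out (σ x) (σ y) (P.ren σ)
  | .inp x z P, σ =>
      .inp (σ x) (freshName ((P.fn.erase z).image σ))
        (P.ren (Function.update σ z (freshName ((P.fn.erase z).image σ))))
  | .par P Q, σ => .par (P.ren σ) (Q.ren σ)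
  | .nu z P, σ =>
      .nu (freshName ((P.fn.erase z).image σ))
        (P.ren (Function.update σ z (freshName ((P.fn.erase z).image σ))))
  | .bang P, σ => .bang (P.ren σ)

/-! ### Structural congruence and reduction -/

section Semantics

variable {Name : Type*}

/-- The smallest congruence containing a relation `r`. -/
inductive Cong (r : Proc Name → Proc Name → Prop) : Proc Name → Proc Name → Prop
  | rule {P Q : Proc Name} : r P Q → Cong r P Q
  | refl (P : Proc Name) : Cong r P P
  | symm {P Q : Proc Name} : Cong r P Q → Cong r Q P
  | trans {P Q R : Proc Name} : Cong r P Q → Cong r Q R → Cong r P R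
  | out (x y : Name) {P P' : Proc Name} : Cong r P P' → Cong r (.out x y P) (.out x y P')
  | inp (x z : Name) {P P' : Proc Name} : Cong r P P' → Cong r (.inp x z P) (.inp x z P')
  | par {P P' Q Q' : Proc Name} : Cong r P P' → Cong r Q Q' → Cong r (.par P Q) (.par P' Q')
  | nu (z : Name) {P P' : Proc Name} : Cong r P P' → Cong r (.nu z P) (.nu z P')
  | bang {P P' : Proc Name} : Cong r P P' → Cong r (.bang P) (.bang P')

/-- A top-level unguarded occurrence of the success constant. -/
inductive Reports : Proc Name → Prop
  | tick : Reports .tick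
  | parLeft {P Q : Proc Name} : Reports P → Reports (.par P Q)
  | parRight {P Q : Proc Name} : Reports Q → Reports (.par P Q)
  | nu {z : Name} {P : Proc Name} : Reports P → Reports (.nu z P)
  | bang {P : Proc Name} : Reports P → Reports (.bang P)

variable [DecidableEq Name]

/-- Rules (8) and (9): renaming of a bound name. -/
inductive AlphaRule : Proc Name → Proc Name → Prop
  | nu (z w : Name) (P : Proc Name) (hw : w ∉ P.names) :
      AlphaRule (.nu z P) (.nu w (P.subst w z))
  | inp (x z w : Name) (P : Proc Name) (hw : w ∉ P.names) :
      AlphaRule (.inp x z P) (.inp x w (P.subst w z))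

/-- Rules (1)-(3) and (5)-(7). -/
inductive StaticRule : Proc Name → Proc Name → Prop
  | assoc (P Q R : Proc Name) : StaticRule (.par P (.par Q R)) (.par (.par P Q) R)
  | comm (P Q : Proc Name) : StaticRule (.par P Q) (.par Q P)
  | unit (P : Proc Name) : StaticRule (.par P .nil) P
  | nuNil (z : Name) : StaticRule (.nu z .nil) .nil
  | nuComm (z u : Name) (P : Proc Name) : StaticRule (.nu z (.nu u P)) (.nu u (.nu z P))
  | scope (w : Name) (P Q : Proc Name) (hw : w ∉ P.names) :
      StaticRule (.nu w (.par P Q)) (.par P (.nu w Q))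

/-- Rule (4): unfolding of a replication. -/
inductive BangRule : Proc Name → Proc Name → Prop
  | unfold (P : Proc Name) : BangRule (.bang P) (.par P (.bang P))

/-- Alpha-conversion: rules (8) and (9) only. -/
def AlphaEq (P Q : Proc Name) : Prop := Cong AlphaRule P Q

/-- `P ≡_S Q`: all rules except (4). -/
def StaticCong (P Q : Proc Name) : Prop :=
  Cong (fun P Q => StaticRule P Q ∨ AlphaRule P Q) P Q

/-- Structural congruence `P ≡ Q`: all rules (1)-(9). -/
def StructCong (P Q : Proc Name) : Prop :=
  Cong (fun P Q => StaticRule P Q ∨ BangRule P Q ∨ AlphaRule P Q) P Q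

/-- The reduction relation `P ⟼ Q`. -/
inductive Red : Proc Name → Proc Name → Prop
  | com (x y z : Name) (P Q : Proc Name) (hy : y ∉ Q.bn) :
      Red (.par (.out x y P) (.inp x z Q)) (.par P (Q.subst y z))
  | par {P P' : Proc Name} (Q : Proc Name) : Red P P' → Red (.par P Q) (.par P' Q)
  | nu (z : Name) {P P' : Proc Name} : Red P P' → Red (.nu z P) (.nu z P')
  | struct {P P' Q Q' : Proc Name} :
      StructCong Q P → Red P P' → StructCong P' Q' → Red Q Q'

end Semantics

/-! ### The asynchronous pi-calculus as a sublanguage -/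

/-- Terms of the asynchronous pi-calculus (with `tick`): an output has no continuation. -/
inductive AProc (Name : Type*) where
  | nil : AProc Name
  | tick : AProc Name
  | out (x y : Name) : AProc Name
  | inp (x z : Name) (P : AProc Name) : AProc Name
  | par (P Q : AProc Name) : AProc Name
  | nu (z : Name) (P : AProc Name) : AProc Name
  | bang (P : AProc Name) : AProc Name

namespace AProc

variable {Name : Type*}

/-- The inclusion of the asynchronous fragment: `x̄y` stands for `x̄y.0`. -/
def toProc : AProc Name → Proc Name
  | nil => .nil
  | tick => .tick
  | out x y => .out x y .nil
  | inp x z P => .inp x z P.toProc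
  | par P Q => .par P.toProc Q.toProc
  | nu z P => .nu z P.toProc
  | bang P => .bang P.toProc

/-- `(w₁)⋯(wₙ)P`. -/
def nus (ws : List Name) (P : AProc Name) : AProc Name := ws.foldr nu P

/-- A plain term: a parallel composition of prefixed terms, `tick`, `nil` and replications. -/
inductive Plain : AProc Name → Prop
  | nil : Plain .nil
  | tick : Plain .tick
  | out (x y : Name) : Plain (.out x y)
  | inp (x z : Name) (P : AProc Name) : Plain (.inp x z P)
  | bang (P : AProc Name) : Plain (.bang P)
  | par {P Q : AProc Name} : Plain P → Plain Q → Plain (.par P Q)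

def Reports (P : AProc Name) : Prop := HondaTokoro.Reports P.toProc

variable [DecidableEq Name]

def fn (P : AProc Name) : Finset Name := P.toProc.fn

def bn (P : AProc Name) : Finset Name := P.toProc.bn

/-- `P{y/z}`: every free occurrence of `z` is replaced by `y`. -/
def subst (y z : Name) : AProc Name → AProc Name
  | nil => nil
  | tick => tick
  | out a b => out (if a = z then y else a) (if b = z then y else b)
  | inp a b P => inp (if a = z then y else a) b (if b = z then P else P.subst y z)
  | par P Q => par (P.subst y z) (Q.subst y z)
  | nu b P => nu b (if b = z then P else P.subst y z)
  | bang P => bang (P.subst y z)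

/-- Simultaneous capture-avoiding renaming `Pσ`. -/
noncomputable def ren [Infinite Name] : AProc Name → (Name → Name) → AProc Name
  | .nil, _ => .nil
  | .tick, _ => .tick
  | .out x y, σ => .out (σ x) (σ y)
  | .inp x z P, σ =>
      .inp (σ x) (freshName ((P.fn.erase z).image σ))
        (P.ren (Function.update σ z (freshName ((P.fn.erase z).image σ))))
  | .par P Q, σ => .par (P.ren σ) (Q.ren σ)
  | .nu z P, σ =>
      .nu (freshName ((P.fn.erase z).image σ))
        (P.ren (Function.update σ z (freshName ((P.fn.erase z).image σ))))
  | .bang P, σ => .bang (P.ren σ)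

def AlphaEq (P Q : AProc Name) : Prop := HondaTokoro.AlphaEq P.toProc Q.toProc

def StaticCong (P Q : AProc Name) : Prop := HondaTokoro.StaticCong P.toProc Q.toProc

def StructCong (P Q : AProc Name) : Prop := HondaTokoro.StructCong P.toProc Q.toProc

def Red (P Q : AProc Name) : Prop := HondaTokoro.Red P.toProc Q.toProc

/-- The inert reduction relation. -/
inductive Inert : AProc Name → AProc Name → Prop
  | com (v y z : Name) (P Q : AProc Name) (hy : y ∉ Q.bn)
      (hv : v ∉ P.fn ∪ (Q.subst y z).fn) :
      Inert (.nu v (.par (.par (.out v y) P) (.inp v z Q))) (.par P (Q.subst y z))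
  | par {P Q : AProc Name} (R : AProc Name) : Inert P Q → Inert (.par P R) (.par Q R)
  | nu (w : Name) {P Q : AProc Name} : Inert P Q → Inert (.nu w P) (.nu w Q)
  | struct {P P' Q Q' : AProc Name} :
      StructCong P P' → Inert P' Q' → StructCong Q' Q → Inert P Q

end AProc

/-! ### The Honda-Tokoro encoding -/

/-- A way of choosing the auxiliary name in the two prefix clauses of the encoding. The choice may
depend on the prefix and on the set of free names of the continuation. -/
structure FreshChoice (Name : Type*) [DecidableEq Name] where
  outName : Name → Name → Finset Name → Name
  inpName : Name → Name → Finset Name → Name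
  outName_fresh : ∀ x y N, outName x y N ∉ N ∪ {x, y}
  inpName_fresh : ∀ x z N, inpName x z N ∉ N ∪ {x}

instance {Name : Type*} [DecidableEq Name] [Infinite Name] : Nonempty (FreshChoice Name) :=
  ⟨{ outName := fun x y N => freshName (N ∪ {x, y})
     inpName := fun x _ N => freshName (N ∪ {x})
     outName_fresh := fun x y N =>
       Classical.choose_spec (Infinite.exists_notMem_finset (N ∪ {x, y}))
     inpName_fresh := fun x _ N =>
       Classical.choose_spec (Infinite.exists_notMem_finset (N ∪ {x})) }⟩

/-- `⟦x̄y.P⟧ = x(u).(ūy | ⟦P⟧)`, `⟦x(z).P⟧ = (u)(x̄u | u(z).⟦P⟧)`, homomorphic elsewhere. -/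
def enc {Name : Type*} [DecidableEq Name] (c : FreshChoice Name) : Proc Name → AProc Name
  | .nil => .nil
  | .tick => .tick
  | .out x y P =>
      .inp x (c.outName x y P.fn) (.par (.out (c.outName x y P.fn) y) (enc c P))
  | .inp x z P =>
      .nu (c.inpName x z P.fn)
        (.par (.out x (c.inpName x z P.fn)) (.inp (c.inpName x z P.fn) z (enc c P)))
  | .par P Q => .par (enc c P) (enc c Q)
  | .nu z P => .nu z (enc c P)
  | .bang P => .bang (enc c P)

/-! ### Gorla's criteria for encodings of the pi-calculus into the asynchronous pi-calculus -/

/-- The composition operators of the source language. -/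
inductive Op (Name : Type*) where
  | nil : Op Name
  | tick : Op Name
  | out (x y : Name) : Op Name
  | inp (x z : Name) : Op Name
  | par : Op Name
  | nu (z : Name) : Op Name
  | bang : Op Name

namespace Op

variable {Name : Type*}

def arity : Op Name → ℕ
  | nil => 0
  | tick => 0
  | out _ _ => 1
  | inp _ _ => 1
  | par => 2
  | nu _ => 1
  | bang => 1

def app : (o : Op Name) → (Fin o.arity → Proc Name) → Proc Name
  | nil, _ => .nil
  | tick, _ => .tick
  | out x y, S => .out x y (S (0 : Fin 1))
  | inp x z, S => .inp x z (S (0 : Fin 1))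
  | par, S => .par (S (0 : Fin 2)) (S (1 : Fin 2))
  | nu z, S => .nu z (S (0 : Fin 1))
  | bang, S => .bang (S (0 : Fin 1))

end Op

/-- Terms built from the operators of the target language and holes numbered by `Fin k`. -/
inductive ACtx (Name : Type*) (k : ℕ) where
  | hole (i : Fin k) : ACtx Name k
  | nil : ACtx Name k
  | tick : ACtx Name k
  | out (x y : Name) : ACtx Name k
  | inp (x z : Name) (C : ACtx Name k) : ACtx Name k
  | par (C D : ACtx Name k) : ACtx Name k
  | nu (z : Name) (C : ACtx Name k) : ACtx Name k
  | bang (C : ACtx Name k) : ACtx Name k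

namespace ACtx

variable {Name : Type*} {k : ℕ}

/-- The number of occurrences of a hole. -/
def count (i : Fin k) : ACtx Name k → ℕ
  | hole j => if j = i then 1 else 0
  | nil => 0
  | tick => 0
  | out _ _ => 0
  | inp _ _ C => C.count i
  | par C D => C.count i + D.count i
  | nu _ C => C.count i
  | bang C => C.count i

/-- Filling of the holes. The binders of the context bind in the terms put into the holes, as they
must for the context `(νz)_` of the operator `(νz)`. -/
def fill (T : Fin k → AProc Name) : ACtx Name k → AProc Name
  | hole i => T i
  | nil => .nil
  | tick => .tick
  | out x y => .out x y
  | inp x z C => .inp x z (C.fill T)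
  | par C D => .par (C.fill T) (D.fill T)
  | nu z C => .nu z (C.fill T)
  | bang C => .bang (C.fill T)

end ACtx

/-- Infinite reduction sequences from `P`. -/
def Diverges {α : Type*} (red : α → α → Prop) (P : α) : Prop :=
  ∃ f : ℕ → α, f 0 = P ∧ ∀ i, red (f i) (f (i + 1))

/-- `P⇓`: some reduct of `P` (in zero or more steps) reports success. -/
def MayReport {α : Type*} (red : α → α → Prop) (rep : α → Prop) (P : α) : Prop :=
  ∃ P', Relation.ReflTransGen red P P' ∧ rep P'

/-- The pair of the translation `tr` and the renaming policy `φ` is an encoding of the pi-calculus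
into the asynchronous pi-calculus with semantic equivalence `eqv`, and it is valid. Since `Pσ` is
determined up to alpha-conversion only, equality in `name_invariance` is alpha-equality. -/
structure GorlaValid {Name : Type*} [DecidableEq Name] [Infinite Name] {k : ℕ}
    (tr : Proc Name → AProc Name) (φ : Name → Fin k → Name)
    (eqv : AProc Name → AProc Name → Prop) : Prop where
  equivalence : Equivalence eqv
  policy : ∀ u v, u ≠ v → ∀ i j, φ u i ≠ φ v j
  compositionality : ∀ (o : Op Name) (N : Set Name), ∃ C : ACtx Name o.arity,
    (∀ i, C.count i = 1) ∧
    ∀ S : Fin o.arity → Proc Name, (⋃ i, ((S i).fn : Set Name)) = N →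
      tr (o.app S) = C.fill (fun i => tr (S i))
  name_invariance : ∀ (S : Proc Name) (σ : Name → Name), ∃ σ' : Name → Name,
    (∀ a i, φ (σ a) i = σ' (φ a i)) ∧
    (Function.Injective σ → (tr (S.ren σ)).AlphaEq ((tr S).ren σ')) ∧
    (¬ Function.Injective σ → eqv (tr (S.ren σ)) ((tr S).ren σ'))
  completeness : ∀ S S' : Proc Name, Relation.ReflTransGen Red S S' →
    ∃ T, Relation.ReflTransGen AProc.Red (tr S) T ∧ eqv T (tr S')
  soundness : ∀ (S : Proc Name) (T : AProc Name), Relation.ReflTransGen AProc.Red (tr S) T →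
    ∃ S', Relation.ReflTransGen Red S S' ∧
      ∃ T', Relation.ReflTransGen AProc.Red T T' ∧ eqv T' (tr S')
  divergence_reflection : ∀ S : Proc Name, Diverges AProc.Red (tr S) → Diverges Red S
  tick : tr .tick = .tick
  success_sensitiveness : ∀ S : Proc Name,
    MayReport Red Reports S ↔ MayReport AProc.Red AProc.Reports (tr S)

end HondaTokoro

set_option linter.unusedSectionVars false

namespace HondaTokoro

/-! ### Names with a distinguished fresh element -/

section Names

variable {V W : Type*} [Infinite V]

/-! Every unguarded output of an encoded term announces, on a channel `x`, the private name `u` of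
an encoded input. Every unguarded input either is an encoded output or listens on such a private
name. Since private names are fresh, an announcement on `x` can only be received by the encoding of
an output on `x`. So a step of an encoded term is always the first half of a communication of the
source. After it, `u` occurs only as the subject of one output and one input, both at top level. The
second half is therefore inert: it competes with no other reduction, and it leads to the encoding of
the source reduct.

The difficulty is inversion: a reduction may use structural congruence anywhere, and a chain of
congruences says little about the shape of its end points. First, alpha-conversion is removed: `tr`
sends a named term to its alpha-class, a `Term`, and `staticCong_iff`, `structCong_iff` and
`red_iff` transfer the relations. Whether replications may be unfolded is a parameter `b` of `SC`,
so that one development serves both congruences. Secondly, `Ext b P L R` records that the prefixes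
`L` can be taken out of `P` itself, without congruence, leaving `R`. By `SC.sim`, congruent terms
have the same extractions up to congruence of continuations and residuals, and by `Ext.sc` an
extraction can be reassembled. Hence every reduction is visible as the extraction of an output and
an input with one subject (`RedN.exists_ext`).

For the encoding, `Ext.exists_sourceExt` lifts each extraction from `encT S` to one from `S`, and
`Ext.enc_pair` applies this to a communicating pair. With `b` false this yields the decomposition,
with `b` true one-step soundness (`RedN.exists_source`). Completeness is a direct computation
(`RedN.exists_halfway`).

For many steps, `InertN.diamond` shows that inert steps commute with all others. A reduct of an
encoded term is thus always some number `n` of inert steps away from the encoding of a source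
reduct, and each further step either lowers `n` by one or advances the source (`InertIter.step`).
Soundness, divergence reflection and success sensitiveness follow. Renaming invariance holds because
the encoding of alpha-classes chooses no names at all. -/

theorem nonempty_option_equiv (V : Type*) [Infinite V] : Nonempty (Option V ≃ V) := by
  rw [← Cardinal.eq, Cardinal.mk_option]
  exact Cardinal.add_one_eq (Cardinal.aleph0_le_mk V)

/-- A scope with one more bound name can reuse the same infinite type of names, so terms under
binders need no change of type and no indices. -/
noncomputable def optionEquiv (V : Type*) [Infinite V] : Option V ≃ V :=
  Classical.choice (nonempty_option_equiv V)

/-- The name of the innermost binder. -/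
noncomputable def z0 : V := optionEquiv V none

/-- The name of a variable seen from below one more binder. -/
noncomputable def sh (a : V) : V := optionEquiv V (some a)

/-- The function sending `z0` to `v` and `sh a` to `f a`. -/
noncomputable def scons (v : W) (f : V → W) (a : V) : W := ((optionEquiv V).symm a).elim v f

@[simp] theorem scons_z0 (v : W) (f : V → W) : scons v f z0 = v := by simp [scons, z0]

@[simp] theorem scons_sh (v : W) (f : V → W) (a : V) : scons v f (sh a) = f a := by
  simp [scons, sh]

theorem name_cases (a : V) : a = z0 ∨ ∃ b, a = sh b := by
  rcases h : (optionEquiv V).symm a with _ | b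
  · left; rw [z0, ← h]; simp
  · right; refine ⟨b, ?_⟩; rw [sh, ← h]; simp

@[simp] theorem sh_inj {a b : V} : sh a = sh b ↔ a = b := by simp [sh]

theorem sh_injective : Function.Injective (sh : V → V) := fun _ _ => sh_inj.1

@[simp] theorem sh_ne_z0 (a : V) : sh a ≠ z0 := by simp [sh, z0]

@[simp] theorem z0_ne_sh (a : V) : z0 ≠ sh a := (sh_ne_z0 a).symm

theorem name_funext {f g : V → W} (h0 : f z0 = g z0) (h : ∀ a, f (sh a) = g (sh a)) : f = g := by
  funext a
  rcases name_cases a with rfl | ⟨b, rfl⟩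
  exacts [h0, h b]

/-- The action of a renaming below a binder. -/
noncomputable def lift (f : V → V) : V → V := scons z0 (sh ∘ f)

@[simp] theorem lift_z0 (f : V → V) : lift f z0 = z0 := by simp [lift]

@[simp] theorem lift_sh (f : V → V) (a : V) : lift f (sh a) = sh (f a) := by simp [lift]

theorem lift_comp (g f : V → V) : lift g ∘ lift f = lift (g ∘ f) :=
  name_funext (by simp) (by simp)

@[simp] theorem lift_id : lift (id : V → V) = id := name_funext (by simp) (by simp)

/-- Exchange of the two innermost binders. -/
noncomputable def swp : V → V := scons (sh z0) (scons z0 (sh ∘ sh))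

@[simp] theorem swp_z0 : swp (z0 : V) = sh z0 := by simp [swp]

@[simp] theorem swp_sh_z0 : swp (sh z0 : V) = z0 := by simp [swp]

@[simp] theorem swp_sh_sh (a : V) : swp (sh (sh a)) = sh (sh a) := by simp [swp]

theorem swp_swp : (swp : V → V) ∘ swp = id := by
  refine name_funext (by simp) fun a => ?_
  rcases name_cases a with rfl | ⟨b, rfl⟩ <;> simp

section Close

variable [DecidableEq V]

/-- Turning the free name `a` into the innermost bound one. -/
noncomputable def cl (a : V) : V → V := Function.update sh a z0

@[simp] theorem cl_self (a : V) : cl a a = z0 := by simp [cl]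

theorem cl_of_ne {a b : V} (h : b ≠ a) : cl a b = sh b := by simp [cl, h]

theorem cl_eq_sh_iff {a b c : V} : cl a b = sh c ↔ b = c ∧ b ≠ a := by
  by_cases h : b = a
  · subst h; simp
  · simp [cl_of_ne h, h]

theorem cl_eq_z0_iff {a b : V} : cl a b = z0 ↔ b = a := by
  by_cases h : b = a
  · simp [h]
  · simp [cl_of_ne h, h]

theorem scons_comp_cl (a : V) (f : V → W) (w : W) :
    scons w f ∘ cl a = Function.update f a w := by
  funext b
  by_cases h : b = a
  · simp [h]
  · simp [cl_of_ne h, h]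

/-- Without injectivity a second name sent to `f a` would be captured on the left but not on the
right. -/
theorem cl_comp_of_injective {f : V → V} (hf : Function.Injective f) (a : V) :
    cl (f a) ∘ f = lift f ∘ cl a := by
  funext b
  by_cases h : b = a
  · simp [h]
  · simp [cl_of_ne h, cl_of_ne (hf.ne h)]

end Close

end Names

/-! ### Terms up to alpha-conversion -/

/-- Terms in which a binder is not named: below it, the bound name is `z0` and every other name `a`
is `sh a`. -/
inductive Term (V : Type*) where
  | nil : Term V
  | tick : Term V
  | out (x y : V) (P : Term V) : Term V
  | inp (x : V) (P : Term V) : Term V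
  | par (P Q : Term V) : Term V
  | nu (P : Term V) : Term V
  | bang (P : Term V) : Term V

namespace Term

variable {V : Type*} [Infinite V]

noncomputable def ren : Term V → (V → V) → Term V
  | nil, _ => nil
  | tick, _ => tick
  | out x y P, f => out (f x) (f y) (P.ren f)
  | inp x P, f => inp (f x) (P.ren (lift f))
  | par P Q, f => par (P.ren f) (Q.ren f)
  | nu P, f => nu (P.ren (lift f))
  | bang P, f => bang (P.ren f)

def fn : Term V → Set V
  | nil => ∅
  | tick => ∅
  | out x y P => {x, y} ∪ P.fn
  | inp x P => {x} ∪ sh ⁻¹' P.fn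
  | par P Q => P.fn ∪ Q.fn
  | nu P => sh ⁻¹' P.fn
  | bang P => P.fn

theorem fn_finite (P : Term V) : P.fn.Finite := by
  induction P with
  | nil => exact Set.finite_empty
  | tick => exact Set.finite_empty
  | out x y P ih => exact (Set.toFinite _).union ih
  | inp x P ih => exact (Set.toFinite _).union (ih.preimage sh_injective.injOn)
  | par P Q ih1 ih2 => exact ih1.union ih2
  | nu P ih => exact ih.preimage sh_injective.injOn
  | bang P ih => exact ih

theorem ren_congr {P : Term V} {f g : V → V} (h : ∀ a ∈ P.fn, f a = g a) : P.ren f = P.ren g := by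
  induction P generalizing f g with
  | nil => rfl
  | tick => rfl
  | out x y P ih =>
    simp only [ren, fn] at *
    rw [h x (by simp), h y (by simp), ih fun a ha => h a (.inr ha)]
  | inp x P ih =>
    simp only [ren, fn] at *
    rw [h x (by simp), ih (g := lift g)]
    intro a ha
    rcases name_cases a with rfl | ⟨b, rfl⟩
    · simp
    · simp [h b (.inr ha)]
  | par P Q ih1 ih2 =>
    simp only [ren, fn] at *
    rw [ih1 fun a ha => h a (.inl ha), ih2 fun a ha => h a (.inr ha)]
  | nu P ih =>
    simp only [ren, fn] at *
    rw [ih (g := lift g)]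
    intro a ha
    rcases name_cases a with rfl | ⟨b, rfl⟩
    · simp
    · simp [h b ha]
  | bang P ih =>
    simp only [ren, fn] at *
    rw [ih h]

@[simp] theorem ren_id (P : Term V) : P.ren id = P := by
  induction P <;> simp_all [ren]

theorem ren_eq_self {P : Term V} {f : V → V} (h : ∀ a ∈ P.fn, f a = a) : P.ren f = P := by
  conv_rhs => rw [← ren_id P]
  exact ren_congr h

theorem ren_ren (P : Term V) (f g : V → V) : (P.ren f).ren g = P.ren (g ∘ f) := by
  induction P generalizing f g <;> simp_all [ren, lift_comp]

theorem mem_fn_ren {P : Term V} {f : V → V} {a : V} :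
    a ∈ (P.ren f).fn ↔ ∃ b ∈ P.fn, f b = a := by
  have key : ∀ (P : Term V) (f : V → V) (a : V),
      (∃ b ∈ P.fn, lift f b = sh a) ↔ ∃ b, sh b ∈ P.fn ∧ f b = a := by
    intro P f a
    constructor
    · rintro ⟨b, hb, h⟩
      rcases name_cases b with rfl | ⟨c, rfl⟩
      · simp at h
      · exact ⟨c, hb, by simpa using h⟩
    · rintro ⟨b, hb, h⟩
      exact ⟨sh b, hb, by simp [h]⟩
  induction P generalizing f a with
  | nil => simp [ren, fn]
  | tick => simp [ren, fn]
  | out x y P ih => simp [ren, fn, ih, or_and_right, exists_or, eq_comm]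
  | inp x P ih => simp [ren, fn, ih, key, or_and_right, exists_or, eq_comm]
  | par P Q ih1 ih2 => simp [ren, fn, ih1, ih2, or_and_right, exists_or]
  | nu P ih => simp [ren, fn, ih, key]
  | bang P ih => simp [ren, fn, ih]

theorem fn_ren (P : Term V) (f : V → V) : (P.ren f).fn = f '' P.fn := by
  ext a; simp [mem_fn_ren]

theorem mem_fn_ren_of_injective {P : Term V} {f : V → V} (hf : Function.Injective f) {a : V} :
    f a ∈ (P.ren f).fn ↔ a ∈ P.fn := by
  rw [mem_fn_ren]
  exact ⟨fun ⟨b, hb, h⟩ => hf h ▸ hb, fun h => ⟨a, h, rfl⟩⟩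

/-- Instantiation of the innermost bound name. -/
noncomputable def inst (v : V) (P : Term V) : Term V := P.ren (scons v id)

@[simp] theorem inst_ren_sh (P : Term V) (v : V) : (P.ren sh).inst v = P := by
  rw [inst, ren_ren, show scons v id ∘ sh = (id : V → V) from by funext a; simp, ren_id]

theorem inst_ren_lift (P : Term V) (f : V → V) (v : V) :
    (P.ren (lift f)).inst v = P.ren (scons v f) := by
  rw [inst, ren_ren]
  congr 1
  exact name_funext (by simp) (by simp)

theorem ren_inst (P : Term V) (f : V → V) (v : V) :
    (P.inst v).ren f = (P.ren (lift f)).inst (f v) := by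
  rw [inst_ren_lift, inst, ren_ren]
  congr 1
  exact name_funext (by simp) (by simp)

theorem mem_fn_inst {P : Term V} {v a : V} :
    a ∈ (P.inst v).fn ↔ sh a ∈ P.fn ∨ (a = v ∧ z0 ∈ P.fn) := by
  rw [inst, mem_fn_ren]
  constructor
  · rintro ⟨b, hb, h⟩
    rcases name_cases b with rfl | ⟨c, rfl⟩
    · exact .inr ⟨by simpa using h.symm, hb⟩
    · left; simpa [← h] using hb
  · rintro (h | ⟨rfl, h⟩)
    · exact ⟨_, h, by simp⟩
    · exact ⟨_, h, by simp⟩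

theorem inst_eq_inst {P : Term V} (h : z0 ∉ P.fn) (v w : V) : P.inst v = P.inst w := by
  refine ren_congr fun a ha => ?_
  rcases name_cases a with rfl | ⟨b, rfl⟩
  · exact absurd ha h
  · simp

variable [DecidableEq V]

theorem inst_ren_cl (P : Term V) (a v : V) :
    (P.ren (cl a)).inst v = P.ren (Function.update id a v) := by
  rw [inst, ren_ren, scons_comp_cl]

@[simp] theorem inst_ren_cl_self (P : Term V) (a : V) : (P.ren (cl a)).inst a = P := by
  rw [inst_ren_cl, show Function.update id a a = id from Function.update_eq_self a id, ren_id]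

/-- Freshness of `v` makes opening a binder and closing it again mutually inverse; in this way
nameless binders receive temporary names. -/
theorem ren_cl_inst {P : Term V} {v : V} (h : sh v ∉ P.fn) : (P.inst v).ren (cl v) = P := by
  rw [inst, ren_ren]
  refine ren_eq_self fun a ha => ?_
  rcases name_cases a with rfl | ⟨b, rfl⟩
  · simp
  · simp [cl_of_ne (show b ≠ v from fun e => h (e ▸ ha))]

theorem ren_cl_eq_ren_sh {P : Term V} {a : V} (h : a ∉ P.fn) : P.ren (cl a) = P.ren sh :=
  ren_congr fun _ hb => cl_of_ne fun e => h (e ▸ hb)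

theorem sh_mem_fn_ren_cl {P : Term V} {a b : V} : sh b ∈ (P.ren (cl a)).fn ↔ b ∈ P.fn ∧ b ≠ a := by
  simp only [mem_fn_ren, cl_eq_sh_iff]
  constructor
  · rintro ⟨c, hc, rfl, h⟩; exact ⟨hc, h⟩
  · rintro ⟨h1, h2⟩; exact ⟨b, h1, rfl, h2⟩

theorem z0_mem_fn_ren_cl {P : Term V} {a : V} : z0 ∈ (P.ren (cl a)).fn ↔ a ∈ P.fn := by
  simp [mem_fn_ren, cl_eq_z0_iff]

/-- Restriction of the free name `a`. -/
noncomputable def nuA (a : V) (P : Term V) : Term V := nu (P.ren (cl a))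

theorem fn_nuA (a : V) (P : Term V) : (nuA a P).fn = P.fn \ {a} := by
  ext b; simp [nuA, fn, sh_mem_fn_ren_cl]

theorem nuA_inst {P : Term V} {v : V} (h : v ∉ (nu P).fn) : nuA v (P.inst v) = nu P := by
  rw [nuA, ren_cl_inst h]

theorem ren_nuA {f : V → V} (hf : Function.Injective f) (a : V) (P : Term V) :
    (nuA a P).ren f = nuA (f a) (P.ren f) := by
  simp [nuA, ren, ren_ren, cl_comp_of_injective hf]

noncomputable def nuAs (ws : List V) (P : Term V) : Term V := ws.foldr nuA P

@[simp] theorem nuAs_nil (P : Term V) : nuAs [] P = P := rfl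

@[simp] theorem nuAs_cons (w : V) (ws : List V) (P : Term V) :
    nuAs (w :: ws) P = nuA w (nuAs ws P) := rfl

theorem nuAs_append (ws ws' : List V) (P : Term V) :
    nuAs (ws ++ ws') P = nuAs ws (nuAs ws' P) := by
  simp [nuAs]

theorem mem_fn_nuAs {ws : List V} {P : Term V} {a : V} :
    a ∈ (nuAs ws P).fn ↔ a ∈ P.fn ∧ a ∉ ws := by
  induction ws with
  | nil => simp
  | cons w ws ih => simp [fn_nuA, ih]; tauto

theorem ren_nuAs {f : V → V} (hf : Function.Injective f) (ws : List V) (P : Term V) :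
    (nuAs ws P).ren f = nuAs (ws.map f) (P.ren f) := by
  induction ws with
  | nil => rfl
  | cons w ws ih => simp [ren_nuA hf, ih]

end Term


/-! ### The alpha-class of a named term -/

section Trans

variable {V : Type*} [Infinite V] [DecidableEq V]

/-- The alpha-class of a term. -/
noncomputable def tr : Proc V → Term V
  | .nil => .nil
  | .tick => .tick
  | .out x y P => .out x y (tr P)
  | .inp x z P => .inp x ((tr P).ren (cl z))
  | .par P Q => .par (tr P) (tr Q)
  | .nu z P => .nuA z (tr P)
  | .bang P => .bang (tr P)

theorem fn_tr (P : Proc V) : (tr P).fn = P.fn := by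
  induction P with
  | nil => simp [tr, Term.fn, Proc.fn]
  | tick => simp [tr, Term.fn, Proc.fn]
  | out x y P ih => simp [tr, Term.fn, Proc.fn, ih, Set.insert_union]
  | inp x z P ih =>
    ext a
    simp [tr, Term.fn, Proc.fn, Term.sh_mem_fn_ren_cl, ih, and_comm]
  | par P Q ih1 ih2 => simp [tr, Term.fn, Proc.fn, ih1, ih2]
  | nu z P ih => simp [tr, Term.fn_nuA, Proc.fn, ih]
  | bang P ih => simp [tr, Term.fn, Proc.fn, ih]

theorem mem_fn_tr {P : Proc V} {a : V} : a ∈ (tr P).fn ↔ a ∈ P.fn := by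
  rw [fn_tr]; rfl

theorem freshName_notMem (s : Finset V) : freshName s ∉ s :=
  Classical.choose_spec (Infinite.exists_notMem_finset s)

/-- The name `w` chosen for a binder disappears when it is closed again, provided that no other free
name is sent to it. This is the common core of capture-avoiding renaming and of the alpha rules. -/
theorem ren_update_cl {t : Term V} {σ : V → V} {z w : V} (h : ∀ a ∈ t.fn, a ≠ z → σ a ≠ w) :
    (t.ren (Function.update σ z w)).ren (cl w) = (t.ren (cl z)).ren (lift σ) := by
  rw [Term.ren_ren, Term.ren_ren]
  refine Term.ren_congr fun a ha => ?_
  by_cases haz : a = z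
  · subst haz; simp
  · simp [haz, cl_of_ne haz, cl_of_ne (h a ha haz)]

theorem tr_ren (P : Proc V) (σ : V → V) : tr (P.ren σ) = (tr P).ren σ := by
  have key : ∀ (P : Proc V) (z : V) (σ : V → V), ∀ a ∈ (tr P).fn, a ≠ z →
      σ a ≠ freshName ((P.fn.erase z).image σ) := by
    intro P z σ a ha haz h
    refine freshName_notMem ((P.fn.erase z).image σ) ?_
    rw [← h]
    exact Finset.mem_image_of_mem _ (Finset.mem_erase.2 ⟨haz, mem_fn_tr.1 ha⟩)
  induction P generalizing σ with
  | nil => simp [Proc.ren, tr, Term.ren]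
  | tick => simp [Proc.ren, tr, Term.ren]
  | out x y P ih => simp [Proc.ren, tr, Term.ren, ih]
  | inp x z P ih => simp [Proc.ren, tr, Term.ren, ih, ren_update_cl (key P z σ)]
  | par P Q ih1 ih2 => simp [Proc.ren, tr, Term.ren, ih1, ih2]
  | nu z P ih => simp [Proc.ren, tr, Term.nuA, Term.ren, ih, ren_update_cl (key P z σ)]
  | bang P ih => simp [Proc.ren, tr, Term.ren, ih]

/-- As `y` is not a binder of `P`, literal replacement captures nothing; below a binder equal to `z`
both sides leave `z` alone. -/
theorem tr_subst {P : Proc V} {y z : V} (hy : y ∉ P.bn) :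
    tr (P.subst y z) = (tr P).ren (Function.update id z y) := by
  have key : ∀ (P : Proc V) (b : V), y ≠ b →
      (y ∉ P.bn → tr (P.subst y z) = (tr P).ren (Function.update id z y)) → y ∉ P.bn →
      (tr (if b = z then P else P.subst y z)).ren (cl b) =
        ((tr P).ren (cl b)).ren (lift (Function.update id z y)) := by
    intro P b hyb ih hP
    by_cases hb : b = z
    · subst hb
      rw [if_pos rfl, Term.ren_ren]
      refine Term.ren_congr fun a _ => ?_
      by_cases ha : a = b
      · simp [ha]
      · simp [cl_of_ne ha, ha]
    · rw [if_neg hb, ih hP, Term.ren_ren, Term.ren_ren]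
      refine Term.ren_congr fun a _ => ?_
      by_cases ha : a = z
      · subst ha; simp [cl_of_ne hyb, cl_of_ne (Ne.symm hb)]
      · by_cases hab : a = b
        · subst hab; simp [ha]
        · simp [ha, cl_of_ne hab]
  induction P with
  | nil => simp [Proc.subst, tr, Term.ren]
  | tick => simp [Proc.subst, tr, Term.ren]
  | out a b P ih =>
    simp only [Proc.subst, tr, Term.ren, ih hy, Function.update_apply, id]
  | inp a b P ih =>
    simp only [Proc.bn, Finset.mem_union, Finset.mem_singleton, not_or] at hy
    simp only [Proc.subst, tr, Term.ren, key P b hy.1 ih hy.2, Function.update_apply, id]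
  | par P Q ih1 ih2 =>
    simp only [Proc.bn, Finset.mem_union, not_or] at hy
    simp only [Proc.subst, tr, Term.ren, ih1 hy.1, ih2 hy.2]
  | nu b P ih =>
    simp only [Proc.bn, Finset.mem_union, Finset.mem_singleton, not_or] at hy
    simp only [Proc.subst, tr, Term.ren, Term.nuA, key P b hy.1 ih hy.2]
  | bang P ih => simp only [Proc.subst, tr, Term.ren, ih hy]

theorem tr_subst_of_notMem_names {P : Proc V} {z w : V} (hw : w ∉ P.names) :
    (tr (P.subst w z)).ren (cl w) = (tr P).ren (cl z) := by
  simp only [Proc.names, Finset.mem_union, not_or] at hw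
  rw [tr_subst hw.2, ren_update_cl, lift_id, Term.ren_id]
  rintro a ha - rfl
  exact hw.1 (mem_fn_tr.1 ha)

theorem AlphaRule.tr_eq {P Q : Proc V} (h : AlphaRule P Q) : tr P = tr Q := by
  cases h with
  | nu z w P hw => simp only [tr, Term.nuA, tr_subst_of_notMem_names hw]
  | inp x z w P hw => simp only [tr, tr_subst_of_notMem_names hw]

/-- A measure unaffected by substitution: after a change of bound name the body is no longer a
subterm, but it keeps its size. -/
def Proc.size : Proc V → ℕ
  | .nil => 0
  | .tick => 0
  | .out _ _ P => P.size + 1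
  | .inp _ _ P => P.size + 1
  | .par P Q => P.size + Q.size + 1
  | .nu _ P => P.size + 1
  | .bang P => P.size + 1

theorem Proc.size_subst (P : Proc V) (y z : V) : (P.subst y z).size = P.size := by
  induction P with
  | inp a b P ih => simp only [Proc.subst, Proc.size]; split_ifs <;> simp [ih]
  | nu b P ih => simp only [Proc.subst, Proc.size]; split_ifs <;> simp [ih]
  | _ => simp_all [Proc.subst, Proc.size]

/-- Two binders with the same closed body are renamed to one name fresh for both, and the induction
on size goes on with the bodies. The relation `r` is arbitrary because alpha-conversion is also
needed inside the two structural congruences. -/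
theorem cong_alphaRule_of_tr_eq {r : Proc V → Proc V → Prop} (hr : ∀ P Q, AlphaRule P Q → r P Q)
    {P Q : Proc V} (h : tr P = tr Q) : Cong r P Q := by
  induction hn : P.size using Nat.strong_induction_on generalizing P Q with
  | _ n ih =>
  subst hn
  have key : ∀ (P Q : Proc V) (z w v : V), v ∉ P.names ∪ Q.names →
      (tr P).ren (cl z) = (tr Q).ren (cl w) → tr (P.subst v z) = tr (Q.subst v w) := by
    intro P Q z w v hv h
    rw [Finset.mem_union, not_or] at hv
    rw [← Term.inst_ren_cl_self (tr (P.subst v z)) v, ← Term.inst_ren_cl_self (tr (Q.subst v w)) v,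
      tr_subst_of_notMem_names hv.1, tr_subst_of_notMem_names hv.2, h]
  cases P with
  | nil => cases Q <;> simp [tr, Term.nuA] at h; exact .refl _
  | tick => cases Q <;> simp [tr, Term.nuA] at h; exact .refl _
  | out x y P =>
    cases Q <;> simp [tr, Term.nuA] at h
    obtain ⟨rfl, rfl, h⟩ := h
    exact .out _ _ (ih _ (by simp [Proc.size]) h rfl)
  | inp x z P =>
    cases Q <;> simp [tr, Term.nuA] at h
    rename_i x' w Q
    obtain ⟨rfl, h⟩ := h
    obtain ⟨v, hv⟩ := Infinite.exists_notMem_finset (P.names ∪ Q.names)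
    have h' := key P Q z w v hv h
    rw [Finset.mem_union, not_or] at hv
    refine .trans (.rule (hr _ _ (.inp x z v P hv.1))) (.trans (.inp _ _ ?_)
      (.symm (.rule (hr _ _ (.inp x w v Q hv.2)))))
    exact ih _ (by simp [Proc.size, Proc.size_subst]) h' rfl
  | par P1 P2 =>
    cases Q <;> simp [tr, Term.nuA] at h
    exact .par (ih _ (by simp only [Proc.size]; omega) h.1 rfl) (ih _ (by simp only [Proc.size]; omega) h.2 rfl)
  | nu z P =>
    cases Q <;> simp [tr, Term.nuA] at h
    rename_i w Q
    obtain ⟨v, hv⟩ := Infinite.exists_notMem_finset (P.names ∪ Q.names)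
    have h' := key P Q z w v hv h
    rw [Finset.mem_union, not_or] at hv
    refine .trans (.rule (hr _ _ (.nu z v P hv.1))) (.trans (.nu _ ?_)
      (.symm (.rule (hr _ _ (.nu w v Q hv.2)))))
    exact ih _ (by simp [Proc.size, Proc.size_subst]) h' rfl
  | bang P =>
    cases Q <;> simp [tr, Term.nuA] at h
    exact .bang (ih _ (by simp [Proc.size]) h rfl)

theorem alphaEq_of_tr_eq {P Q : Proc V} (h : tr P = tr Q) : AlphaEq P Q :=
  cong_alphaRule_of_tr_eq (fun _ _ => id) h

/-- The terms without output continuations. -/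
def Term.Async : Term V → Prop
  | .nil => True
  | .tick => True
  | .out _ _ P => P = .nil
  | .inp _ P => P.Async
  | .par P Q => P.Async ∧ Q.Async
  | .nu P => P.Async
  | .bang P => P.Async

theorem Term.Async.ren {t : Term V} (h : t.Async) (f : V → V) : (t.ren f).Async := by
  induction t generalizing f with
  | out x y P => simp_all [Term.Async, Term.ren]
  | _ => simp_all [Term.Async, Term.ren]

theorem Term.exists_notMem (A : Set V) (hA : A.Finite) (t : Term V) : ∃ v, v ∉ A ∧ v ∉ t.fn := by
  obtain ⟨v, hv⟩ := (hA.union t.fn_finite).infinite_compl.nonempty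
  exact ⟨v, fun h => hv (.inl h), fun h => hv (.inr h)⟩

/-- Representatives can be chosen with binders off any finite set, so that the side conditions of
the named rules can be met, and asynchronous classes have asynchronous representatives. -/
theorem exists_tr_eq (t : Term V) {A : Set V} (hA : A.Finite) :
    ∃ P : Proc V, tr P = t ∧ (∀ a ∈ P.bn, a ∉ A) ∧ (t.Async → ∃ Q : AProc V, Q.toProc = P) := by
  -- Below a binder the induction hypothesis is needed for the body instantiated with the chosen
  -- name, hence the claim for all renamings of `t`.
  have gen : ∀ σ : V → V, ∃ P : Proc V, tr P = t.ren σ ∧ (∀ a ∈ P.bn, a ∉ A) ∧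
      (t.Async → ∃ Q : AProc V, Q.toProc = P) := by
    have key : ∀ (t : Term V) (σ : V → V), ∃ v, v ∉ A ∧
        (t.ren (scons v σ)).ren (cl v) = t.ren (lift σ) := by
      intro t σ
      obtain ⟨v, hv, hv'⟩ := Term.exists_notMem A hA (.nu (t.ren (lift σ)))
      refine ⟨v, hv, ?_⟩
      rw [← Term.inst_ren_lift]
      exact Term.ren_cl_inst hv'
    induction t with
    | nil => exact fun σ => ⟨.nil, rfl, by simp [Proc.bn], fun _ => ⟨.nil, rfl⟩⟩
    | tick => exact fun σ => ⟨.tick, rfl, by simp [Proc.bn], fun _ => ⟨.tick, rfl⟩⟩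
    | out x y t ih =>
      intro σ
      obtain ⟨P, hP, hA, hQ⟩ := ih σ
      by_cases ht : t = .nil
      · subst ht
        exact ⟨.out (σ x) (σ y) .nil, rfl, by simp [Proc.bn], fun _ => ⟨.out (σ x) (σ y), rfl⟩⟩
      · exact ⟨.out (σ x) (σ y) P, by simp [tr, Term.ren, hP], by simpa [Proc.bn] using hA,
          fun h => absurd h ht⟩
    | inp x t ih =>
      intro σ
      obtain ⟨v, hv, h⟩ := key t σ
      obtain ⟨P, hP, hA, hQ⟩ := ih (scons v σ)
      refine ⟨.inp (σ x) v P, by simp [tr, Term.ren, hP, h], by simpa [Proc.bn, hv] using hA,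
        fun ht => ?_⟩
      obtain ⟨Q, rfl⟩ := hQ ht
      exact ⟨.inp (σ x) v Q, rfl⟩
    | par t s ih1 ih2 =>
      intro σ
      obtain ⟨P, hP, hA, hQ⟩ := ih1 σ
      obtain ⟨P', hP', hA', hQ'⟩ := ih2 σ
      refine ⟨.par P P', by simp [tr, Term.ren, hP, hP'], ?_, fun ht => ?_⟩
      · intro a ha
        rcases Finset.mem_union.1 ha with h | h
        exacts [hA a h, hA' a h]
      · obtain ⟨Q, rfl⟩ := hQ ht.1
        obtain ⟨Q', rfl⟩ := hQ' ht.2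
        exact ⟨.par Q Q', rfl⟩
    | nu t ih =>
      intro σ
      obtain ⟨v, hv, h⟩ := key t σ
      obtain ⟨P, hP, hA, hQ⟩ := ih (scons v σ)
      refine ⟨.nu v P, by simp [tr, Term.nuA, Term.ren, hP, h], by simpa [Proc.bn, hv] using hA,
        fun ht => ?_⟩
      obtain ⟨Q, rfl⟩ := hQ ht
      exact ⟨.nu v Q, rfl⟩
    | bang t ih =>
      intro σ
      obtain ⟨P, hP, hA, hQ⟩ := ih σ
      refine ⟨.bang P, by simp [tr, Term.ren, hP], by simpa [Proc.bn] using hA, fun ht => ?_⟩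
      obtain ⟨Q, rfl⟩ := hQ ht
      exact ⟨.bang Q, rfl⟩
  simpa using gen id

end Trans

/-! ### Structural congruence on alpha-classes -/

/-- Structural congruence; the rule for replication is available if `b` holds. -/
inductive SC {V : Type*} [Infinite V] (b : Prop) : Term V → Term V → Prop
  | refl (P : Term V) : SC b P P
  | symm {P Q : Term V} : SC b P Q → SC b Q P
  | trans {P Q R : Term V} : SC b P Q → SC b Q R → SC b P R
  | out (x y : V) {P P' : Term V} : SC b P P' → SC b (.out x y P) (.out x y P')
  | inp (x : V) {P P' : Term V} : SC b P P' → SC b (.inp x P) (.inp x P')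
  | par {P P' Q Q' : Term V} : SC b P P' → SC b Q Q' → SC b (.par P Q) (.par P' Q')
  | nu {P P' : Term V} : SC b P P' → SC b (.nu P) (.nu P')
  | bang {P P' : Term V} : SC b P P' → SC b (.bang P) (.bang P')
  | assoc (P Q R : Term V) : SC b (.par P (.par Q R)) (.par (.par P Q) R)
  | comm (P Q : Term V) : SC b (.par P Q) (.par Q P)
  | unit (P : Term V) : SC b (.par P .nil) P
  | nuNil : SC b (.nu .nil) .nil
  | nuComm (P : Term V) : SC b (.nu (.nu P)) (.nu (.nu (P.ren swp)))
  | scope (P Q : Term V) : SC b (.nu (.par (P.ren sh) Q)) (.par P (.nu Q))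
  | unfold (P : Term V) (hb : b) : SC b (.bang P) (.par P (.bang P))

namespace SC

variable {V : Type*} [Infinite V] {b : Prop} {P Q R P' Q' : Term V}

/-- The side conditions of the named rules have turned into `sh` and `swp`, with which lifted
renamings commute; so `f` need not be injective. -/
theorem ren (h : SC b P Q) (f : V → V) : SC b (P.ren f) (Q.ren f) := by
  induction h generalizing f with
  | refl P => exact .refl _
  | symm _ ih => exact (ih f).symm
  | trans _ _ ih1 ih2 => exact (ih1 f).trans (ih2 f)
  | out x y _ ih => exact .out _ _ (ih f)
  | inp x _ ih => exact .inp _ (ih _)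
  | par _ _ ih1 ih2 => exact .par (ih1 f) (ih2 f)
  | nu _ ih => exact .nu (ih _)
  | bang _ ih => exact .bang (ih f)
  | assoc P Q R => exact .assoc _ _ _
  | comm P Q => exact .comm _ _
  | unit P => exact .unit _
  | nuNil => exact .nuNil
  | nuComm P =>
    have h : swp ∘ lift (lift f) = lift (lift f) ∘ swp := by
      refine name_funext (by simp) fun a => ?_
      rcases name_cases a with rfl | ⟨a, rfl⟩ <;> simp
    have := SC.nuComm (b := b) (P.ren (lift (lift f)))
    simpa only [Term.ren, Term.ren_ren, h] using this
  | scope P Q =>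
    have h : lift f ∘ sh = sh ∘ f := by funext a; simp
    have := SC.scope (b := b) (P.ren f) (Q.ren (lift f))
    simpa only [Term.ren, Term.ren_ren, h] using this
  | unfold P hb => exact .unfold _ hb

theorem fn_eq (h : SC b P Q) : P.fn = Q.fn := by
  induction h with
  | refl P => rfl
  | symm _ ih => exact ih.symm
  | trans _ _ ih1 ih2 => exact ih1.trans ih2
  | out x y _ ih => simp [Term.fn, ih]
  | inp x _ ih => simp [Term.fn, ih]
  | par _ _ ih1 ih2 => simp [Term.fn, ih1, ih2]
  | nu _ ih => simp [Term.fn, ih]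
  | bang _ ih => simp [Term.fn, ih]
  | assoc P Q R => simp [Term.fn, Set.union_assoc]
  | comm P Q => simp [Term.fn, Set.union_comm]
  | unit P => simp [Term.fn]
  | nuNil => simp [Term.fn]
  | nuComm P =>
    ext a
    simp only [Term.fn, Set.mem_preimage, Term.mem_fn_ren]
    constructor
    · intro h; exact ⟨_, h, by simp⟩
    · rintro ⟨c, hc, h⟩
      rcases name_cases c with rfl | ⟨c, rfl⟩
      · simp at h
      · rcases name_cases c with rfl | ⟨c, rfl⟩
        · simp at h
        · simpa [← (show c = a by simpa using h)] using hc
  | scope P Q =>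
    ext a
    simp [Term.fn, Term.mem_fn_ren]
  | unfold P hb => simp [Term.fn]

theorem inst (h : SC b P Q) (v : V) : SC b (P.inst v) (Q.inst v) := h.ren _

theorem parl (h : SC b P P') (Q : Term V) : SC b (.par P Q) (.par P' Q) := h.par (.refl _)

theorem parr (h : SC b Q Q') (P : Term V) : SC b (.par P Q) (.par P Q') := SC.par (.refl _) h

theorem unit' (P : Term V) : SC b (.par .nil P) P := (SC.comm _ _).trans (.unit _)

theorem parComm4 (P Q P' Q' : Term V) :
    SC b (.par (.par P Q) (.par P' Q')) (.par (.par P P') (.par Q Q')) := by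
  refine (SC.assoc _ _ _).trans (.trans (.parl ?_ _) (SC.assoc _ _ _).symm)
  exact (SC.assoc _ _ _).symm.trans ((SC.parr (.comm _ _) _).trans (.assoc _ _ _))

theorem parRight (P Q R : Term V) : SC b (.par (.par P Q) R) (.par (.par P R) Q) :=
  (SC.assoc _ _ _).symm.trans ((SC.parr (.comm _ _) _).trans (.assoc _ _ _))

variable [DecidableEq V]

theorem nuA (h : SC b P Q) (a : V) : SC b (P.nuA a) (Q.nuA a) := .nu (h.ren _)

theorem nuAs (h : SC b P Q) (ws : List V) : SC b (P.nuAs ws) (Q.nuAs ws) := by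
  induction ws with
  | nil => exact h
  | cons w ws ih => exact ih.nuA w

theorem nuA_scope {a : V} (h : a ∉ P.fn) (Q : Term V) :
    SC b ((Term.par P Q).nuA a) (.par P (Q.nuA a)) := by
  have := SC.scope (b := b) P (Q.ren (cl a))
  rwa [← Term.ren_cl_eq_ren_sh h] at this

theorem nuA_scope' {a : V} (h : a ∉ P.fn) (Q : Term V) :
    SC b ((Term.par Q P).nuA a) (.par (Q.nuA a) P) :=
  ((SC.comm _ _).nuA a).trans ((nuA_scope h Q).trans (.comm _ _))

theorem nuA_of_notMem {a : V} (h : a ∉ P.fn) : SC b (P.nuA a) P :=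
  ((SC.unit P).symm.nuA a).trans ((nuA_scope h _).trans (.trans (.parr .nuNil _) (.unit P)))

theorem nuA_comm (a c : V) (P : Term V) : SC b ((P.nuA c).nuA a) ((P.nuA a).nuA c) := by
  by_cases hac : a = c
  · subst hac; exact .refl _
  · have := SC.nuComm (b := b) ((P.ren (cl c)).ren (lift (cl a)))
    have h : swp ∘ lift (cl a) ∘ cl c = lift (cl c) ∘ cl a := by
      funext d
      by_cases hdc : d = c
      · subst hdc; simp [cl_of_ne (Ne.symm hac)]
      · by_cases hda : d = a
        · subst hda; simp [cl_of_ne hac]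
        · simp [cl_of_ne hdc, cl_of_ne hda]
    simpa only [Term.nuA, Term.ren, Term.ren_ren, h] using this

theorem nuA_nuAs (a : V) (ws : List V) (P : Term V) :
    SC b ((P.nuAs ws).nuA a) ((P.nuA a).nuAs ws) := by
  induction ws with
  | nil => exact .refl _
  | cons w ws ih => exact (nuA_comm _ _ _).trans (ih.nuA w)

theorem nuAs_scope {ws : List V} (h : ∀ w ∈ ws, w ∉ P.fn) (Q : Term V) :
    SC b ((Term.par P Q).nuAs ws) (.par P (Q.nuAs ws)) := by
  induction ws with
  | nil => exact .refl _
  | cons w ws ih =>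
    exact ((ih fun v hv => h v (by simp [hv])).nuA w).trans (nuA_scope (h w (by simp)) _)

theorem nuAs_scope' {ws : List V} (h : ∀ w ∈ ws, w ∉ P.fn) (Q : Term V) :
    SC b ((Term.par Q P).nuAs ws) (.par (Q.nuAs ws) P) :=
  ((SC.comm _ _).nuAs ws).trans ((nuAs_scope h Q).trans (.comm _ _))

theorem nuAs_of_notMem {ws : List V} (h : ∀ w ∈ ws, w ∉ P.fn) : SC b (P.nuAs ws) P := by
  induction ws with
  | nil => exact .refl _
  | cons w ws ih =>
    exact ((ih fun v hv => h v (by simp [hv])).nuA w).trans (nuA_of_notMem (h w (by simp)))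

theorem nuAs_perm {ws ws' : List V} (h : ws.Perm ws') (P : Term V) :
    SC b (P.nuAs ws) (P.nuAs ws') := by
  induction h with
  | nil => exact .refl _
  | cons w _ ih => exact ih.nuA w
  | swap w v ws => exact nuA_comm _ _ _
  | trans _ _ ih1 ih2 => exact ih1.trans ih2

/-- Only the set of restricted names that occur matters. -/
theorem nuAs_congr {ws ws' : List V} (h : ∀ a ∈ P.fn, a ∈ ws ↔ a ∈ ws') :
    SC b (P.nuAs ws) (P.nuAs ws') := by
  classical
  -- Names that are repeated or do not occur can be dropped; what remains of `ws` and `ws'` are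
  -- duplicate-free lists with the same members.
  have key : ∀ ws : List V, SC b (P.nuAs ws) (P.nuAs (ws.filter (· ∈ P.fn)).dedup) := by
    intro ws
    induction ws with
    | nil => exact .refl _
    | cons w ws ih =>
      by_cases hw : w ∈ P.fn
      · by_cases hw' : w ∈ ws
        · rw [List.filter_cons_of_pos (by simpa using hw), List.dedup_cons_of_mem (by simp [hw, hw'])]
          exact (nuA_of_notMem (P := P.nuAs ws) (by simp [Term.mem_fn_nuAs, hw'])).trans ih
        · rw [List.filter_cons_of_pos (by simpa using hw),
            List.dedup_cons_of_notMem (by simp [hw'])]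
          exact ih.nuA w
      · rw [List.filter_cons_of_neg (by simpa using hw)]
        exact (nuA_of_notMem (P := P.nuAs ws) (by simp [Term.mem_fn_nuAs, hw])).trans ih
  refine (key ws).trans (.trans (nuAs_perm ?_ P) (key ws').symm)
  rw [List.perm_ext_iff_of_nodup (List.nodup_dedup _) (List.nodup_dedup _)]
  intro a
  simp only [List.mem_dedup, List.mem_filter, decide_eq_true_eq]
  exact ⟨fun ⟨h1, h2⟩ => ⟨(h a h2).1 h1, h2⟩, fun ⟨h1, h2⟩ => ⟨(h a h2).2 h1, h2⟩⟩

end SC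

/-! ### Agreement of the congruences on named terms and on alpha-classes -/

section Transfer

variable {V : Type*} [Infinite V] [DecidableEq V] {b : Prop}

theorem StaticRule.sc {P Q : Proc V} (h : StaticRule P Q) : SC b (tr P) (tr Q) := by
  cases h with
  | assoc P Q R => exact .assoc _ _ _
  | comm P Q => exact .comm _ _
  | unit => exact .unit _
  | nuNil z => exact .nuNil
  | nuComm z u P => exact .nuA_comm _ _ _
  | scope w P Q hw =>
    refine SC.nuA_scope ?_ _
    rw [mem_fn_tr]
    exact fun h => hw (Finset.mem_union_left _ h)

theorem Cong.sc {r : Proc V → Proc V → Prop} (hr : ∀ P Q, r P Q → SC b (tr P) (tr Q))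
    {P Q : Proc V} (h : Cong r P Q) : SC b (tr P) (tr Q) := by
  induction h with
  | rule h => exact hr _ _ h
  | refl P => exact .refl _
  | symm _ ih => exact ih.symm
  | trans _ _ ih1 ih2 => exact ih1.trans ih2
  | out x y _ ih => exact .out _ _ ih
  | inp x z _ ih => exact .inp _ (ih.ren _)
  | par _ _ ih1 ih2 => exact .par ih1 ih2
  | nu z _ ih => exact ih.nuA z
  | bang _ ih => exact .bang ih

theorem StaticCong.sc {P Q : Proc V} (h : StaticCong P Q) : SC False (tr P) (tr Q) :=
  Cong.sc (fun _ _ h => h.elim StaticRule.sc fun h => h.tr_eq ▸ .refl _) h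

theorem StructCong.sc {P Q : Proc V} (h : StructCong P Q) : SC True (tr P) (tr Q) := by
  refine Cong.sc (fun _ _ h => ?_) h
  rcases h with h | h | h
  · exact h.sc
  · cases h with
    | unfold P => exact SC.unfold (tr P) trivial
  · exact h.tr_eq ▸ .refl _

/-- Each rule on alpha-classes is realised on suitable representatives, and the alpha rules in `r`
absorb the passage between representatives. -/
theorem SC.cong {r : Proc V → Proc V → Prop} (hs : ∀ P Q, StaticRule P Q → r P Q)
    (hα : ∀ P Q, AlphaRule P Q → r P Q) (hb : b → ∀ P Q, BangRule P Q → r P Q)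
    {t t' : Term V} (h : SC b t t') {P Q : Proc V} (hP : tr P = t) (hQ : tr Q = t') :
    Cong r P Q := by
  have ex : ∀ t : Term V, ∃ P : Proc V, tr P = t := fun t =>
    let ⟨P, h, _⟩ := exists_tr_eq t Set.finite_empty; ⟨P, h⟩
  have eqv : ∀ {P Q : Proc V}, tr P = tr Q → Cong r P Q := cong_alphaRule_of_tr_eq hα
  -- One name serves to open both bodies, so that the congruence rule for a named binder applies.
  have bind : ∀ (f : V → V) (s t : Term V), ∃ v, (s.ren (scons v f)).ren (cl v) = s.ren (lift f) ∧
      (t.ren (scons v f)).ren (cl v) = t.ren (lift f) := by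
    intro f s t
    obtain ⟨v, hv, hv'⟩ :=
      Term.exists_notMem _ (Term.fn_finite (.nu (s.ren (lift f)))) (.nu (t.ren (lift f)))
    refine ⟨v, ?_⟩
    rw [← Term.inst_ren_lift, ← Term.inst_ren_lift]
    exact ⟨Term.ren_cl_inst hv, Term.ren_cl_inst hv'⟩
  -- All renamings `f` are needed, since under a binder the induction hypothesis is used at `scons v
  -- f`.
  have gen : ∀ (f : V → V) (P Q : Proc V), tr P = t.ren f → tr Q = t'.ren f → Cong r P Q := by
    clear hP hQ P Q
    induction h with
    | refl t => exact fun f P Q hP hQ => eqv (hP.trans hQ.symm)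
    | symm _ ih => exact fun f P Q hP hQ => (ih f Q P hQ hP).symm
    | trans _ _ ih1 ih2 =>
      intro f P Q hP hQ
      obtain ⟨R, hR⟩ := ex (Term.ren _ f)
      exact (ih1 f P R hP hR).trans (ih2 f R Q hR hQ)
    | @out x y t t' _ ih =>
      intro f P Q hP hQ
      obtain ⟨P', hP'⟩ := ex (t.ren f)
      obtain ⟨Q', hQ'⟩ := ex (t'.ren f)
      exact .trans (eqv (Q := .out (f x) (f y) P') (by simp [hP, tr, Term.ren, hP']))
        (.trans (.out _ _ (ih f P' Q' hP' hQ')) (eqv (by simp [hQ, tr, Term.ren, hQ'])))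
    | @inp x t t' _ ih =>
      intro f P Q hP hQ
      obtain ⟨v, h1, h2⟩ := bind f t t'
      obtain ⟨P', hP'⟩ := ex (t.ren (scons v f))
      obtain ⟨Q', hQ'⟩ := ex (t'.ren (scons v f))
      exact .trans (eqv (Q := .inp (f x) v P') (by simp [hP, tr, Term.ren, hP', h1]))
        (.trans (.inp _ _ (ih _ P' Q' hP' hQ')) (eqv (by simp [hQ, tr, Term.ren, hQ', h2])))
    | @par s s' t t' _ _ ih1 ih2 =>
      intro f P Q hP hQ
      obtain ⟨P1, hP1⟩ := ex (s.ren f)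
      obtain ⟨Q1, hQ1⟩ := ex (s'.ren f)
      obtain ⟨P2, hP2⟩ := ex (t.ren f)
      obtain ⟨Q2, hQ2⟩ := ex (t'.ren f)
      exact .trans (eqv (Q := .par P1 P2) (by simp [hP, tr, Term.ren, hP1, hP2]))
        (.trans (.par (ih1 f P1 Q1 hP1 hQ1) (ih2 f P2 Q2 hP2 hQ2))
          (eqv (by simp [hQ, tr, Term.ren, hQ1, hQ2])))
    | @nu t t' _ ih =>
      intro f P Q hP hQ
      obtain ⟨v, h1, h2⟩ := bind f t t'
      obtain ⟨P', hP'⟩ := ex (t.ren (scons v f))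
      obtain ⟨Q', hQ'⟩ := ex (t'.ren (scons v f))
      exact .trans (eqv (Q := .nu v P') (by simp [hP, tr, Term.nuA, Term.ren, hP', h1]))
        (.trans (.nu _ (ih _ P' Q' hP' hQ')) (eqv (by simp [hQ, tr, Term.nuA, Term.ren, hQ', h2])))
    | @bang t t' _ ih =>
      intro f P Q hP hQ
      obtain ⟨P', hP'⟩ := ex (t.ren f)
      obtain ⟨Q', hQ'⟩ := ex (t'.ren f)
      exact .trans (eqv (Q := .bang P') (by simp [hP, tr, Term.ren, hP']))
        (.trans (.bang (ih f P' Q' hP' hQ')) (eqv (by simp [hQ, tr, Term.ren, hQ'])))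
    | assoc s t u =>
      intro f P Q hP hQ
      obtain ⟨P1, h1⟩ := ex (s.ren f)
      obtain ⟨P2, h2⟩ := ex (t.ren f)
      obtain ⟨P3, h3⟩ := ex (u.ren f)
      exact .trans (eqv (by simp [hP, tr, Term.ren, h1, h2, h3]))
        (.trans (.rule (hs _ _ (.assoc P1 P2 P3))) (eqv (by simp [hQ, tr, Term.ren, h1, h2, h3])))
    | comm s t =>
      intro f P Q hP hQ
      obtain ⟨P1, h1⟩ := ex (s.ren f)
      obtain ⟨P2, h2⟩ := ex (t.ren f)
      exact .trans (eqv (by simp [hP, tr, Term.ren, h1, h2]))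
        (.trans (.rule (hs _ _ (.comm P1 P2))) (eqv (by simp [hQ, tr, Term.ren, h1, h2])))
    | unit s =>
      intro f P Q hP hQ
      exact .trans (eqv (by simp [hP, tr, Term.ren, hQ])) (.rule (hs _ _ (.unit Q)))
    | nuNil =>
      intro f P Q hP hQ
      exact .trans (eqv (by simp [hP, tr, Term.nuA, Term.ren]))
        (.trans (.rule (hs _ _ (.nuNil (z0 : V)))) (eqv (by simp [hQ, tr, Term.ren])))
    | nuComm t =>
      intro f P Q hP hQ
      obtain ⟨v, hv, hv'⟩ :=
        Term.exists_notMem ∅ Set.finite_empty ((Term.nu (.nu t)).ren f)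
      obtain ⟨w, hw, hw'⟩ :=
        Term.exists_notMem {v} (Set.finite_singleton v) ((Term.nu (.nu t)).ren f)
      replace hw : w ≠ v := by simpa using hw
      obtain ⟨T, hT⟩ := ex (t.ren (scons w (scons v f)))
      have e1 : tr P = tr (.nu v (.nu w T)) := by
        rw [hP]
        simp only [tr, hT, Term.nuA, Term.ren, Term.ren_ren]
        congr 2
        refine Term.ren_congr fun a ha => ?_
        rcases name_cases a with rfl | ⟨a, rfl⟩
        · simp
        · rcases name_cases a with rfl | ⟨a, rfl⟩
          · simp [cl_of_ne hw.symm]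
          · have h1 : f a ∈ ((Term.nu (.nu t)).ren f).fn := by
              rw [Term.mem_fn_ren]; exact ⟨a, ha, rfl⟩
            have h2 : f a ≠ v := fun e => hv' (e ▸ h1)
            have h3 : f a ≠ w := fun e => hw' (e ▸ h1)
            simp [cl_of_ne h2, cl_of_ne h3]
      have e2 : tr (.nu w (.nu v T)) = tr Q := by
        rw [hQ]
        simp only [tr, hT, Term.nuA, Term.ren, Term.ren_ren]
        congr 2
        refine Term.ren_congr fun a ha => ?_
        rcases name_cases a with rfl | ⟨a, rfl⟩
        · simp [cl_of_ne hw]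
        · rcases name_cases a with rfl | ⟨a, rfl⟩
          · simp
          · have h1 : f a ∈ ((Term.nu (.nu t)).ren f).fn := by
              rw [Term.mem_fn_ren]; exact ⟨a, ha, rfl⟩
            have h2 : f a ≠ v := fun e => hv' (e ▸ h1)
            have h3 : f a ≠ w := fun e => hw' (e ▸ h1)
            simp [cl_of_ne h2, cl_of_ne h3]
      exact .trans (eqv e1) (.trans (.rule (hs _ _ (.nuComm v w T))) (eqv e2))
    | scope s t =>
      intro f P Q hP hQ
      obtain ⟨v, hv, hv'⟩ :=
        Term.exists_notMem _ (Term.fn_finite (.nu (t.ren (lift f)))) (s.ren f)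
      -- The named scope rule forbids `v` even as a bound name of `P1`.
      obtain ⟨P1, h1, h1', -⟩ := exists_tr_eq (s.ren f) (Set.finite_singleton v)
      obtain ⟨P2, h2⟩ := ex (t.ren (scons v f))
      have hvP : v ∉ P1.names := by
        simp only [Proc.names, Finset.mem_union, not_or, ← mem_fn_tr, h1]
        exact ⟨hv', fun h => h1' v h rfl⟩
      have ht : (t.ren (scons v f)).ren (cl v) = t.ren (lift f) := by
        rw [← Term.inst_ren_lift]
        exact Term.ren_cl_inst hv
      refine .trans (eqv ?_) (.trans (.rule (hs _ _ (.scope v P1 P2 hvP))) (eqv ?_))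
      · simp only [hP, tr, Term.nuA, Term.ren, h1, h2, ht, Term.ren_cl_eq_ren_sh hv', Term.ren_ren]
        congr 3
        funext a
        simp
      · simp [hQ, tr, Term.nuA, Term.ren, h1, h2, ht]
    | unfold t h =>
      intro f P Q hP hQ
      obtain ⟨P1, h1⟩ := ex (t.ren f)
      exact .trans (eqv (by simp [hP, tr, Term.ren, h1]))
        (.trans (.rule (hb h _ _ (.unfold P1))) (eqv (by simp [hQ, tr, Term.ren, h1])))
  exact gen id P Q (by simpa using hP) (by simpa using hQ)

theorem staticCong_iff {P Q : Proc V} : StaticCong P Q ↔ SC False (tr P) (tr Q) :=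
  ⟨StaticCong.sc, fun h => h.cong (fun _ _ => .inl) (fun _ _ => .inr) (fun h => h.elim) rfl rfl⟩

theorem structCong_iff {P Q : Proc V} : StructCong P Q ↔ SC True (tr P) (tr Q) :=
  ⟨StructCong.sc, fun h => h.cong (fun _ _ => .inl) (fun _ _ h => .inr (.inr h))
    (fun _ _ _ h => .inr (.inl h)) rfl rfl⟩

end Transfer


/-! ### The encoding on alpha-classes -/

section EncT

variable {V : Type*} [Infinite V] [DecidableEq V]

/-- The encoding on alpha-classes. -/
noncomputable def encT : Term V → Term V
  | .nil => .nil
  | .tick => .tick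
  | .out x y P => .inp x (.par (.out z0 (sh y) .nil) ((encT P).ren sh))
  | .inp x P => .nu (.par (.out (sh x) z0 .nil) (.inp z0 ((encT P).ren (lift sh))))
  | .par P Q => .par (encT P) (encT Q)
  | .nu P => .nu (encT P)
  | .bang P => .bang (encT P)

/-- The auxiliary name is a nameless binder, so nothing can clash with it. This is what makes the
encoding invariant under non-injective renamings too. -/
theorem encT_ren (P : Term V) (f : V → V) : encT (P.ren f) = (encT P).ren f := by
  have h : ∀ f : V → V, lift f ∘ sh = sh ∘ f := by intro f; funext a; simp
  induction P generalizing f with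
  | out x y P ih => simp [encT, Term.ren, ih, Term.ren_ren, h]
  | inp x P ih =>
    simp [encT, Term.ren, ih, Term.ren_ren, lift_comp, h]
  | _ => simp_all [encT, Term.ren]

theorem fn_encT (P : Term V) : (encT P).fn = P.fn := by
  induction P with
  | out x y P ih =>
    ext a
    simp [encT, Term.fn, Term.mem_fn_ren, ih, or_assoc]
  | inp x P ih =>
    ext a
    simp only [encT, Term.fn, Set.mem_preimage, Set.mem_union, Set.mem_insert_iff, sh_inj,
      Set.mem_singleton_iff, sh_ne_z0, or_false, false_or, Set.notMem_empty, Term.mem_fn_ren, ih]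
    constructor
    · rintro (h | ⟨c, hc, h⟩)
      · exact .inl h
      · rcases name_cases c with rfl | ⟨c, rfl⟩
        · simp at h
        · right; simpa [← (show c = a by simpa using h)] using hc
    · rintro (h | h)
      · exact .inl h
      · exact .inr ⟨_, h, by simp⟩
  | _ => simp_all [encT, Term.fn]

theorem encT_async (P : Term V) : (encT P).Async := by
  induction P with
  | out x y P ih => exact ⟨rfl, ih.ren _⟩
  | inp x P ih => exact ⟨rfl, ih.ren _⟩
  | par P Q ih1 ih2 => exact ⟨ih1, ih2⟩
  | nil => trivial
  | tick => trivial
  | nu P ih => exact ih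
  | bang P ih => exact ih

/-- The axioms of the congruence mention only operators on which the encoding is homomorphic, so
each becomes an instance of itself. -/
theorem SC.encT {b : Prop} {P Q : Term V} (h : SC b P Q) : SC b (encT P) (encT Q) := by
  induction h with
  | refl P => exact .refl _
  | symm _ ih => exact ih.symm
  | trans _ _ ih1 ih2 => exact ih1.trans ih2
  | out x y _ ih => exact .inp _ (.parr (ih.ren _) _)
  | inp x _ ih => exact .nu (.parr (.inp _ (ih.ren _)) _)
  | par _ _ ih1 ih2 => exact .par ih1 ih2
  | nu _ ih => exact .nu ih
  | bang _ ih => exact .bang ih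
  | assoc P Q R => exact .assoc _ _ _
  | comm P Q => exact .comm _ _
  | unit P => exact .unit _
  | nuNil => exact .nuNil
  | nuComm P =>
    simp only [HondaTokoro.encT, encT_ren]
    exact .nuComm _
  | scope P Q =>
    simp only [HondaTokoro.encT, encT_ren]
    exact .scope _ _
  | unfold P h => exact .unfold _ h

theorem encT_nuAs (ws : List V) (P : Term V) : encT (P.nuAs ws) = (encT P).nuAs ws := by
  induction ws with
  | nil => rfl
  | cons w ws ih => simp [Term.nuA, encT, encT_ren, ih]

theorem encT_inst (P : Term V) (v : V) : encT (P.inst v) = (encT P).inst v := encT_ren _ _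

theorem encT_inp {x u : V} {P : Term V} (hu : u ∉ (Term.inp x P).fn) :
    encT (.inp x P) = .nuA u (.par (.out x u .nil) (.inp u (encT P))) := by
  simp only [Term.fn, Set.mem_union, Set.mem_singleton_iff, Set.mem_preimage, not_or] at hu
  simp only [encT, Term.nuA, Term.ren, cl_self, cl_of_ne (Ne.symm hu.1)]
  congr 3
  refine Term.ren_congr fun a ha => ?_
  rcases name_cases a with rfl | ⟨a, rfl⟩
  · simp
  · have : a ≠ u := by rintro rfl; rw [fn_encT] at ha; exact hu.2 ha
    simp [cl_of_ne this]

/-- The right-hand side does not depend on `c`: all choices of fresh names give the same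
alpha-class, and only `encT` has to be studied. -/
theorem tr_enc (c : FreshChoice V) (P : Proc V) : tr (enc c P).toProc = encT (tr P) := by
  induction P with
  | nil => rfl
  | tick => rfl
  | out x y P ih =>
    have h := c.outName_fresh x y P.fn
    simp only [Finset.mem_union, Finset.mem_insert, Finset.mem_singleton, not_or] at h
    obtain ⟨h1, h2, h3⟩ := h
    have : c.outName x y P.fn ∉ (encT (tr P)).fn := by rwa [fn_encT, mem_fn_tr]
    simp [enc, AProc.toProc, tr, encT, Term.ren, ih, cl_of_ne (Ne.symm h3),
      Term.ren_cl_eq_ren_sh this]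
  | inp x z P ih =>
    have h := c.inpName_fresh x z P.fn
    simp only [Finset.mem_union, Finset.mem_singleton, not_or] at h
    obtain ⟨h1, h2⟩ := h
    rw [show tr (.inp x z P) = .inp x ((tr P).ren (cl z)) from rfl,
      encT_inp (u := c.inpName x z P.fn)]
    · simp [enc, AProc.toProc, tr, ih, encT_ren]
    · simp [Term.fn, Term.sh_mem_fn_ren_cl, h2, mem_fn_tr, h1]
  | par P Q ih1 ih2 => simp [enc, AProc.toProc, tr, encT, ih1, ih2]
  | nu z P ih => simp [enc, AProc.toProc, tr, encT, ih, Term.nuA, encT_ren]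
  | bang P ih => simp [enc, AProc.toProc, tr, encT, ih]

theorem AProc.toProc_ren (P : AProc V) (σ : V → V) : (P.ren σ).toProc = P.toProc.ren σ := by
  induction P generalizing σ with
  | _ => simp_all [AProc.ren, AProc.toProc, Proc.ren, AProc.fn]

theorem tr_enc_ren (c : FreshChoice V) (S : Proc V) (σ : V → V) :
    tr (enc c (S.ren σ)).toProc = tr ((enc c S).ren σ).toProc := by
  rw [AProc.toProc_ren, tr_ren, tr_enc, tr_enc, tr_ren, encT_ren]

theorem enc_ren_alphaEq (c : FreshChoice V) (S : Proc V) (σ : V → V) :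
    (enc c (S.ren σ)).AlphaEq ((enc c S).ren σ) :=
  alphaEq_of_tr_eq (tr_enc_ren c S σ)

end EncT

/-! ### Extraction of prefixes -/

section Ext

variable {V : Type*} [Infinite V]

/-- The free names of the elements of a multiset of terms. -/
def fnM (L : Multiset (Term V)) : Set V := {a | ∃ p ∈ L, a ∈ p.fn}

@[simp] theorem fnM_zero : fnM (0 : Multiset (Term V)) = ∅ := by simp [fnM]

@[simp] theorem fnM_add (L M : Multiset (Term V)) : fnM (L + M) = fnM L ∪ fnM M := by
  ext a; simp [fnM, or_and_right, exists_or]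

@[simp] theorem fnM_cons (p : Term V) (L : Multiset (Term V)) :
    fnM (p ::ₘ L) = p.fn ∪ fnM L := by
  ext a; simp [fnM]

@[simp] theorem fnM_singleton (p : Term V) : fnM {p} = p.fn := by
  ext a; simp [fnM]

theorem fnM_finite (L : Multiset (Term V)) : (fnM L).Finite := by
  induction L using Multiset.induction_on with
  | empty => simp
  | cons p L ih => simpa using ⟨p.fn_finite, ih⟩

/-- The free names of an extraction. -/
def fnX (L : Multiset (Term V)) (R : Term V) : Set V := fnM L ∪ R.fn

theorem fnX_finite (L : Multiset (Term V)) (R : Term V) : (fnX L R).Finite :=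
  (fnM_finite L).union R.fn_finite

variable [DecidableEq V]

/-- Terms that are neither a parallel composition nor a restriction. -/
def Term.Leaf : Term V → Prop
  | .par _ _ => False
  | .nu _ => False
  | _ => True

theorem Term.Leaf.ren {P : Term V} (h : P.Leaf) (f : V → V) : (P.ren f).Leaf := by
  cases P <;> exact h

/-- `Ext b P L R`: the prefixes `L` occur unguarded in `P`, and `R` is what remains if they are
removed and restrictions are opened. The opened names are those in `fnX L R` that are not free in
`P`. If `b` holds, then replications may be unfolded and restrictions may be kept; otherwise all
restrictions are opened. -/
inductive Ext (b : Prop) : Term V → Multiset (Term V) → Term V → Prop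
  | refl (P : Term V) : b ∨ P.Leaf → Ext b P 0 P
  | out (x y : V) (P : Term V) : Ext b (.out x y P) {.out x y P} .nil
  | inp (x : V) (P : Term V) : Ext b (.inp x P) {.inp x P} .nil
  -- The inclusion says that a name opened on one side does not occur on the other.
  | par {P Q : Term V} {L M : Multiset (Term V)} {P' Q' : Term V} :
      Ext b P L P' → Ext b Q M Q' → fnX L P' ∩ fnX M Q' ⊆ P.fn ∩ Q.fn →
      Ext b (.par P Q) (L + M) (.par P' Q')
  -- By the last condition a vacuous restriction is not given a name that is opened further inside.
  | opened (v : V) {P : Term V} {L : Multiset (Term V)} {P' : Term V} :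
      Ext b (P.inst v) L P' → v ∉ (Term.nu P).fn → (v ∈ fnX L P' → z0 ∈ P.fn) →
      Ext b (.nu P) L P'
  | closed (hb : b) (v : V) {P : Term V} {L : Multiset (Term V)} {P' : Term V} :
      Ext b (P.inst v) L P' → v ∉ (Term.nu P).fn → (v ∈ fnX L P' → z0 ∈ P.fn) → v ∉ fnM L →
      Ext b (.nu P) L (.nuA v P')
  | bang {P : Term V} {L : Multiset (Term V)} {P' : Term V} (hb : b) :
      Ext b (.par P (.bang P)) L P' → Ext b (.bang P) L P'

namespace Ext

variable {b : Prop} {P Q R : Term V} {L M : Multiset (Term V)}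

theorem fn_subset (h : Ext b P L R) : P.fn ⊆ fnX L R := by
  induction h with
  | refl P => simp [fnX]
  | out x y P => simp [fnX]
  | inp x P => simp [fnX]
  | par _ _ _ ih1 ih2 =>
    simp only [fnX, Term.fn, fnM_add] at *
    intro a ha
    rcases ha with ha | ha
    · rcases ih1 ha with h | h <;> simp [h]
    · rcases ih2 ha with h | h <;> simp [h]
  | opened v _ h1 _ ih =>
    exact fun a ha => ih (Term.mem_fn_inst.2 (.inl ha))
  | closed _ v _ h1 _ h3 ih =>
    intro a ha
    have hav : a ≠ v := by rintro rfl; exact h1 ha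
    have := ih (Term.mem_fn_inst.2 (.inl ha))
    simpa [fnX, Term.fn_nuA, hav] using this
  | bang _ _ ih => exact fun a ha => ih (by simpa [Term.fn] using ha)

theorem prefixes (h : Ext b P L R) :
    ∀ p ∈ L, (∃ x y A, p = .out x y A) ∨ ∃ x A, p = .inp x A := by
  induction h with
  | refl P => simp
  | out x y P => simp
  | inp x P => simp
  | par _ _ _ ih1 ih2 =>
    intro p hp
    rcases Multiset.mem_add.1 hp with h | h
    exacts [ih1 p h, ih2 p h]
  | opened v _ _ _ ih => exact ih
  | closed _ v _ _ _ _ ih => exact ih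
  | bang _ _ ih => exact ih

end Ext

theorem fnM_map_ren (L : Multiset (Term V)) (f : V → V) :
    fnM (L.map (·.ren f)) = f '' fnM L := by
  ext a
  simp only [fnM, Multiset.mem_map, Set.mem_ofPred_eq, Set.mem_image]
  constructor
  · rintro ⟨_, ⟨p, hp, rfl⟩, ha⟩
    obtain ⟨c, hc, rfl⟩ := Term.mem_fn_ren.1 ha
    exact ⟨c, ⟨p, hp, hc⟩, rfl⟩
  · rintro ⟨c, ⟨p, hp, hc⟩, rfl⟩
    exact ⟨_, ⟨p, hp, rfl⟩, Term.mem_fn_ren.2 ⟨c, hc, rfl⟩⟩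

theorem fnX_map_ren (L : Multiset (Term V)) (R : Term V) (f : V → V) :
    fnX (L.map (·.ren f)) (R.ren f) = f '' fnX L R := by
  rw [fnX, fnX, fnM_map_ren, Term.fn_ren, Set.image_union]

namespace Ext

variable {b : Prop} {P Q R : Term V} {L M : Multiset (Term V)}

theorem ren (h : Ext b P L R) {f : V → V} (hf : Function.Injective f) :
    Ext b (P.ren f) (L.map (·.ren f)) (R.ren f) := by
  have hz : ∀ (P : Term V), z0 ∈ P.fn → z0 ∈ (P.ren (lift f)).fn := fun P h =>
    Term.mem_fn_ren.2 ⟨_, h, by simp⟩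
  have hn : ∀ (P : Term V) (v : V), v ∉ (Term.nu P).fn → f v ∉ (Term.nu (P.ren (lift f))).fn :=
    fun P v h h' => h ((Term.mem_fn_ren_of_injective (P := .nu P) hf).1 h')
  induction h with
  | refl P h => exact .refl _ (h.imp_right fun h => h.ren f)
  | out x y P => exact .out _ _ _
  | inp x P => exact .inp _ _
  | par _ _ h ih1 ih2 =>
    rw [Multiset.map_add]
    refine .par ih1 ih2 ?_
    rw [fnX_map_ren, fnX_map_ren, Term.fn_ren, Term.fn_ren, ← Set.image_inter hf,
      ← Set.image_inter hf]
    exact Set.image_mono h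
  | opened v _ h1 h2 ih =>
    rw [Term.ren_inst] at ih
    refine .opened (f v) ih (hn _ _ h1) fun h => hz _ (h2 ?_)
    rw [fnX_map_ren] at h
    exact (hf.mem_set_image).1 h
  | closed hb v _ h1 h2 h3 ih =>
    rw [Term.ren_inst] at ih
    rw [Term.ren_nuA hf]
    refine .closed hb (f v) ih (hn _ _ h1) (fun h => hz _ (h2 ?_)) ?_
    · rw [fnX_map_ren] at h
      exact (hf.mem_set_image).1 h
    · rw [fnM_map_ren, hf.mem_set_image]
      exact h3
  | bang hb _ ih => exact .bang hb ih

theorem par_inv (h : Ext b (.par P Q) L R) : ∃ L1 L2 R1 R2, L = L1 + L2 ∧ R = .par R1 R2 ∧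
    Ext b P L1 R1 ∧ Ext b Q L2 R2 ∧ fnX L1 R1 ∩ fnX L2 R2 ⊆ P.fn ∩ Q.fn := by
  cases h with
  | refl _ h =>
    have hb : b := h.resolve_right id
    exact ⟨0, 0, P, Q, by simp, rfl, .refl _ (.inl hb), .refl _ (.inl hb), by simp [fnX]⟩
  | par h1 h2 h3 => exact ⟨_, _, _, _, rfl, rfl, h1, h2, h3⟩

theorem map_ren_eq_self {L : Multiset (Term V)} {f : V → V} (h : ∀ a ∈ fnM L, f a = a) :
    L.map (·.ren f) = L := by
  conv_rhs => rw [← Multiset.map_id L]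
  exact Multiset.map_congr rfl fun p hp => Term.ren_eq_self fun a ha => h a ⟨p, hp, ha⟩

/-- A restriction that is kept can be given any fresh name. -/
theorem nu_inv (h : Ext b (.nu P) L R) {A : Set V} (hA : A.Finite) :
    (∃ v, z0 ∈ P.fn ∧ v ∉ (Term.nu P).fn ∧ Ext b (P.inst v) L R) ∨
    ∃ v R', v ∉ A ∧ v ∉ (Term.nu P).fn ∧ v ∉ fnM L ∧ (v ∈ R'.fn → z0 ∈ P.fn) ∧
      Ext b (P.inst v) L R' ∧ (b ∨ v ∉ R'.fn) ∧ SC b R (.nuA v R') := by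
  cases h with
  | refl _ hb =>
    replace hb : b := hb.resolve_right id
    right
    obtain ⟨v, hv, hv'⟩ := Term.exists_notMem A hA (.nu P)
    refine ⟨v, P.inst v, hv, hv', by simp, fun h => ?_, .refl _ (.inl hb), .inl hb, by
      rw [Term.nuA_inst hv']; exact .refl _⟩
    rw [Term.mem_fn_inst] at h
    exact h.elim (fun h => absurd h hv') fun h => h.2
  | opened v h h1 h2 =>
    by_cases hz : z0 ∈ P.fn
    · exact .inl ⟨v, hz, h1, h⟩
    · right
      -- Instantiating a vacuous restriction has no effect, so it may be treated as kept under a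
      -- fresh name.
      obtain ⟨w, hw, hw'⟩ := Term.exists_notMem _ (hA.union (fnX_finite L R)) (.nu P)
      rw [Set.mem_union, fnX, Set.mem_union, not_or, not_or] at hw
      exact ⟨w, R, hw.1, hw', hw.2.1, fun h => absurd h hw.2.2, Term.inst_eq_inst hz v w ▸ h,
        .inr hw.2.2, (SC.nuA_of_notMem hw.2.2).symm⟩
  | @closed hb v _ _ P' h h1 h2 h3 =>
    right
    obtain ⟨w, hw, hw'⟩ := Term.exists_notMem _ (hA.union (fnX_finite L P')) (.nu P)
    rw [Set.mem_union, fnX, Set.mem_union, not_or, not_or] at hw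
    have hf := (Equiv.swap v w).injective
    have hfix : ∀ a, a ≠ v → a ≠ w → Equiv.swap v w a = a :=
      fun a => Equiv.swap_apply_of_ne_of_ne
    have e := h.ren hf
    have e1 : (P.inst v).ren (Equiv.swap v w) = P.inst w := by
      rw [Term.ren_inst, Equiv.swap_apply_left]
      congr 1
      refine Term.ren_eq_self fun a ha => ?_
      rcases name_cases a with rfl | ⟨a, rfl⟩
      · simp
      · rw [lift_sh, hfix]
        · rintro rfl; exact h1 ha
        · rintro rfl; exact hw' ha
    rw [e1, map_ren_eq_self fun a ha => hfix a (fun e => h3 (e ▸ ha)) fun e => hw.2.1 (e ▸ ha)] at e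
    refine ⟨w, _, hw.1, hw', hw.2.1, fun hz => ?_, e, .inl hb, ?_⟩
    · obtain ⟨c, hc, hc'⟩ := Term.mem_fn_ren.1 hz
      have : c = v := by
        by_contra hcv
        rw [hfix c hcv fun e => hw.2.2 (e ▸ hc)] at hc'
        exact hw.2.2 (hc' ▸ hc)
      exact h2 (.inr (this ▸ hc))
    · have : Term.nuA w (P'.ren (Equiv.swap v w)) = Term.nuA v P' := by
        have h' := Term.ren_nuA hf v P'
        rw [Equiv.swap_apply_left] at h'
        rw [← h']
        refine Term.ren_eq_self fun a ha => ?_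
        rw [Term.fn_nuA] at ha
        exact hfix a ha.2 fun e => hw.2.2 (e ▸ ha.1)
      rw [this]
      exact .refl _

/-- A restriction can be kept, or else opened if its name does not occur. -/
theorem kept {v : V} (h : Ext b (P.inst v) L R) (hv : v ∉ (Term.nu P).fn) (hL : v ∉ fnM L)
    (hz : v ∈ R.fn → z0 ∈ P.fn) (hb : b ∨ v ∉ R.fn) :
    ∃ R', Ext b (.nu P) L R' ∧ SC b R' (.nuA v R) := by
  have hz' : v ∈ fnX L R → z0 ∈ P.fn := fun h => hz (h.resolve_left hL)
  rcases hb with hb | hR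
  · exact ⟨_, .closed hb v h hv hz' hL, .refl _⟩
  · exact ⟨_, .opened v h hv hz', (SC.nuA_of_notMem hR).symm⟩

theorem nil_inv (h : Ext b (.nil : Term V) L R) : L = 0 ∧ R = .nil := by
  cases h; simp

end Ext

/-! ### Invariance of extractions under structural congruence -/

/-- Congruence of prefixes: the subjects and objects agree and the continuations are congruent. -/
inductive PrefixCong (b : Prop) : Term V → Term V → Prop
  | out (x y : V) {P Q : Term V} : SC b P Q → PrefixCong b (.out x y P) (.out x y Q)
  | inp (x : V) {P Q : Term V} : SC b P Q → PrefixCong b (.inp x P) (.inp x Q)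

theorem PrefixCong.trans {b : Prop} {p q r : Term V} (h : PrefixCong b p q)
    (h' : PrefixCong b q r) : PrefixCong b p r := by
  cases h with
  | out x y h => cases h' with | out _ _ h' => exact .out _ _ (h.trans h')
  | inp x h => cases h' with | inp _ h' => exact .inp _ (h.trans h')

theorem PrefixCong.sc {b : Prop} {p q : Term V} (h : PrefixCong b p q) : SC b p q := by
  cases h with
  | out x y h => exact .out _ _ h
  | inp x h => exact .inp _ h

instance {b : Prop} : IsTrans (Term V) (PrefixCong b) := ⟨fun _ _ _ => PrefixCong.trans⟩

theorem fnM_eq_of_rel {b : Prop} {L M : Multiset (Term V)}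
    (h : Multiset.Rel (PrefixCong b) L M) : fnM L = fnM M := by
  induction h with
  | zero => rfl
  | cons h _ ih => rw [fnM_cons, fnM_cons, ih, h.sc.fn_eq]

/-- Every extraction from `P` is matched by one from `Q`. -/
def Sim (b : Prop) (P Q : Term V) : Prop :=
  ∀ L R, Ext b P L R → ∃ M R', Ext b Q M R' ∧ Multiset.Rel (PrefixCong b) L M ∧ SC b R R'

namespace Sim

variable {b : Prop} {P Q R P' Q' : Term V}

theorem rel_refl {P : Term V} {L : Multiset (Term V)} {R : Term V} (h : Ext b P L R) :
    Multiset.Rel (PrefixCong b) L L := by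
  refine Multiset.rel_refl_of_refl_on fun p hp => ?_
  rcases h.prefixes p hp with ⟨x, y, A, rfl⟩ | ⟨x, A, rfl⟩
  exacts [.out _ _ (.refl _), .inp _ (.refl _)]

theorem trans (h : Sim b P Q) (h' : Sim b Q R) : Sim b P R := by
  intro L A hA
  obtain ⟨M, B, hB, h1, h2⟩ := h L A hA
  obtain ⟨N, C, hC, h3, h4⟩ := h' M B hB
  exact ⟨N, C, hC, Multiset.Rel.trans _ h1 h3, h2.trans h4⟩

theorem out (x y : V) (h : SC b P Q) : Sim b (.out x y P) (.out x y Q) := by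
  intro L A hA
  cases hA with
  | refl => exact ⟨0, _, .refl _ (.inr trivial), .zero, h.out _ _⟩
  | out => exact ⟨_, _, .out _ _ _, .cons (.out _ _ h) .zero, .refl _⟩

theorem inp (x : V) (h : SC b P Q) : Sim b (.inp x P) (.inp x Q) := by
  intro L A hA
  cases hA with
  | refl => exact ⟨0, _, .refl _ (.inr trivial), .zero, h.inp _⟩
  | inp => exact ⟨_, _, .inp _ _, .cons (.inp _ h) .zero, .refl _⟩

theorem fnX_eq {L M : Multiset (Term V)} {R R' : Term V} (h : Multiset.Rel (PrefixCong b) L M)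
    (h' : SC b R R') : fnX L R = fnX M R' := by
  rw [fnX, fnX, fnM_eq_of_rel h, h'.fn_eq]

theorem par (hP : P.fn = P'.fn) (hQ : Q.fn = Q'.fn) (h : Sim b P P') (h' : Sim b Q Q') :
    Sim b (.par P Q) (.par P' Q') := by
  intro L A hA
  obtain ⟨L1, L2, R1, R2, rfl, rfl, h1, h2, h3⟩ := hA.par_inv
  obtain ⟨M1, A1, e1, r1, s1⟩ := h _ _ h1
  obtain ⟨M2, A2, e2, r2, s2⟩ := h' _ _ h2
  refine ⟨_, _, .par e1 e2 ?_, r1.add r2, s1.par s2⟩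
  rwa [← fnX_eq r1 s1, ← fnX_eq r2 s2, ← hP, ← hQ]

theorem nu (hP : P.fn = Q.fn) (hs : SC b P Q) (h : ∀ v, Sim b (P.inst v) (Q.inst v)) :
    Sim b (.nu P) (.nu Q) := by
  have hn : (Term.nu P).fn = (Term.nu Q).fn := by simp [Term.fn, hP]
  intro L A hA
  cases hA with
  | refl _ h => exact ⟨0, _, .refl _ h, .zero, hs.nu⟩
  | opened v h0 h1 h2 =>
    obtain ⟨M, B, e, r, s⟩ := h v _ _ h0
    rw [fnX_eq r s] at h2
    exact ⟨M, B, .opened v e (hn ▸ h1) (hP ▸ h2), r, s⟩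
  | closed hb v h0 h1 h2 h3 =>
    obtain ⟨M, B, e, r, s⟩ := h v _ _ h0
    rw [fnX_eq r s] at h2
    exact ⟨M, _, .closed hb v e (hn ▸ h1) (hP ▸ h2) (fnM_eq_of_rel r ▸ h3), r, s.nuA v⟩

theorem bang (hP : P.fn = Q.fn) (hs : SC b P Q) (h : Sim b P Q) : Sim b (.bang P) (.bang Q) := by
  -- An extraction from a replication alternates between `.bang P` and its unfolding, so both shapes
  -- are treated in one induction on its derivation.
  have key : ∀ X L A, Ext b X L A →
      (X = .bang P → ∃ M R', Ext b (.bang Q) M R' ∧ Multiset.Rel (PrefixCong b) L M ∧ SC b A R') ∧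
      (X = .par P (.bang P) → ∃ M R', Ext b (.par Q (.bang Q)) M R' ∧
        Multiset.Rel (PrefixCong b) L M ∧ SC b A R') := by
    intro X L A hX
    induction hX with
    | refl X h =>
      constructor
      · rintro rfl; exact ⟨0, _, .refl _ h, .zero, hs.bang⟩
      · rintro rfl; exact ⟨0, _, .refl _ h, .zero, hs.par hs.bang⟩
    | out => simp
    | inp => simp
    | opened => simp
    | closed => simp
    | @par X Y L M X' Y' h1 h2 h3 _ ih =>
      refine ⟨by simp, ?_⟩
      rintro ⟨⟩
      obtain ⟨M1, A1, e1, r1, s1⟩ := h _ _ h1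
      obtain ⟨M2, A2, e2, r2, s2⟩ := ih.1 rfl
      refine ⟨_, _, .par e1 e2 ?_, r1.add r2, s1.par s2⟩
      rw [← fnX_eq r1 s1, ← fnX_eq r2 s2]
      simpa [Term.fn, hP] using h3
    | bang hb _ ih =>
      refine ⟨?_, by simp⟩
      rintro ⟨⟩
      obtain ⟨M, B, e, r, s⟩ := ih.2 rfl
      exact ⟨M, B, .bang hb e, r, s⟩
  exact fun L A hA => (key _ L A hA).1 rfl

theorem assoc (P Q R : Term V) : Sim b (.par P (.par Q R)) (.par (.par P Q) R) := by
  intro L A hA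
  obtain ⟨L1, L2, R1, X, rfl, rfl, h1, h2, h3⟩ := hA.par_inv
  obtain ⟨L3, L4, R3, R4, rfl, rfl, h4, h5, h6⟩ := h2.par_inv
  have rr := rel_refl hA
  rw [← add_assoc] at *
  have f1 := h1.fn_subset
  have f4 := h4.fn_subset
  have f5 := h5.fn_subset
  have e1 : fnX (L3 + L4) (.par R3 R4) = fnX L3 R3 ∪ fnX L4 R4 := by
    ext; simp [fnX, Term.fn]; tauto
  have e2 : fnX (L1 + L3) (.par R1 R3) = fnX L1 R1 ∪ fnX L3 R3 := by
    ext; simp [fnX, Term.fn]; tauto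
  rw [e1] at h3
  refine ⟨_, _, .par (.par h1 h4 ?_) h5 ?_, rr, .assoc _ _ _⟩
  · rintro a ⟨ha, ha'⟩
    have k := h3 ⟨ha, .inl ha'⟩
    refine ⟨k.1, k.2.elim id fun k' => (h6 ⟨ha', f5 k'⟩).1⟩
  · rw [e2]
    rintro a ⟨ha | ha, ha'⟩
    · have k := h3 ⟨ha, .inr ha'⟩
      exact ⟨.inl k.1, k.2.elim (fun k' => (h6 ⟨f4 k', ha'⟩).2) id⟩
    · have k := h6 ⟨ha, ha'⟩
      exact ⟨.inr k.1, k.2⟩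

theorem comm (P Q : Term V) : Sim b (.par P Q) (.par Q P) := by
  intro L A hA
  obtain ⟨L1, L2, R1, R2, rfl, rfl, h1, h2, h3⟩ := hA.par_inv
  have rr := rel_refl hA
  refine ⟨L2 + L1, _, .par h2 h1 ?_, by simpa [add_comm] using rr, .comm _ _⟩
  rwa [Set.inter_comm, Set.inter_comm Q.fn]

theorem assoc' (P Q R : Term V) : Sim b (.par (.par P Q) R) (.par P (.par Q R)) :=
  (comm _ _).trans (.trans (.par rfl (by simp [Term.fn, Set.union_comm]) (fun L A h =>
    ⟨L, A, h, rel_refl h, .refl _⟩) (comm _ _)) (.trans (assoc _ _ _) (.trans (comm _ _)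
    (.par rfl (by simp [Term.fn, Set.union_comm]) (fun L A h => ⟨L, A, h, rel_refl h, .refl _⟩)
      (comm _ _)))))

theorem unit (P : Term V) : Sim b (.par P .nil) P := by
  intro L A hA
  obtain ⟨L1, L2, R1, R2, rfl, rfl, h1, h2, h3⟩ := hA.par_inv
  obtain ⟨rfl, rfl⟩ := h2.nil_inv
  exact ⟨L1, R1, h1, by simpa using rel_refl h1, .unit _⟩

theorem unit' (P : Term V) : Sim b P (.par P .nil) := by
  intro L A hA
  refine ⟨L + 0, _, .par hA (.refl _ (.inr trivial)) ?_, by simpa using rel_refl hA, (SC.unit _).symm⟩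
  simp [fnX, Term.fn]

theorem nuNil : Sim b (.nu .nil : Term V) .nil := by
  intro L A hA
  cases hA with
  | refl => exact ⟨0, _, .refl _ (.inr trivial), .zero, .nuNil⟩
  | opened v h =>
    obtain ⟨rfl, rfl⟩ := Ext.nil_inv h
    exact ⟨0, _, .refl _ (.inr trivial), .zero, .refl _⟩
  | closed _ v h =>
    obtain ⟨rfl, rfl⟩ := Ext.nil_inv h
    exact ⟨0, _, .refl _ (.inr trivial), .zero, .nuNil⟩

theorem nuNil' : Sim b (.nil : Term V) (.nu .nil) := by
  intro L A hA
  obtain ⟨rfl, rfl⟩ := hA.nil_inv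
  exact ⟨0, _, .opened z0 (.refl .nil (.inr trivial)) (by simp [Term.fn]) (by simp [fnX, Term.fn]),
    .zero, .refl _⟩

theorem fnX_par (L M : Multiset (Term V)) (P Q : Term V) :
    fnX (L + M) (.par P Q) = fnX L P ∪ fnX M Q := by
  ext; simp [fnX, Term.fn]; tauto

theorem fn_nu_ren_sh_par (P Q : Term V) :
    (Term.nu (.par (P.ren sh) Q)).fn = P.fn ∪ (Term.nu Q).fn := by
  ext a; simp [Term.fn, Term.mem_fn_ren]

theorem z0_mem_fn_ren_sh_par {P Q : Term V} : z0 ∈ (Term.par (P.ren sh) Q).fn ↔ z0 ∈ Q.fn := by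
  simp [Term.fn, Term.mem_fn_ren]

/-- If the restriction is kept, its name cannot occur in the residual of `P`: it would then be
shared by both sides and hence free in `P`. So the restriction can be narrowed to the residual of
`Q`. -/
theorem scope (P Q : Term V) : Sim b (.nu (.par (P.ren sh) Q)) (.par P (.nu Q)) := by
  intro L A hA
  have rr := rel_refl hA
  have key : ∀ v L1 L2 R1 R2, v ∉ P.fn ∪ (Term.nu Q).fn →
      fnX L1 R1 ∩ fnX L2 R2 ⊆ P.fn ∩ (Q.inst v).fn →
      fnX L1 R1 ∩ fnX L2 R2 ⊆ P.fn ∩ (Term.nu Q).fn := by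
    intro v L1 L2 R1 R2 hv h a ha
    obtain ⟨k1, k2⟩ := h ha
    refine ⟨k1, (Term.mem_fn_inst.1 k2).resolve_right ?_⟩
    rintro ⟨rfl, -⟩
    exact hv (.inl k1)
  have hi : ∀ v, (Term.par (P.ren sh) Q).inst v = .par P (Q.inst v) := by
    intro v
    show Term.par ((P.ren sh).inst v) (Q.inst v) = _
    rw [Term.inst_ren_sh]
  rcases hA.nu_inv Set.finite_empty with ⟨v, hz, hv, h⟩ | ⟨v, R', -, hv, hvL, hz, h, hb, hs⟩
  · rw [hi] at h
    rw [fn_nu_ren_sh_par] at hv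
    rw [z0_mem_fn_ren_sh_par] at hz
    obtain ⟨L1, L2, R1, R2, rfl, rfl, h1, h2, h3⟩ := h.par_inv
    exact ⟨_, _, .par h1 (.opened v h2 (fun h => hv (.inr h)) fun _ => hz) (key _ _ _ _ _ hv h3),
      rr, .refl _⟩
  · rw [hi] at h
    rw [fn_nu_ren_sh_par] at hv
    rw [z0_mem_fn_ren_sh_par] at hz
    obtain ⟨L1, L2, R1, R2, rfl, rfl, h1, h2, h3⟩ := h.par_inv
    rw [fnM_add, Set.mem_union, not_or] at hvL
    have hv1 : v ∉ R1.fn := by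
      intro hR
      have := hz (.inl hR)
      exact hv (.inl (h3 ⟨.inr hR, h2.fn_subset (Term.mem_fn_inst.2 (.inr ⟨rfl, this⟩))⟩).1)
    obtain ⟨X, hX, sX⟩ := h2.kept (fun h => hv (.inr h)) hvL.2 (fun h => hz (.inr h))
      (hb.imp_right fun h h' => h (.inr h'))
    refine ⟨_, _, .par h1 hX ?_, rr, hs.trans ((SC.nuA_scope hv1 _).trans (.parr sX.symm _))⟩
    refine (Set.inter_subset_inter_right _ ?_).trans (key _ _ _ _ _ hv h3)
    rw [fnX, fnX, sX.fn_eq, Term.fn_nuA]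
    exact Set.union_subset_union_right _ Set.sdiff_subset

/-- A kept restriction is given a name outside everything extracted from `P`, so that its scope can
be extended over the residual of `P`. -/
theorem scope' (P Q : Term V) : Sim b (.par P (.nu Q)) (.nu (.par (P.ren sh) Q)) := by
  intro L A hA
  have rr := rel_refl hA
  obtain ⟨L1, L2, R1, R2, rfl, rfl, h1, h2, h3⟩ := hA.par_inv
  have hi : ∀ v, (Term.par (P.ren sh) Q).inst v = .par P (Q.inst v) := by
    intro v
    show Term.par ((P.ren sh).inst v) (Q.inst v) = _
    rw [Term.inst_ren_sh]
  have hnu : (Term.nu Q).fn ⊆ fnX L2 R2 := h2.fn_subset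
  have up : ∀ v, (Term.nu Q).fn ⊆ (Q.inst v).fn := fun v a ha => Term.mem_fn_inst.2 (.inl ha)
  rcases h2.nu_inv (fnX_finite L1 R1) with ⟨v, hz, hv, h⟩ | ⟨v, R', hvA, hv, hvL, hz, h, hb, hs⟩
  · have hv1 : v ∉ fnX L1 R1 := fun h' =>
      hv (h3 ⟨h', h.fn_subset (Term.mem_fn_inst.2 (.inr ⟨rfl, hz⟩))⟩).2
    refine ⟨_, _, .opened v ?_ ?_ fun _ => z0_mem_fn_ren_sh_par.2 hz, rr, .refl _⟩
    · rw [hi]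
      exact .par h1 h (h3.trans (Set.inter_subset_inter_right _ (up v)))
    · rw [fn_nu_ren_sh_par]
      rintro (h' | h')
      exacts [hv1 (h1.fn_subset h'), hv h']
  · have e : Ext b (.par P (Q.inst v)) (L1 + L2) (.par R1 R') := by
      refine .par h1 h ?_
      rintro a ⟨ha, ha'⟩
      have : a ∈ fnX L2 R2 := by
        rw [fnX, hs.fn_eq, Term.fn_nuA]
        refine ha'.imp_right fun h => ⟨h, ?_⟩
        rintro rfl
        exact hvA ha
      have := h3 ⟨ha, this⟩
      exact ⟨this.1, up v this.2⟩
    rw [← hi] at e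
    have k1 : v ∉ (Term.nu (.par (P.ren sh) Q)).fn := by
      rw [fn_nu_ren_sh_par]
      rintro (h' | h')
      exacts [hvA (h1.fn_subset h'), hv h']
    have k2 : v ∉ fnM (L1 + L2) := by
      rw [fnM_add]
      rintro (h' | h')
      exacts [hvA (.inl h'), hvL h']
    have k3 : v ∈ (Term.par R1 R').fn → z0 ∈ (Term.par (P.ren sh) Q).fn := by
      rw [z0_mem_fn_ren_sh_par]
      rintro (h' | h')
      exacts [absurd (.inr h') hvA, hz h']
    obtain ⟨X, hX, sX⟩ := e.kept k1 k2 k3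
      (hb.imp_right fun h h' => h'.elim (fun h' => hvA (.inr h')) h)
    exact ⟨_, _, hX, rr, (SC.parr hs _).trans
      ((SC.nuA_scope (fun h => hvA (.inr h)) _).symm.trans sX.symm)⟩

/-- Each of the two restrictions may be opened or kept. `build` treats the four cases together: `R2`
is the residual of the doubly instantiated body, `R1` what the inner restriction `w` makes of it,
and `R` what the outer restriction `v` makes of `R1`. -/
theorem nuComm (P : Term V) : Sim b (.nu (.nu P)) (.nu (.nu (P.ren swp))) := by
  intro L A hA
  have rr := rel_refl hA
  have hsh : ∀ a, sh (sh a) ∈ (P.ren swp).fn ↔ sh (sh a) ∈ P.fn := by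
    intro a
    have := (SC.nuComm (b := b) P).fn_eq
    simp only [Term.fn, Set.ext_iff, Set.mem_preimage] at this
    exact (this a).symm
  have hmem : ∀ a, a ∈ (P.ren swp).fn ↔ swp a ∈ P.fn := by
    intro a
    have hs : ∀ c : V, swp (swp c) = c := fun c => congrFun swp_swp c
    rw [Term.mem_fn_ren]
    exact ⟨fun ⟨c, hc, h⟩ => by rwa [← h, hs], fun h => ⟨_, h, hs a⟩⟩
  -- the two instantiations commute
  have hi : ∀ v w, (Term.inst v (P.ren (lift (scons w id)))) =
      Term.inst w ((P.ren swp).ren (lift (scons v id))) := by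
    intro v w
    rw [Term.inst_ren_lift, Term.inst_ren_lift, Term.ren_ren]
    congr 1
    refine name_funext (by simp) fun a => ?_
    rcases name_cases a with rfl | ⟨a, rfl⟩ <;> simp
  have hin : ∀ (P : Term V) v, (Term.nu P).inst v = .nu (P.ren (lift (scons v id))) :=
    fun _ _ => rfl
  have hl0 : ∀ (P : Term V) v, z0 ∈ (P.ren (lift (scons v id))).fn ↔ z0 ∈ P.fn := by
    intro P v
    rw [Term.mem_fn_ren]
    constructor
    · rintro ⟨c, hc, h⟩
      rcases name_cases c with rfl | ⟨c, rfl⟩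
      · exact hc
      · simp at h
    · exact fun h => ⟨_, h, by simp⟩
  have hls : ∀ (P : Term V) v a, sh a ∈ (P.ren (lift (scons v id))).fn ↔
      sh (sh a) ∈ P.fn ∨ (a = v ∧ sh z0 ∈ P.fn) := by
    intro P v a
    have := Term.mem_fn_inst (P := .nu P) (v := v) (a := a)
    exact this
  -- the matching extraction for instantiations `v` and `w`
  have build : ∀ v w R R1 R2, v ≠ w → v ∉ (Term.nu (.nu P)).fn → w ∉ (Term.nu (.nu P)).fn →
      Ext b (Term.inst w (P.ren (lift (scons v id)))) L R2 →
      (w ∈ fnX L R2 → z0 ∈ P.fn) → (v ∈ fnX L R2 → sh z0 ∈ P.fn) →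
      (R1 = R2 ∨ (w ∉ fnM L ∧ (b ∨ w ∉ R2.fn) ∧ R1 = .nuA w R2)) →
      (R = R1 ∨ (v ∉ fnM L ∧ (b ∨ v ∉ R2.fn) ∧ R = .nuA v R1)) →
      ∃ M R', Ext b (.nu (.nu (P.ren swp))) M R' ∧ Multiset.Rel (PrefixCong b) L M ∧ SC b R R' := by
    intro v w R R1 R2 hvw hv hw h hzw hzv h1 h2
    rw [hi] at h
    have hv' : v ∉ (Term.nu ((P.ren swp).ren (lift (scons w id)))).fn := by
      simp only [Term.fn, Set.mem_preimage, hls, hsh, not_or]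
      exact ⟨hv, fun h => hvw h.1⟩
    have hv'' : v ∈ fnX L R2 → z0 ∈ ((P.ren swp).ren (lift (scons w id))).fn := by
      rw [hl0, hmem, swp_z0]; exact hzv
    have hw' : w ∉ (Term.nu (.nu (P.ren swp))).fn := by
      simp only [Term.fn, Set.mem_preimage, hsh]; exact hw
    have hw'' : w ∈ fnX L R2 → z0 ∈ (Term.nu (P.ren swp)).fn := by
      simp only [Term.fn, Set.mem_preimage, hmem, swp_sh_z0]; exact hzw
    have first : ∃ X, Ext b (.nu ((P.ren swp).ren (lift (scons w id)))) L X ∧ X.fn ⊆ R2.fn ∧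
        ((R = R1 ∧ X = R2) ∨ (R = .nuA v R1 ∧ SC b X (.nuA v R2))) := by
      rcases h2 with rfl | ⟨h2, h3, rfl⟩
      · exact ⟨_, .opened v h hv' hv'', subset_rfl, .inl ⟨rfl, rfl⟩⟩
      · obtain ⟨X, hX, sX⟩ := h.kept hv' h2 (fun h => hv'' (.inr h)) h3
        refine ⟨X, hX, ?_, .inr ⟨rfl, sX⟩⟩
        rw [sX.fn_eq, Term.fn_nuA]
        exact Set.sdiff_subset
    obtain ⟨X, hX, hXf, hR⟩ := first
    rcases h1 with rfl | ⟨h1, h3, rfl⟩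
    · refine ⟨_, X, .opened w hX hw' fun h => hw'' (h.imp_right fun h => hXf h), rr, ?_⟩
      rcases hR with ⟨rfl, rfl⟩ | ⟨rfl, hR⟩
      exacts [.refl _, hR.symm]
    · obtain ⟨Y, hY, sY⟩ := hX.kept hw' h1 (fun h => hw'' (.inr (hXf h)))
        (h3.imp_right fun h h' => h (hXf h'))
      refine ⟨_, Y, hY, rr, ?_⟩
      rcases hR with ⟨rfl, rfl⟩ | ⟨rfl, hR⟩
      exacts [sY.symm, (SC.nuA_comm _ _ _).trans (.trans (hR.nuA w).symm sY.symm)]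
  rcases hA.nu_inv Set.finite_empty with ⟨v, hz, hv, h⟩ | ⟨v, R', -, hv, hvL, hz, h, hb, hs⟩
  · rw [hin] at h
    rcases h.nu_inv (Set.finite_singleton v) with ⟨w, hz', hw, h⟩ | ⟨w, R', hwA, hw, hwL, hz', h, hb, hs⟩
    · simp only [Term.fn, Set.mem_preimage, hls, not_or] at hw
      exact build v w A A A (fun e => hw.2 ⟨e.symm, hz⟩) hv hw.1 h (fun _ => (hl0 _ _).1 hz')
        (fun _ => hz) (.inl rfl) (.inl rfl)
    · simp only [Term.fn, Set.mem_preimage, hls, not_or] at hw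
      obtain ⟨M, R, h1, h2, h3⟩ := build v w _ _ R' (fun e => hwA e.symm) hv hw.1 h
        (fun h => (hl0 _ _).1 (hz' (h.resolve_left hwL))) (fun _ => hz) (.inr ⟨hwL, hb, rfl⟩) (.inl rfl)
      exact ⟨M, R, h1, h2, hs.trans h3⟩
  · rw [hin] at h
    rcases h.nu_inv (Set.finite_singleton v) with ⟨w, hz', hw, h⟩ | ⟨w, R2, hwA, hw, hwL, hz', h, hb', hs'⟩
    · simp only [Term.fn, Set.mem_preimage, hls, not_or] at hw
      have hvw : v ≠ w := by
        rintro rfl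
        have hv' : v ∈ fnX L R' := h.fn_subset (Term.mem_fn_inst.2 (.inr ⟨rfl, hz'⟩))
        exact hw.2 ⟨rfl, hz (hv'.resolve_left hvL)⟩
      obtain ⟨M, R, h1, h2, h3⟩ := build v w _ _ R' hvw hv hw.1 h
        (fun _ => (hl0 _ _).1 hz') (fun h => hz (h.resolve_left hvL)) (.inl rfl)
        (.inr ⟨hvL, hb, rfl⟩)
      exact ⟨M, R, h1, h2, hs.trans h3⟩
    · simp only [Term.fn, Set.mem_preimage, hls, not_or] at hw
      obtain ⟨M, R, h1, h2, h3⟩ := build v w _ _ R2 (fun e => hwA e.symm) hv hw.1 h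
        (fun h => (hl0 _ _).1 (hz' (h.resolve_left hwL)))
        (fun h => hz (by
          have := h.resolve_left hvL
          rw [hs'.fn_eq, Term.fn_nuA]
          exact ⟨this, fun e => hwA e.symm⟩)) (.inr ⟨hwL, hb', rfl⟩)
        (.inr ⟨hvL, hb.imp_right fun h h' => h (by
          rw [hs'.fn_eq, Term.fn_nuA]
          exact ⟨h', fun e => hwA e.symm⟩), rfl⟩)
      exact ⟨M, R, h1, h2, hs.trans ((hs'.nuA v).trans h3)⟩

end Sim

/-- This is the inversion principle for structural congruence. Both directions are proved at once
because of symmetry, and for all renamings because of binders. -/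
theorem SC.sim {b : Prop} {P Q : Term V} (h : SC b P Q) : Sim b P Q := by
  have of_eq : ∀ {P Q : Term V}, P = Q → Sim b P Q := by
    rintro P _ rfl L R h
    exact ⟨L, R, h, Sim.rel_refl h, .refl _⟩
  have gen : ∀ f : V → V, Sim b (P.ren f) (Q.ren f) ∧ Sim b (Q.ren f) (P.ren f) := by
    induction h with
    | refl P => exact fun f => ⟨of_eq rfl, of_eq rfl⟩
    | symm _ ih => exact fun f => (ih f).symm
    | trans _ _ ih1 ih2 => exact fun f => ⟨(ih1 f).1.trans (ih2 f).1, (ih2 f).2.trans (ih1 f).2⟩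
    | out x y h ih => exact fun f => ⟨.out _ _ (h.ren f), .out _ _ (h.ren f).symm⟩
    | inp x h ih => exact fun f => ⟨.inp _ (h.ren _), .inp _ (h.ren _).symm⟩
    | par h1 h2 ih1 ih2 =>
      exact fun f => ⟨.par (h1.ren f).fn_eq (h2.ren f).fn_eq (ih1 f).1 (ih2 f).1,
        .par (h1.ren f).symm.fn_eq (h2.ren f).symm.fn_eq (ih1 f).2 (ih2 f).2⟩
    | nu h ih =>
      refine fun f => ⟨.nu (h.ren _).fn_eq (h.ren _) fun v => ?_,
        .nu (h.ren _).symm.fn_eq (h.ren _).symm fun v => ?_⟩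
      · rw [Term.inst_ren_lift, Term.inst_ren_lift]; exact (ih _).1
      · rw [Term.inst_ren_lift, Term.inst_ren_lift]; exact (ih _).2
    | bang h ih =>
      exact fun f => ⟨.bang (h.ren f).fn_eq (h.ren f) (ih f).1,
        .bang (h.ren f).symm.fn_eq (h.ren f).symm (ih f).2⟩
    | assoc P Q R => exact fun f => ⟨.assoc _ _ _, .assoc' _ _ _⟩
    | comm P Q => exact fun f => ⟨.comm _ _, .comm _ _⟩
    | unit P => exact fun f => ⟨.unit _, .unit' _⟩
    | nuNil => exact fun f => ⟨.nuNil, .nuNil'⟩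
    | nuComm P =>
      intro f
      have h : swp ∘ lift (lift f) = lift (lift f) ∘ swp := by
        refine name_funext (by simp) fun a => ?_
        rcases name_cases a with rfl | ⟨a, rfl⟩ <;> simp
      have h1 := Sim.nuComm (b := b) (P.ren (lift (lift f)))
      have h2 := Sim.nuComm (b := b) ((P.ren (lift (lift f))).ren swp)
      rw [Term.ren_ren _ swp swp, swp_swp, Term.ren_id] at h2
      rw [Term.ren_ren, h] at h1 h2
      simp only [Term.ren, Term.ren_ren]
      exact ⟨h1, h2⟩
    | scope P Q =>
      intro f
      have h : lift f ∘ sh = sh ∘ f := by funext a; simp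
      have h1 := Sim.scope (b := b) (P.ren f) (Q.ren (lift f))
      have h2 := Sim.scope' (b := b) (P.ren f) (Q.ren (lift f))
      rw [Term.ren_ren, ← h] at h1 h2
      simp only [Term.ren, Term.ren_ren]
      exact ⟨h1, h2⟩
    | unfold P hb =>
      intro f
      refine ⟨?_, fun L R h => ⟨L, R, .bang hb h, Sim.rel_refl h, .refl _⟩⟩
      intro L R h
      cases h with
      | refl => exact ⟨0, _, .refl _ (.inl hb), .zero, .unfold _ hb⟩
      | bang hb h => exact ⟨_, _, h, Sim.rel_refl h, .refl _⟩
  simpa using (gen id).1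

/-! ### Parallel composition of a multiset -/

/-- The parallel composition of the elements of a multiset, in some order. -/
noncomputable def prod (L : Multiset (Term V)) : Term V := L.toList.foldr .par .nil

section Prod

variable {b : Prop}

theorem SC.foldr_perm {l l' : List (Term V)} (h : l.Perm l') :
    SC b (l.foldr .par .nil) (l'.foldr .par .nil) := by
  induction h with
  | nil => exact .refl _
  | cons p _ ih => exact .parr ih _
  | swap p q l => exact (SC.assoc _ _ _).trans (.trans (.parl (.comm _ _) _) (SC.assoc _ _ _).symm)
  | trans _ _ ih1 ih2 => exact ih1.trans ih2

theorem prod_zero : prod (0 : Multiset (Term V)) = .nil := by simp [prod]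

theorem SC.prod_cons (p : Term V) (L : Multiset (Term V)) :
    SC b (prod (p ::ₘ L)) (.par p (prod L)) := by
  refine SC.foldr_perm (l' := p :: L.toList) ?_
  rw [← Multiset.coe_eq_coe, ← Multiset.cons_coe, Multiset.coe_toList, Multiset.coe_toList]

theorem SC.prod_singleton (p : Term V) : SC b (prod {p}) p := by
  have := SC.prod_cons (b := b) p 0
  rw [prod_zero] at this
  exact this.trans (.unit _)

theorem SC.prod_add (L M : Multiset (Term V)) :
    SC b (prod (L + M)) (.par (prod L) (prod M)) := by
  induction L using Multiset.induction_on with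
  | empty => rw [zero_add, prod_zero]; exact (SC.unit' _).symm
  | cons p L ih =>
    rw [Multiset.cons_add]
    exact (SC.prod_cons _ _).trans ((SC.parr ih _).trans ((SC.assoc _ _ _).trans
      (.parl (SC.prod_cons _ _).symm _)))

theorem fn_prod (L : Multiset (Term V)) : (prod L).fn = fnM L := by
  induction L using Multiset.induction_on with
  | empty => simp [prod_zero, Term.fn]
  | cons p L ih => rw [(SC.prod_cons (b := False) p L).fn_eq, fnM_cons, ← ih]; rfl

theorem Term.Async.prod {L : Multiset (Term V)} (h : ∀ p ∈ L, p.Async) : (prod L).Async := by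
  have : ∀ l : List (Term V), (∀ p ∈ l, p.Async) → (l.foldr Term.par .nil).Async := by
    intro l
    induction l with
    | nil => intro _; trivial
    | cons p l ih =>
      exact fun h => ⟨h p (by simp), ih fun q hq => h q (by simp [hq])⟩
  exact this _ fun p hp => h p (by simpa using hp)

theorem SC.parr_prod_add (L M : Multiset (Term V)) (P Q : Term V) :
    SC b (.par (prod (L + M)) (.par P Q)) (.par (.par (prod L) P) (.par (prod M) Q)) :=
  (SC.parl (.prod_add _ _) _).trans (.parComm4 _ _ _ _)

end Prod

theorem fn_par_prod (L : Multiset (Term V)) (R : Term V) :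
    (Term.par (prod L) R).fn = fnX L R := by
  rw [Term.fn, fn_prod, fnX]

/-- A term is congruent to the reassembly of any of its extractions. -/
theorem Ext.sc {b : Prop} {P R : Term V} {L : Multiset (Term V)} (h : Ext b P L R) {ws : List V}
    (h1 : ∀ a ∈ ws, a ∉ P.fn) (h2 : ∀ a ∈ fnX L R, a ∉ P.fn → a ∈ ws) :
    SC b P (.nuAs ws (.par (prod L) R)) := by
  classical
  have drop : ∀ (P : Term V) (ws : List V), (∀ a ∈ ws, a ∉ P.fn) →
      SC b P (.nuAs ws (.par (prod 0) P)) := by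
    intro P ws h
    rw [prod_zero]
    exact ((SC.nuAs (.unit' _) ws).trans (.nuAs_of_notMem h)).symm
  induction h generalizing ws with
  | refl P => exact drop P ws h1
  | out x y P =>
    exact (SC.nuAs ((SC.parl (.prod_singleton _) _).trans (.unit _)) ws |>.trans
      (.nuAs_of_notMem h1)).symm
  | inp x P =>
    exact (SC.nuAs ((SC.parl (.prod_singleton _) _).trans (.unit _)) ws |>.trans
      (.nuAs_of_notMem h1)).symm
  | @par P Q L M P' Q' hP hQ h ih1 ih2 =>
    have f1 := hP.fn_subset
    have f2 := hQ.fn_subset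
    simp only [Term.fn, Set.mem_union, not_or] at h1 h2
    rw [Sim.fnX_par] at h2
    -- The names in `ws` are divided between the two sides according to whether they occur on the
    -- left; by the side condition `h` none occurs on both.
    have k1 := ih1 (ws := ws.filter (· ∈ fnX L P')) (fun a ha => (h1 a (List.mem_filter.1 ha).1).1)
      fun a ha hP => List.mem_filter.2 ⟨h2 a (.inl ha) ⟨hP, fun hQ => hP (h ⟨ha, f2 hQ⟩).1⟩,
        by simpa using ha⟩
    have k2 := ih2 (ws := ws.filter (· ∉ fnX L P')) (fun a ha => (h1 a (List.mem_filter.1 ha).1).2)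
      fun a ha hQ => List.mem_filter.2 ⟨h2 a (.inr ha) ⟨fun hP => hQ (h ⟨f1 hP, ha⟩).2, hQ⟩,
        by simpa using fun h' => hQ (h ⟨h', ha⟩).2⟩
    refine (k1.par k2).trans ?_
    refine (SC.nuAs_scope' ?_ _).symm.trans (.trans (.nuAs (SC.nuAs_scope ?_ _).symm _) ?_)
    · intro a ha
      rw [← k2.fn_eq]
      exact (h1 a (List.mem_filter.1 ha).1).2
    · intro a ha
      rw [fn_par_prod]
      simpa using (List.mem_filter.1 ha).2
    · rw [← Term.nuAs_append]
      refine (SC.nuAs (SC.parr_prod_add _ _ _ _).symm _).trans (.nuAs_congr fun a _ => ?_)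
      simp only [List.mem_append, List.mem_filter, ← and_or_left]
      simp [em]
  | @opened v P L P' h hv hz ih =>
    have k := ih (ws := ws.filter (· ≠ v)) ?_ ?_
    · rw [← Term.nuA_inst hv]
      refine (k.nuA v).trans (.trans (.nuAs_congr (ws := v :: ws.filter (· ≠ v)) (ws' := ws) ?_)
        (.refl _))
      intro a ha
      rw [fn_par_prod] at ha
      by_cases hav : a = v
      · subst hav
        simpa using h2 a ha hv
      · simp [hav]
    · intro a ha
      rw [Term.mem_fn_inst, not_or]
      simp only [List.mem_filter, decide_eq_true_eq] at ha
      exact ⟨h1 a ha.1, fun h => ha.2 h.1⟩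
    · intro a ha ha'
      rw [Term.mem_fn_inst, not_or] at ha'
      simp only [List.mem_filter, decide_eq_true_eq]
      refine ⟨h2 a ha ha'.1, ?_⟩
      rintro rfl
      exact ha'.2 ⟨rfl, hz ha⟩
  | @closed _ v P L P' h hv hz hL ih =>
    have k := ih (ws := ws.filter (· ≠ v)) ?_ ?_
    · rw [← Term.nuA_inst hv]
      refine (k.nuA v).trans (.trans (.nuA_nuAs _ _ _) (.trans (.nuAs (.nuA_scope ?_ _) _)
        (.nuAs_congr ?_)))
      · rwa [fn_prod]
      · intro a ha
        rw [fn_par_prod, fnX, Term.fn_nuA] at ha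
        have : a ≠ v := by rintro rfl; simp [hL] at ha
        simp [this]
    · intro a ha
      rw [Term.mem_fn_inst, not_or]
      simp only [List.mem_filter, decide_eq_true_eq] at ha
      exact ⟨h1 a ha.1, fun h => ha.2 h.1⟩
    · intro a ha ha'
      rw [Term.mem_fn_inst, not_or] at ha'
      have hav : a ≠ v := by
        rintro rfl
        exact ha'.2 ⟨rfl, hz ha⟩
      simp only [List.mem_filter, decide_eq_true_eq]
      refine ⟨h2 a (ha.imp_right fun h => ?_) ha'.1, hav⟩
      rw [Term.fn_nuA]
      exact ⟨h, hav⟩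
  | @bang P L P' hb h ih =>
    exact (SC.unfold P hb).trans (ih (by simpa [Term.fn] using h1) (by simpa [Term.fn] using h2))

/-- The names opened by an extraction. -/
theorem Ext.exists_opened {b : Prop} {P R : Term V} {L : Multiset (Term V)} (_h : Ext b P L R) :
    ∃ ws : List V, ws.Nodup ∧ ∀ a, a ∈ ws ↔ a ∈ fnX L R ∧ a ∉ P.fn := by
  classical
  refine ⟨((fnX_finite L R).sdiff (t := P.fn)).toFinset.toList, Finset.nodup_toList _, ?_⟩
  simp

/-- Opening restrictions of names that occur. -/
theorem Ext.nuAs {b : Prop} {P R : Term V} {L : Multiset (Term V)} (h : Ext b P L R)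
    (hF : fnX L R ⊆ P.fn) {ws : List V} (hws : ws.Nodup) : Ext b (P.nuAs ws) L R := by
  induction ws with
  | nil => exact h
  | cons w ws ih =>
    rw [List.nodup_cons] at hws
    refine .opened w ?_ ?_ fun hw => ?_
    · rw [Term.inst_ren_cl_self]
      exact ih hws.2
    · exact fun h => (Term.sh_mem_fn_ren_cl.1 h).2 rfl
    · exact Term.z0_mem_fn_ren_cl.2 (Term.mem_fn_nuAs.2 ⟨hF hw, hws.1⟩)

end Ext


/-! ### Reduction on alpha-classes -/

section Reduction

variable {V : Type*} [Infinite V] [DecidableEq V]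

/-- Bound names are moved out of the way by transpositions with fresh names. A permutation is used
because extractions and restrictions are stable under injective renamings. -/
theorem exists_perm_avoiding {K A : Set V} (hK : K.Finite) (hA : A.Finite) {ws : List V}
    (hws : ∀ w ∈ ws, w ∉ K) :
    ∃ e : Equiv.Perm V, (∀ k ∈ K, e k = k) ∧ ∀ w ∈ ws, e w ∉ A := by
  induction ws with
  | nil => exact ⟨1, by simp, by simp⟩
  | cons w ws ih =>
    obtain ⟨e, h1, h2⟩ := ih fun v hv => hws v (by simp [hv])
    by_cases hw : e w ∈ A
    · obtain ⟨c, hc⟩ := ((hA.union hK).union (ws.map e).finite_toSet).infinite_compl.nonempty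
      simp only [Set.mem_compl_iff, Set.mem_union, not_or, Set.mem_ofPred_eq, List.mem_map,
        not_exists, not_and] at hc
      refine ⟨Equiv.swap (e w) c * e, fun k hk => ?_, fun v hv => ?_⟩
      · rw [Equiv.Perm.mul_apply, h1 k hk]
        refine Equiv.swap_apply_of_ne_of_ne ?_ ?_
        · intro h
          have : w = k := e.injective (by rw [← h, h1 k hk])
          exact hws w (by simp) (this ▸ hk)
        · rintro rfl; exact hc.1.2 hk
      · rw [Equiv.Perm.mul_apply]
        rcases List.mem_cons.1 hv with rfl | hv
        · rw [Equiv.swap_apply_left]; exact hc.1.1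
        · rw [Equiv.swap_apply_of_ne_of_ne (fun h => h2 v hv (by rwa [h])) (hc.2 v hv)]
          exact h2 v hv
    · refine ⟨e, h1, fun v hv => ?_⟩
      rcases List.mem_cons.1 hv with rfl | hv
      exacts [hw, h2 v hv]

/-- A communication about to happen. -/
abbrev redex (x y : V) (A B C : Term V) : Term V := .par (.par (.out x y A) (.inp x B)) C

/-- The result of a communication. -/
noncomputable abbrev reduct (y : V) (A B C : Term V) : Term V := .par (.par A (B.inst y)) C

theorem fn_inst_subset (B : Term V) (y : V) (a : V) (h : a ∈ (B.inst y).fn) : sh a ∈ B.fn ∨ a = y :=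
  (Term.mem_fn_inst.1 h).imp_right And.left

theorem fn_reduct_subset (x y : V) (A B C : Term V) :
    (reduct y A B C).fn ⊆ (redex x y A B C).fn := by
  intro a ha
  simp only [Term.fn, Set.mem_union, Set.mem_insert_iff, Set.mem_singleton_iff,
    Set.mem_preimage] at ha ⊢
  rcases ha with (h | h) | h
  · simp [h]
  · rcases fn_inst_subset _ _ _ h with h | h <;> simp [h]
  · simp [h]

/-- Reduction, in normal form. -/
def RedN (P P' : Term V) : Prop :=
  ∃ (ws : List V) (x y : V) (A B C : Term V), SC True P (.nuAs ws (redex x y A B C)) ∧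
    SC True P' (.nuAs ws (reduct y A B C))

theorem ren_redex (x y : V) (A B C : Term V) (f : V → V) :
    (redex x y A B C).ren f = redex (f x) (f y) (A.ren f) (B.ren (lift f)) (C.ren f) := rfl

theorem ren_reduct (y : V) (A B C : Term V) (f : V → V) :
    (reduct y A B C).ren f = reduct (f y) (A.ren f) (B.ren (lift f)) (C.ren f) := by
  simp only [reduct, Term.ren, Term.ren_inst]

theorem Ext.par_of_subset {b : Prop} {P Q P' Q' : Term V} {L M : Multiset (Term V)}
    (h1 : Ext b P L P') (h2 : Ext b Q M Q') (f1 : fnX L P' ⊆ P.fn) (f2 : fnX M Q' ⊆ Q.fn) :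
    Ext b (.par P Q) (L + M) (.par P' Q') ∧
      fnX (L + M) (.par P' Q') ⊆ (Term.par P Q).fn := by
  refine ⟨.par h1 h2 (Set.inter_subset_inter f1 f2), ?_⟩
  rw [Sim.fnX_par]
  exact Set.union_subset_union f1 f2

theorem Ext.async {b : Prop} {P R : Term V} {L : Multiset (Term V)} (h : Ext b P L R)
    (hP : P.Async) : (∀ p ∈ L, p.Async) ∧ R.Async := by
  induction h with
  | refl P => exact ⟨by simp, hP⟩
  | out x y P => exact ⟨by simpa using hP, trivial⟩
  | inp x P => exact ⟨by simpa using hP, trivial⟩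
  | par _ _ _ ih1 ih2 =>
    refine ⟨fun p hp => ?_, (ih1 hP.1).2, (ih2 hP.2).2⟩
    rcases Multiset.mem_add.1 hp with h | h
    exacts [(ih1 hP.1).1 p h, (ih2 hP.2).1 p h]
  | @opened v P _ _ _ _ _ ih => exact ih (Term.Async.ren (t := P) hP _)
  | @closed _ v P _ _ _ _ _ _ ih =>
    have := ih (Term.Async.ren (t := P) hP _)
    exact ⟨this.1, this.2.ren _⟩
  | bang _ _ ih => exact ih ⟨hP, hP⟩

theorem Term.Async.nuAs {P : Term V} (h : P.Async) (ws : List V) : (P.nuAs ws).Async := by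
  induction ws with
  | nil => exact h
  | cons w ws ih => exact ih.ren _

theorem rel_pair {b : Prop} {x y : V} {A B : Term V} {M : Multiset (Term V)}
    (h : Multiset.Rel (PrefixCong b) {.out x y A, .inp x B} M) :
    ∃ A' B', M = {.out x y A', .inp x B'} ∧ SC b A A' ∧ SC b B B' := by
  rw [Multiset.insert_eq_cons, ← Multiset.cons_zero] at h
  obtain ⟨p, M1, hp, h1, rfl⟩ := Multiset.rel_cons_left.1 h
  obtain ⟨q, M2, hq, h2, rfl⟩ := Multiset.rel_cons_left.1 h1
  rw [Multiset.rel_zero_left] at h2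
  subst h2
  cases hp with
  | out _ _ hA => cases hq with | inp _ hB => exact ⟨_, _, rfl, hA, hB⟩

theorem Ext.of_redex (x y : V) (A B C : Term V) :
    Ext True (redex x y A B C) {.out x y A, .inp x B} (.par (.par .nil .nil) C) ∧
      fnX {.out x y A, .inp x B} (.par (.par .nil .nil) C) ⊆ (redex x y A B C).fn := by
  have h1 := Ext.par_of_subset (b := True) (.out x y A) (.inp x B) (by simp [fnX, Term.fn])
    (by simp [fnX, Term.fn])
  have h2 := Ext.par_of_subset h1.1 (.refl C (.inl trivial)) h1.2 (by simp [fnX])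
  rwa [add_zero, Multiset.singleton_add] at h2

theorem fnX_redex (x y : V) (A B R : Term V) :
    fnX {.out x y A, .inp x B} R = (redex x y A B R).fn := by
  ext a; simp [fnX, Term.fn, Multiset.insert_eq_cons]

theorem SC.prod_pair {b : Prop} (p q : Term V) : SC b (prod {p, q}) (.par p q) :=
  (SC.prod_cons _ _).trans (.parr (.prod_singleton _) _)

theorem SC.reduct_congr {b : Prop} (y : V) {A B C A' B' C' : Term V} (hA : SC b A A') (hB : SC b B B')
    (hC : SC b C C') : SC b (reduct y A B C) (reduct y A' B' C') :=
  (hA.par (hB.inst y)).par hC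

namespace RedN

variable {P P' Q Q' : Term V}

theorem sc (h : RedN P P') (hQ : SC True Q P) (hQ' : SC True P' Q') : RedN Q Q' := by
  obtain ⟨ws, x, y, A, B, C, h1, h2⟩ := h
  exact ⟨ws, x, y, A, B, C, hQ.trans h1, hQ'.symm.trans h2⟩

theorem nuA (h : RedN P P') (v : V) : RedN (P.nuA v) (P'.nuA v) := by
  obtain ⟨ws, x, y, A, B, C, h1, h2⟩ := h
  exact ⟨v :: ws, x, y, A, B, C, h1.nuA v, h2.nuA v⟩

theorem nuAs (h : RedN P P') (ws : List V) : RedN (P.nuAs ws) (P'.nuAs ws) := by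
  induction ws with
  | nil => exact h
  | cons w ws ih => exact ih.nuA w

theorem fn_subset (h : RedN P P') : P'.fn ⊆ P.fn := by
  obtain ⟨ws, x, y, A, B, C, h1, h2⟩ := h
  rw [h1.fn_eq, h2.fn_eq]
  intro a ha
  rw [Term.mem_fn_nuAs] at ha ⊢
  exact ⟨fn_reduct_subset x y A B C ha.1, ha.2⟩

theorem ren (h : RedN P P') {f : V → V} (hf : Function.Injective f) :
    RedN (P.ren f) (P'.ren f) := by
  obtain ⟨ws, x, y, A, B, C, h1, h2⟩ := h
  refine ⟨ws.map f, f x, f y, A.ren f, B.ren (lift f), C.ren f, ?_, ?_⟩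
  · rw [← ren_redex, ← Term.ren_nuAs hf]; exact h1.ren f
  · rw [← ren_reduct, ← Term.ren_nuAs hf]; exact h2.ren f

/-- The restrictions of the normal form are renamed off `Q`, after which their scope extends over
it. -/
theorem par (h : RedN P P') (Q : Term V) : RedN (.par P Q) (.par P' Q) := by
  obtain ⟨ws, x, y, A, B, C, h1, h2⟩ := h
  obtain ⟨e, he1, he2⟩ := exists_perm_avoiding (ws := ws)
    (K := (Term.nuAs ws (redex x y A B C)).fn) (Term.fn_finite _) Q.fn_finite
    fun w hw h => (Term.mem_fn_nuAs.1 h).2 hw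
  have he : Function.Injective e := e.injective
  have h1' : Term.nuAs ws (redex x y A B C) = .nuAs (ws.map e) ((redex x y A B C).ren e) := by
    rw [← Term.ren_nuAs he, Term.ren_eq_self he1]
  have h2' : Term.nuAs ws (reduct y A B C) = .nuAs (ws.map e) ((reduct y A B C).ren e) := by
    rw [← Term.ren_nuAs he, Term.ren_eq_self]
    intro a ha
    rw [Term.mem_fn_nuAs] at ha
    exact he1 a (Term.mem_fn_nuAs.2 ⟨fn_reduct_subset x y A B C ha.1, ha.2⟩)
  have hQ : ∀ w ∈ ws.map e, w ∉ Q.fn := by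
    intro w hw
    obtain ⟨v, hv, rfl⟩ := List.mem_map.1 hw
    exact he2 v hv
  rw [h1', ren_redex] at h1
  rw [h2', ren_reduct] at h2
  exact ⟨ws.map e, e x, e y, A.ren e, B.ren (lift e), .par (C.ren e) Q,
    (h1.parl Q).trans ((SC.nuAs_scope' hQ _).symm.trans (.nuAs (SC.assoc _ _ _).symm _)),
    (h2.parl Q).trans ((SC.nuAs_scope' hQ _).symm.trans (.nuAs (SC.assoc _ _ _).symm _))⟩

theorem of_ext {x y : V} {A B R : Term V} (h : Ext True P {.out x y A, .inp x B} R) {ws : List V}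
    (h1 : ∀ a ∈ ws, a ∉ P.fn) (h2 : ∀ a ∈ fnX {.out x y A, .inp x B} R, a ∉ P.fn → a ∈ ws) :
    RedN P (.nuAs ws (reduct y A B R)) :=
  ⟨ws, x, y, A, B, R, (h.sc h1 h2).trans (.nuAs (.parl (.prod_pair _ _) _) _), .refl _⟩

/-- The redex is found in `P` itself: `SC.sim` transports the evident extraction from the normal
form to `P`. The result is determined up to congruence by any list that contains the opened names
and no free name of `P`. -/
theorem exists_ext (h : RedN P P') : ∃ (x y : V) (A B R : Term V),
    Ext True P {.out x y A, .inp x B} R ∧ ∀ ws : List V, (∀ a ∈ ws, a ∉ P.fn) →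
      (∀ a ∈ fnX {.out x y A, .inp x B} R, a ∉ P.fn → a ∈ ws) →
      SC True P' (.nuAs ws (reduct y A B R)) := by
  obtain ⟨ws, x, y, A, B, C, h1, h2⟩ := h
  have h1' := h1.trans (.nuAs_congr (ws' := ws.dedup) (by simp))
  obtain ⟨e1, e2⟩ := Ext.of_redex x y A B C
  obtain ⟨M, R, h3, h4, h5⟩ := h1'.symm.sim _ _ (e1.nuAs e2 (List.nodup_dedup ws))
  obtain ⟨A', B', rfl, hA, hB⟩ := rel_pair h4
  refine ⟨x, y, A', B', R, h3, fun vs k1 k2 => ?_⟩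
  refine h2.trans (.trans (.nuAs_congr fun a ha => ?_)
    (.nuAs (.reduct_congr y hA hB (.trans (.symm ?_) h5)) vs))
  · replace ha := fn_reduct_subset x y A B C ha
    have hfn := h1.fn_eq
    constructor
    · intro haw
      refine k2 a ?_ ?_
      · rw [← Sim.fnX_eq h4 h5, fnX_redex]
        simpa [Term.fn] using ha
      · rw [hfn]; exact fun h => (Term.mem_fn_nuAs.1 h).2 haw
    · intro hav
      by_contra haw
      refine k1 a hav ?_
      rw [hfn]
      exact Term.mem_fn_nuAs.2 ⟨ha, haw⟩
  · exact (SC.parl (.unit _) _).trans (.unit' _)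

/-- A restriction does not create reductions: whether the extraction opens or keeps it, the same
pair can be extracted below it. -/
theorem nuA_inv {v : V} (h : RedN (P.nuA v) P') : ∃ P'', RedN P P'' ∧ SC True P' (P''.nuA v) := by
  obtain ⟨x, y, A, B, R, he, hs⟩ := h.exists_ext
  -- The extraction may have instantiated the restriction with a name `w` other than `v`; a
  -- transposition turns it back in the end.
  have main : ∃ w P'', w ∉ (P.nuA v).fn ∧ RedN ((P.ren (cl v)).inst w) P'' ∧
      SC True P' (P''.nuA w) := by
    unfold Term.nuA at he hs
    generalize hL : ({.out x y A, .inp x B} : Multiset (Term V)) = L at he hs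
    cases he with
    | refl => simp at hL
    | opened w h hw hz =>
      obtain ⟨ws, -, hws⟩ := h.exists_opened
      subst hL
      refine ⟨w, _, hw, .of_ext h (fun a ha => ((hws a).1 ha).2) fun a ha ha' =>
        (hws a).2 ⟨ha, ha'⟩, ?_⟩
      refine hs (w :: ws) ?_ ?_
      · intro a ha
        rcases List.mem_cons.1 ha with rfl | ha
        · exact hw
        · exact fun h => ((hws a).1 ha).2 (Term.mem_fn_inst.2 (.inl h))
      · intro a ha ha'
        by_cases haw : a = w
        · simp [haw]
        · refine List.mem_cons_of_mem _ ((hws a).2 ⟨ha, ?_⟩)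
          rw [Term.mem_fn_inst]
          rintro (h | h)
          exacts [ha' h, haw h.1]
    | @closed _ w _ _ R' h hw hz hL' =>
      obtain ⟨ws, -, hws⟩ := h.exists_opened
      subst hL
      refine ⟨w, _, hw, .of_ext h (fun a ha => ((hws a).1 ha).2) fun a ha ha' =>
        (hws a).2 ⟨ha, ha'⟩, ?_⟩
      refine (hs ws ?_ ?_).trans (.trans (.nuAs (SC.nuA_scope ?_ _).symm _) (SC.nuA_nuAs _ _ _).symm)
      · exact fun a ha h => ((hws a).1 ha).2 (Term.mem_fn_inst.2 (.inl h))
      · intro a ha ha'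
        have haw : a ≠ w := by
          rintro rfl
          rw [fnX, Term.fn_nuA] at ha
          exact ha.elim hL' fun h => h.2 rfl
        refine (hws a).2 ⟨ha.imp_right fun h => ?_, ?_⟩
        · rw [Term.fn_nuA] at h; exact h.1
        · rw [Term.mem_fn_inst]
          rintro (h | h)
          exacts [ha' h, haw h.1]
      · intro h
        refine hL' ?_
        simp only [Term.fn, Set.mem_union] at h
        simp only [Multiset.insert_eq_cons, fnM_cons, fnM_singleton, Term.fn, Set.mem_union,
          Set.mem_insert_iff, Set.mem_singleton_iff, Set.mem_preimage]
        rcases h with h | h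
        · simp [h]
        · rcases fn_inst_subset _ _ _ h with h | h <;> simp [h]
  obtain ⟨w, P'', hw, h1, h2⟩ := main
  have hf := (Equiv.swap v w).injective
  have hfix : ∀ a, a ≠ v → a ≠ w → Equiv.swap v w a = a :=
    fun a => Equiv.swap_apply_of_ne_of_ne
  rw [Term.fn_nuA] at hw
  refine ⟨P''.ren (Equiv.swap v w), ?_, ?_⟩
  · have := h1.ren hf
    rwa [Term.inst_ren_cl, Term.ren_ren, Term.ren_eq_self] at this
    intro a ha
    by_cases hav : a = v
    · subst hav; simp
    · simp only [Function.comp, Function.update_apply, if_neg hav, id]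
      exact hfix a hav fun e => hw ⟨e ▸ ha, e ▸ hav⟩
  · have e : (P''.ren (Equiv.swap v w)).nuA v = (P''.nuA w).ren (Equiv.swap v w) := by
      rw [Term.ren_nuA hf, Equiv.swap_apply_right]
    rw [e, Term.ren_eq_self]
    · exact h2
    · intro a ha
      rw [Term.fn_nuA] at ha
      refine hfix a ?_ ha.2
      rintro rfl
      have := h1.fn_subset ha.1
      rw [Term.mem_fn_inst, Term.sh_mem_fn_ren_cl] at this
      exact this.elim (fun h => h.2 rfl) fun h => ha.2 h.1

theorem nuAs_inv {ws : List V} (h : RedN (P.nuAs ws) P') :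
    ∃ P'', RedN P P'' ∧ SC True P' (P''.nuAs ws) := by
  induction ws generalizing P' with
  | nil => exact ⟨P', h, .refl _⟩
  | cons w ws ih =>
    obtain ⟨Q, h1, h2⟩ := nuA_inv h
    obtain ⟨Q', h3, h4⟩ := ih h1
    exact ⟨Q', h3, h2.trans (h4.nuA w)⟩

/-- Congruence may leave the asynchronous calculus, as when the continuation `0` of an output
becomes `0 | 0`; but a reduct read off from an extraction stays inside. -/
theorem exists_async (h : RedN P P') (hP : P.Async) : ∃ Q, Q.Async ∧ SC True P' Q := by
  obtain ⟨x, y, A, B, R, he, hs⟩ := h.exists_ext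
  obtain ⟨ws, -, hws⟩ := he.exists_opened
  obtain ⟨h1, h2⟩ := he.async hP
  have hA : A = .nil := h1 (.out x y A) (by simp)
  have hB : B.Async := h1 (.inp x B) (by simp)
  subst hA
  exact ⟨_, Term.Async.nuAs (P := reduct y .nil B R) ⟨⟨trivial, hB.ren _⟩, h2⟩ ws,
    hs ws (fun a ha => ((hws a).1 ha).2) fun a ha ha' => (hws a).2 ⟨ha, ha'⟩⟩

end RedN

/-! ### Inert reductions and their commutation with other reductions -/

/-- Inert reduction, in normal form. -/
def InertN (P Q : Term V) : Prop :=
  ∃ (ws : List V) (v y : V) (A B C : Term V), v ∉ (reduct y A B C).fn ∧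
    SC True P (.nuAs ws (.nuA v (redex v y A B C))) ∧ SC True Q (.nuAs ws (reduct y A B C))

namespace InertN

variable {P P' Q Q' : Term V}

theorem sc_left (h : InertN P Q) (h' : SC True P' P) : InertN P' Q := by
  obtain ⟨ws, v, y, A, B, C, hv, h1, h2⟩ := h
  exact ⟨ws, v, y, A, B, C, hv, h'.trans h1, h2⟩

theorem redN (h : InertN P Q) : RedN P Q := by
  obtain ⟨ws, v, y, A, B, C, hv, h1, h2⟩ := h
  refine ⟨ws ++ [v], v, y, A, B, C, ?_, ?_⟩
  · rw [Term.nuAs_append]; exact h1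
  · rw [Term.nuAs_append]; exact h2.trans (.nuAs (SC.nuA_of_notMem hv).symm ws)

/-- Since `v` does not occur in `C`, neither displayed prefix has a partner there: the two
communicate with each other or take no part. -/
theorem redex_cases {v y : V} {A B C X : Term V} (hv : v ∉ C.fn) (h : RedN (redex v y A B C) X) :
    SC True X (reduct y A B C) ∨ ∃ C', RedN C C' ∧ SC True X (redex v y A B C') := by
  obtain ⟨x, y', A', B', R, he, hs⟩ := h.exists_ext
  obtain ⟨ws, -, hws⟩ := he.exists_opened
  replace hs := hs ws (fun a ha => ((hws a).1 ha).2) fun a ha ha' => (hws a).2 ⟨ha, ha'⟩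
  obtain ⟨L, L3, S, R3, hL, rfl, h12, h3, hc⟩ := he.par_inv
  obtain ⟨L1, L2, R1, R2, rfl, rfl, h1, h2, -⟩ := h12.par_inv
  have hwsC : ∀ a ∈ ws, a ∉ C.fn := fun a ha h => ((hws a).1 ha).2 (.inr h)
  have hwsD : ∀ a ∈ ws, a ∉ (Term.par (.out v y A) (.inp v B)).fn :=
    fun a ha h => ((hws a).1 ha).2 (.inl h)
  have hws3 : ∀ a ∈ fnX L3 R3, a ∉ C.fn → a ∈ ws := by
    intro a ha ha'
    refine (hws a).2 ⟨?_, ?_⟩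
    · rw [hL, Sim.fnX_par]; exact .inr ha
    · exact fun h => h.elim (fun h => ha' (hc ⟨h12.fn_subset h, ha⟩).2) ha'
  -- A name opened inside `C` could happen to be `v`; the side condition on shared names excludes
  -- this.
  have hno : ∀ p ∈ L3, v ∈ p.fn → v ∈ fnX (L1 + L2) (.par R1 R2) → False :=
    fun p hp hvp h => hv (hc ⟨h, .inl ⟨p, hp, hvp⟩⟩).2
  cases h1 with
  | refl =>
    cases h2 with
    | refl =>
      right
      simp only [zero_add] at hL
      subst hL
      refine ⟨_, .of_ext h3 hwsC hws3, hs.trans ?_⟩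
      refine .trans (.nuAs ?_ ws) (SC.nuAs_scope hwsD _)
      exact (SC.assoc _ _ _).trans (.trans (.parl (.comm _ _) _) (SC.assoc _ _ _).symm)
    | inp =>
      exfalso
      have hm : Term.inp v B ∈ ({.out x y' A', .inp x B'} : Multiset (Term V)) := by
        rw [hL]; simp
      have ho : Term.out x y' A' ∈ 0 + {Term.inp v B} + L3 := by rw [← hL]; simp
      simp at hm ho
      obtain ⟨rfl, -⟩ := hm
      exact hno _ ho (by simp [Term.fn]) (by simp [fnX, Term.fn])
  | out =>
    cases h2 with
    | refl =>
      exfalso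
      have hm : Term.out v y A ∈ ({.out x y' A', .inp x B'} : Multiset (Term V)) := by
        rw [hL]; simp
      have ho : Term.inp x B' ∈ {Term.out v y A} + 0 + L3 := by rw [← hL]; simp
      simp at hm ho
      obtain ⟨rfl, -⟩ := hm
      exact hno _ ho (by simp [Term.fn]) (by simp [fnX, Term.fn])
    | inp =>
      left
      have hcard := congrArg Multiset.card hL
      simp at hcard
      subst hcard
      have hm : Term.out v y A ∈ ({.out x y' A', .inp x B'} : Multiset (Term V)) := by
        rw [hL]; simp
      have hm' : Term.inp v B ∈ ({.out x y' A', .inp x B'} : Multiset (Term V)) := by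
        rw [hL]; simp
      simp at hm hm'
      obtain ⟨rfl, rfl, rfl⟩ := hm
      obtain ⟨-, rfl⟩ := hm'
      refine hs.trans ?_
      refine .trans (.nuAs (.parr (.trans (.parl (.trans (.unit _) ?_) _) (.refl _)) _) ws)
        ((SC.nuAs_scope ?_ _).trans (.parr (h3.sc hwsC hws3).symm _))
      · rw [prod_zero]; exact .refl _
      · intro a ha h
        refine hwsD a ha ?_
        simp only [Term.fn, Set.mem_union, Set.mem_insert_iff, Set.mem_singleton_iff,
          Set.mem_preimage] at h ⊢
        rcases h with h | h
        · simp [h]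
        · rcases fn_inst_subset _ _ _ h with h | h <;> simp [h]

/-- The restrictions are stripped by inversion and `redex_cases` decides. If the step happens in
`C`, then `v` remains private, because reduction creates no free names. -/
theorem diamond (h : InertN P Q) (h' : RedN P P') :
    SC True P' Q ∨ ∃ Q', RedN Q Q' ∧ InertN P' Q' := by
  obtain ⟨ws, v, y, A, B, C, hv, h1, h2⟩ := h
  obtain ⟨X, h3, h4⟩ := (h'.sc h1.symm (.refl _)).nuAs_inv
  obtain ⟨X', h5, h6⟩ := h3.nuA_inv
  have hv' : v ∉ (Term.par A (B.inst y)).fn ∧ v ∉ C.fn := not_or.1 hv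
  rcases redex_cases hv'.2 h5 with h7 | ⟨C', h7, h8⟩
  · left
    exact h4.trans (.trans (.nuAs (h6.trans ((h7.nuA v).trans (.nuA_of_notMem hv))) ws) h2.symm)
  · right
    refine ⟨.nuAs ws (reduct y A B C'), ?_, ws, v, y, A, B, C', ?_, ?_, .refl _⟩
    · exact ((h7.par _).nuAs ws).sc (h2.trans (.nuAs (.comm _ _) ws)) (.nuAs (.comm _ _) ws)
    · exact not_or.2 ⟨hv'.1, fun h => hv'.2 (h7.fn_subset h)⟩
    · exact h4.trans (.nuAs (h6.trans (h8.nuA v)) ws)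

end InertN

/-! ### Transfer to named terms -/

theorem tr_nus (ws : List V) (P : Proc V) : tr (P.nus ws) = .nuAs ws (tr P) := by
  induction ws with
  | nil => rfl
  | cons w ws ih => simp only [Proc.nus, List.foldr_cons, tr, Term.nuAs_cons] at ih ⊢; rw [ih]

theorem Red.redN {P Q : Proc V} (h : Red P Q) : RedN (tr P) (tr Q) := by
  induction h with
  | com x y z P Q hy =>
    refine ⟨[], x, y, tr P, (tr Q).ren (cl z), .nil, (SC.unit _).symm, ?_⟩
    simp only [reduct, Term.inst_ren_cl, ← tr_subst hy]
    exact (SC.unit _).symm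
  | par Q _ ih => exact ih.par _
  | nu z _ ih => exact ih.nuA z
  | struct h1 _ h2 ih => exact ih.sc h1.sc h2.sc

theorem Red.nus {P Q : Proc V} (h : Red P Q) (ws : List V) : Red (P.nus ws) (Q.nus ws) := by
  induction ws with
  | nil => exact h
  | cons w ws ih => exact .nu w ih

/-- A named form of the body of an input for which the literal substitution of `y` satisfies the
side condition of communication. -/
theorem exists_tr_inp_eq (B : Term V) (y : V) : ∃ (z : V) (Q : Proc V), y ∉ Q.bn ∧
    (tr Q).ren (cl z) = B ∧ tr (Q.subst y z) = B.inst y ∧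
    (B.Async → ∃ R : AProc V, R.toProc = Q) := by
  obtain ⟨z, -, hz⟩ := Term.exists_notMem ∅ Set.finite_empty (.nu B)
  obtain ⟨Q, hQ, hy, hA⟩ := exists_tr_eq (B.inst z) (Set.finite_singleton y)
  have hy' : y ∉ Q.bn := fun h => hy y h rfl
  have hcl : (tr Q).ren (cl z) = B := by rw [hQ]; exact Term.ren_cl_inst hz
  refine ⟨z, Q, hy', hcl, ?_, fun h => hA (h.ren _)⟩
  rw [tr_subst hy', ← Term.inst_ren_cl, hcl]

theorem red_iff {P Q : Proc V} : Red P Q ↔ RedN (tr P) (tr Q) := by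
  refine ⟨Red.redN, ?_⟩
  rintro ⟨ws, x, y, A, B, C, h1, h2⟩
  obtain ⟨A, rfl, -⟩ := exists_tr_eq A Set.finite_empty
  obtain ⟨C, rfl, -⟩ := exists_tr_eq C Set.finite_empty
  obtain ⟨z, B', hy, rfl, hs, -⟩ := exists_tr_inp_eq B y
  refine .struct (structCong_iff.2 ?_) (((Red.com x y z A B' hy).par C).nus ws)
    (structCong_iff.2 ?_)
  · rw [tr_nus]; exact h1
  · rw [tr_nus]; simpa only [tr, hs] using h2.symm

theorem AProc.red_iff {P Q : AProc V} : P.Red Q ↔ RedN (tr P.toProc) (tr Q.toProc) :=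
  HondaTokoro.red_iff

theorem AProc.structCong_iff {P Q : AProc V} :
    P.StructCong Q ↔ SC True (tr P.toProc) (tr Q.toProc) :=
  HondaTokoro.structCong_iff

theorem AProc.toProc_nus (ws : List V) (P : AProc V) : (P.nus ws).toProc = P.toProc.nus ws := by
  induction ws with
  | nil => rfl
  | cons w ws ih =>
    simp only [AProc.nus, Proc.nus, List.foldr_cons, AProc.toProc] at ih ⊢; rw [ih]

theorem AProc.toProc_subst (P : AProc V) (y z : V) :
    (P.subst y z).toProc = P.toProc.subst y z := by
  induction P with
  | inp a b P ih =>
    simp only [AProc.subst, AProc.toProc, Proc.subst]; split_ifs <;> simp [ih]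
  | nu b P ih =>
    simp only [AProc.subst, AProc.toProc, Proc.subst]; split_ifs <;> simp [ih]
  | _ => simp_all [AProc.subst, AProc.toProc, Proc.subst]

theorem AProc.async_tr (P : AProc V) : (tr P.toProc).Async := by
  induction P with
  | nil => trivial
  | tick => trivial
  | out x y => rfl
  | inp x z P ih => exact ih.ren _
  | par P Q ih1 ih2 => exact ⟨ih1, ih2⟩
  | nu z P ih => exact ih.ren _
  | bang P ih => exact ih

theorem exists_aproc_tr_eq {t : Term V} (h : t.Async) : ∃ P : AProc V, tr P.toProc = t := by
  obtain ⟨P, hP, -, hA⟩ := exists_tr_eq t Set.finite_empty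
  obtain ⟨Q, rfl⟩ := hA h
  exact ⟨Q, hP⟩

theorem AProc.Inert.nus {P Q : AProc V} (h : P.Inert Q) (ws : List V) :
    (P.nus ws).Inert (Q.nus ws) := by
  induction ws with
  | nil => exact h
  | cons w ws ih => exact .nu w ih

/-- The components must be asynchronous, since the named relation exists only between asynchronous
terms; their order in the redex differs and is adjusted by congruence. -/
theorem AProc.inert_of_sc {P Q : AProc V} {ws : List V} {v y : V} {B C : Term V} (hB : B.Async)
    (hC : C.Async) (hv : v ∉ (reduct y .nil B C).fn)
    (h1 : SC True (tr P.toProc) (.nuAs ws (.nuA v (redex v y .nil B C))))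
    (h2 : SC True (tr Q.toProc) (.nuAs ws (reduct y .nil B C))) : P.Inert Q := by
  obtain ⟨C, rfl⟩ := exists_aproc_tr_eq hC
  obtain ⟨z, B', hy, rfl, hs, hA⟩ := exists_tr_inp_eq B y
  obtain ⟨B, rfl⟩ := hA hB
  have hv' : v ∉ C.fn ∪ (B.subst y z).fn := by
    simp only [Term.fn, Set.mem_union, not_or, ← hs, ← AProc.toProc_subst, mem_fn_tr] at hv
    rw [Finset.mem_union, not_or]
    exact ⟨hv.2, hv.1.2⟩
  refine .struct (P' := .nus ws (.nu v (.par (.par (.out v y) C) (.inp v z B))))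
    (AProc.structCong_iff.2 ?_) ((AProc.Inert.com v y z C B hy hv').nus ws)
    (AProc.structCong_iff.2 ?_)
  · rw [AProc.toProc_nus, tr_nus]
    exact h1.trans (.nuAs (.nuA (.parRight _ _ _) _) _)
  · rw [AProc.toProc_nus, tr_nus]
    simp only [AProc.toProc, tr, AProc.toProc_subst, hs]
    exact .trans (.nuAs (.trans (.comm _ _) (.parl (SC.unit' _).symm _)) _) h2.symm

end Reduction


/-! ### Extraction from encoded terms -/

section Decomposition

variable {V : Type*} [Infinite V] [DecidableEq V]

/-- The source prefixes given by outputs `(x, y, P)` and inputs `(u, x, P)`, where `u` is the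
auxiliary name of the input in the encoded term. -/
noncomputable def srcPre (O I : Multiset (V × V × Term V)) : Multiset (Term V) :=
  O.map (fun o => .out o.1 o.2.1 o.2.2) + I.map (fun i => .inp i.2.1 i.2.2)

/-- The encodings of the prefixes in `srcPre O I`, with the auxiliary names of the inputs opened. -/
noncomputable def tgtPre (O I : Multiset (V × V × Term V)) : Multiset (Term V) :=
  O.map (fun o => encT (.out o.1 o.2.1 o.2.2)) + I.map (fun i => .out i.2.1 i.1 .nil) +
    I.map (fun i => .inp i.1 (encT i.2.2))

theorem srcPre_add (O I O' I' : Multiset (V × V × Term V)) :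
    srcPre (O + O') (I + I') = srcPre O I + srcPre O' I' := by
  simp only [srcPre, Multiset.map_add]; abel

theorem tgtPre_add (O I O' I' : Multiset (V × V × Term V)) :
    tgtPre (O + O') (I + I') = tgtPre O I + tgtPre O' I' := by
  simp only [tgtPre, Multiset.map_add]; abel

theorem mem_fnM_tgtPre (O I : Multiset (V × V × Term V)) (a : V) :
    a ∈ fnM (tgtPre O I) ↔ a ∈ fnM (srcPre O I) ∨ a ∈ I.map (·.1) := by
  have hO : fnM (O.map fun o => encT (.out o.1 o.2.1 o.2.2)) =
      fnM (O.map fun o => Term.out o.1 o.2.1 o.2.2) := by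
    ext a; simp [fnM, fn_encT]
  rw [tgtPre, srcPre, fnM_add, fnM_add, fnM_add, hO]
  simp only [Set.mem_union, or_assoc]
  refine or_congr Iff.rfl ?_
  simp only [fnM, Multiset.mem_map, Set.mem_ofPred_eq, exists_exists_and_eq_and, Term.fn, fn_encT,
    Set.mem_union, Set.mem_insert_iff, Set.mem_singleton_iff, Set.mem_preimage,
    Set.notMem_empty, or_false]
  constructor
  · rintro (⟨i, hi, rfl | rfl⟩ | ⟨i, hi, rfl | h⟩)
    · exact .inl ⟨i, hi, .inl rfl⟩
    · exact .inr ⟨i, hi, rfl⟩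
    · exact .inr ⟨i, hi, rfl⟩
    · exact .inl ⟨i, hi, .inr h⟩
  · rintro (⟨i, hi, rfl | h⟩ | ⟨i, hi, rfl⟩)
    · exact .inl ⟨i, hi, .inl rfl⟩
    · exact .inr ⟨i, hi, .inr h⟩
    · exact .inl ⟨i, hi, .inr rfl⟩

/-- An extraction from `encT S` that comes from an extraction from `S`: all prefixes of `S` that are
involved are extracted, with residual `T`, and `L'` are the parts of their encodings that are not
in `L`. The names `ts` are restricted in `R` but opened in `T`. -/
structure SourceExt (b : Prop) (S : Term V) (L : Multiset (Term V)) (R : Term V)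
    (O I : Multiset (V × V × Term V)) (T : Term V) (L' : Multiset (Term V)) (ts : List V) :
    Prop where
  ext : Ext b S (srcPre O I) T
  nodup : (I.map (·.1)).Nodup
  fresh : ∀ u ∈ I.map (·.1), u ∉ fnX (srcPre O I) T
  eq : L + L' = tgtPre O I
  sc : SC b R (.nuAs ts (.par (prod L') (encT T)))
  kept : ∀ t ∈ ts, t ∉ fnM L ∧ t ∉ S.fn
  closed : b ∨ ts = []

namespace SourceExt

variable {b : Prop} {S R T : Term V} {L L' : Multiset (Term V)}
  {O I : Multiset (V × V × Term V)} {ts : List V}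

theorem mem_fnX_iff (h : SourceExt b S L R O I T L' ts) (a : V) :
    a ∈ fnX L R ↔ (a ∈ fnX (srcPre O I) T ∨ a ∈ I.map (·.1)) ∧ a ∉ ts := by
  have e : a ∈ fnX (srcPre O I) T ∨ a ∈ I.map (·.1) ↔ a ∈ fnM L ∨ a ∈ fnM L' ∨ a ∈ T.fn := by
    have := mem_fnM_tgtPre O I a
    rw [← h.eq, fnM_add, Set.mem_union] at this
    rw [fnX, Set.mem_union]
    tauto
  rw [e, fnX, Set.mem_union, h.sc.fn_eq, Term.mem_fn_nuAs, Term.fn, Set.mem_union, fn_prod, fn_encT]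
  constructor
  · rintro (h' | h')
    · exact ⟨.inl h', fun ht => (h.kept a ht).1 h'⟩
    · exact ⟨.inr h'.1, h'.2⟩
  · rintro ⟨h1 | h1, h2⟩
    · exact .inl h1
    · exact .inr ⟨h1, h2⟩

theorem ren (h : SourceExt b S L R O I T L' ts) {f : V → V} (hf : Function.Injective f) :
    SourceExt b (S.ren f) (L.map (·.ren f)) (R.ren f)
      (O.map fun o => (f o.1, f o.2.1, o.2.2.ren f))
      (I.map fun i => (f i.1, f i.2.1, i.2.2.ren (lift f))) (T.ren f) (L'.map (·.ren f))
      (ts.map f) := by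
  have e1 : srcPre (O.map fun o => (f o.1, f o.2.1, o.2.2.ren f))
      (I.map fun i => (f i.1, f i.2.1, i.2.2.ren (lift f))) = (srcPre O I).map (·.ren f) := by
    simp [srcPre, Function.comp_def, Term.ren]
  have e2 : tgtPre (O.map fun o => (f o.1, f o.2.1, o.2.2.ren f))
      (I.map fun i => (f i.1, f i.2.1, i.2.2.ren (lift f))) = (tgtPre O I).map (·.ren f) := by
    simp [tgtPre, Function.comp_def, Term.ren, encT_ren, ← encT_ren (.out _ _ _)]
  have e3 : (I.map fun i => (f i.1, f i.2.1, i.2.2.ren (lift f))).map (·.1) =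
      (I.map (·.1)).map f := by
    simp
  have hprod : SC b ((prod L').ren f) (prod (L'.map (·.ren f))) := by
    have : ∀ L : Multiset (Term V), SC b ((prod L).ren f) (prod (L.map (·.ren f))) := by
      intro L
      induction L using Multiset.induction_on with
      | empty => simp only [prod_zero, Multiset.map_zero]; exact .refl _
      | cons p L ih =>
        rw [Multiset.map_cons]
        exact ((SC.prod_cons p L).ren f).trans ((SC.parr ih _).trans (SC.prod_cons _ _).symm)
    exact this L'
  refine ⟨e1 ▸ h.ext.ren hf, ?_, ?_, ?_, ?_, ?_, ?_⟩
  · rw [e3]; exact h.nodup.map hf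
  · rw [e3, e1, fnX_map_ren]
    intro u hu
    obtain ⟨w, hw, rfl⟩ := Multiset.mem_map.1 hu
    rw [hf.mem_set_image]
    exact h.fresh w hw
  · rw [e2, ← h.eq, Multiset.map_add]
  · have := h.sc.ren f
    rw [Term.ren_nuAs hf] at this
    refine this.trans (.nuAs ?_ _)
    simp only [Term.ren, ← encT_ren]
    exact .parl hprod _
  · intro t ht
    obtain ⟨w, hw, rfl⟩ := List.mem_map.1 ht
    rw [fnM_map_ren, hf.mem_set_image, Term.mem_fn_ren_of_injective hf]
    exact h.kept w hw
  · exact h.closed.imp_right fun h => by simp [h]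

/-- The names `ts` are free neither in `S` nor in the extraction from `encT S`, so they can be
permuted away; this keeps parallel components apart. -/
theorem exists_avoiding (h : SourceExt b S L R O I T L' ts) {A : Set V} (hA : A.Finite) :
    ∃ O I T L' ts, SourceExt b S L R O I T L' ts ∧ ∀ t ∈ ts, t ∉ A := by
  obtain ⟨e, he1, he2⟩ := exists_perm_avoiding (ws := ts) (K := S.fn ∪ fnX L R)
    (S.fn_finite.union (fnX_finite L R)) hA (by
      rintro t ht (h' | h')
      · exact (h.kept t ht).2 h'
      · exact ((h.mem_fnX_iff t).1 h').2 ht)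
  have := h.ren e.injective
  rw [Term.ren_eq_self fun a ha => he1 a (.inl ha),
    Ext.map_ren_eq_self fun a ha => he1 a (.inr (.inl ha)),
    Term.ren_eq_self fun a ha => he1 a (.inr (.inr ha))] at this
  refine ⟨_, _, _, _, _, this, fun t ht => ?_⟩
  obtain ⟨w, hw, rfl⟩ := List.mem_map.1 ht
  exact he2 w hw

theorem refl (S : Term V) (h : b ∨ S.Leaf) : SourceExt b S 0 (encT S) 0 0 S 0 [] where
  ext := .refl S h
  nodup := by simp
  fresh := by simp
  eq := by simp [tgtPre]
  sc := by rw [prod_zero]; exact (SC.unit' _).symm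
  kept := by simp
  closed := .inr rfl

/-- All freshness conditions come from `hboth`: a name involved on both sides, auxiliary names
included, is free in both `S1` and `S2`. -/
theorem par {S1 S2 R1 R2 T1 T2 : Term V} {L1 L2 L1' L2' : Multiset (Term V)}
    {O1 O2 I1 I2 : Multiset (V × V × Term V)} {ts1 ts2 : List V}
    (h1 : SourceExt b S1 L1 R1 O1 I1 T1 L1' ts1) (h2 : SourceExt b S2 L2 R2 O2 I2 T2 L2' ts2)
    (e2 : S2.fn ⊆ fnX L2 R2) (e1 : S1.fn ⊆ fnX L1 R1)
    (hc : fnX L1 R1 ∩ fnX L2 R2 ⊆ S1.fn ∩ S2.fn) (ht1 : ∀ t ∈ ts1, t ∉ fnX L2 R2)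
    (ht2 : ∀ t ∈ ts2, (t ∉ fnX L1 R1) ∧ t ∉ ts1) :
    SourceExt b (.par S1 S2) (L1 + L2) (.par R1 R2) (O1 + O2) (I1 + I2) (.par T1 T2) (L1' + L2')
      (ts1 ++ ts2) := by
  have k1 : ∀ a, (a ∈ fnX (srcPre O1 I1) T1 ∨ a ∈ I1.map (·.1)) ↔ a ∈ fnX L1 R1 ∨ a ∈ ts1 ∧
      (a ∈ fnX (srcPre O1 I1) T1 ∨ a ∈ I1.map (·.1)) := by
    intro a; rw [h1.mem_fnX_iff]; tauto
  have k2 : ∀ a, (a ∈ fnX (srcPre O2 I2) T2 ∨ a ∈ I2.map (·.1)) ↔ a ∈ fnX L2 R2 ∨ a ∈ ts2 ∧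
      (a ∈ fnX (srcPre O2 I2) T2 ∨ a ∈ I2.map (·.1)) := by
    intro a; rw [h2.mem_fnX_iff]; tauto
  have hboth : ∀ a, (a ∈ fnX (srcPre O1 I1) T1 ∨ a ∈ I1.map (·.1)) →
      (a ∈ fnX (srcPre O2 I2) T2 ∨ a ∈ I2.map (·.1)) → a ∈ S1.fn ∩ S2.fn := by
    intro a ha1 ha2
    rcases (k1 a).1 ha1 with h | h
    · rcases (k2 a).1 ha2 with h' | h'
      · exact hc ⟨h, h'⟩
      · exact absurd h (ht2 a h'.1).1
    · rcases (k2 a).1 ha2 with h' | h'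
      · exact absurd h' (ht1 a h.1)
      · exact absurd h.1 (ht2 a h'.1).2
  have n1 : ∀ u ∈ I1.map (·.1), u ∉ fnX (srcPre O2 I2) T2 ∧ u ∉ I2.map (·.1) := by
    intro u hu
    rw [← not_or]
    exact fun h => h1.fresh u hu (h1.ext.fn_subset (hboth u (.inr hu) h).1)
  have n2 : ∀ u ∈ I2.map (·.1), u ∉ fnX (srcPre O1 I1) T1 := by
    intro u hu h
    exact h2.fresh u hu (h2.ext.fn_subset (hboth u (.inl h) (.inr hu)).2)
  have d1 : ∀ t ∈ ts1, t ∉ (Term.nuAs ts2 (.par (prod L2') (encT T2))).fn := by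
    intro t ht h
    rw [← h2.sc.fn_eq] at h
    exact ht1 t ht (.inr h)
  have d2 : ∀ t ∈ ts2, t ∉ (Term.par (prod L1') (encT T1)).fn := by
    intro t ht h
    by_cases ht' : t ∈ ts1
    · exact (ht2 t ht).2 ht'
    · refine (ht2 t ht).1 (.inr ?_)
      rw [h1.sc.fn_eq, Term.mem_fn_nuAs]
      exact ⟨h, ht'⟩
  refine ⟨?_, ?_, ?_, ?_, ?_, ?_, ?_⟩
  · rw [srcPre_add]
    exact .par h1.ext h2.ext fun a ha => hboth a (.inl ha.1) (.inl ha.2)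
  · rw [Multiset.map_add, Multiset.nodup_add]
    exact ⟨h1.nodup, h2.nodup, Multiset.disjoint_left.2 fun {u} hu => (n1 u hu).2⟩
  · intro u hu
    rw [srcPre_add, Sim.fnX_par]
    rw [Multiset.map_add, Multiset.mem_add] at hu
    rcases hu with hu | hu
    · exact not_or.2 ⟨h1.fresh u hu, (n1 u hu).1⟩
    · exact not_or.2 ⟨n2 u hu, h2.fresh u hu⟩
  · rw [tgtPre_add, ← h1.eq, ← h2.eq]; abel
  · rw [Term.nuAs_append]
    refine (h1.sc.par h2.sc).trans ((SC.nuAs_scope' d1 _).symm.trans (.nuAs ?_ _))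
    exact (SC.nuAs_scope d2 _).symm.trans (.nuAs (SC.parr_prod_add _ _ _ _).symm _)
  · intro t ht
    rw [fnM_add]
    rcases List.mem_append.1 ht with h | h
    · exact ⟨not_or.2 ⟨(h1.kept t h).1, fun h' => ht1 t h (.inl h')⟩,
        not_or.2 ⟨(h1.kept t h).2, fun h' => ht1 t h (e2 h')⟩⟩
    · exact ⟨not_or.2 ⟨fun h' => (ht2 t h).1 (.inl h'), (h2.kept t h).1⟩,
        not_or.2 ⟨fun h' => (ht2 t h).1 (e1 h'), (h2.kept t h).2⟩⟩
  · rcases h1.closed with h | rfl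
    · exact .inl h
    · exact h2.closed.imp_right fun h => by simp [h]

/-- An encoded input consists of two prefixes. An extraction may take any of them, while the source
input is extracted as a whole; what was not taken forms `L'`. -/
theorem single (u x : V) (P : Term V) (hu : u ∉ (Term.inp x P).fn)
    (h : L + L' = {.out x u .nil, .inp u (encT P)}) (hR : SC b R (prod L')) :
    SourceExt b (.inp x P) L R 0 {(u, x, P)} .nil L' [] where
  ext := by simpa [srcPre] using Ext.inp x P
  nodup := by simp
  fresh := by simpa [srcPre, fnX, Term.fn] using hu
  eq := by rw [h]; simp [tgtPre]
  sc := hR.trans (SC.unit _).symm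
  kept := by simp
  closed := .inr rfl

end SourceExt

/-- The encoding comes apart only where the source does: an unguarded restriction of `encT S`
encodes a restriction of the source or introduces the auxiliary name of an input, and going below
the latter means extracting that input. -/
theorem Ext.exists_sourceExt {b : Prop} {S R : Term V} {L : Multiset (Term V)}
    (h : Ext b (encT S) L R) : ∃ O I T L' ts, SourceExt b S L R O I T L' ts := by
  have inpCase : ∀ {x v : V} {P0 P : Term V} {L : Multiset (Term V)} {R : Term V},
      encT (.inp x P) = .nu P0 → Ext b (P0.inst v) L R → v ∉ (Term.nu P0).fn →
      ∃ L', SourceExt b (.inp x P) L R 0 {(v, x, P)} .nil L' [] := by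
    intro x v P0 P L R hP h hv
    have hv' : v ∉ (Term.inp x P).fn := by rwa [← hP, fn_encT] at hv
    rw [encT_inp hv'] at hP
    simp only [Term.nuA, Term.nu.injEq] at hP
    rw [← hP, Term.inst_ren_cl_self] at h
    obtain ⟨L1, L2, R1, R2, rfl, rfl, h1, h2, -⟩ := h.par_inv
    cases h1 with
    | refl =>
      cases h2 with
      | refl =>
        exact ⟨_, .single v x P hv' (zero_add _) (SC.prod_pair _ _).symm⟩
      | inp =>
        exact ⟨{.out x v .nil}, .single v x P hv' (by rw [zero_add, add_comm]; rfl)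
          ((SC.unit _).trans (SC.prod_singleton _).symm)⟩
    | out =>
      cases h2 with
      | refl =>
        exact ⟨{.inp v (encT P)}, .single v x P hv' (by rw [add_zero]; rfl)
          ((SC.unit' _).trans (SC.prod_singleton _).symm)⟩
      | inp =>
        exact ⟨0, .single v x P hv' (by rw [add_zero]; rfl)
          ((SC.unit _).trans (by rw [prod_zero]; exact .refl _))⟩
  generalize hE : encT S = E at h
  induction h generalizing S with
  | refl E h =>
    subst hE
    refine ⟨_, _, _, _, _, .refl S (h.imp_right fun h => ?_)⟩
    cases S <;> first | exact h | trivial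
  | out x y P => cases S <;> simp [encT] at hE
  | inp x P =>
    cases S <;> simp only [encT, reduceCtorEq] at hE
    rename_i a y P1
    refine ⟨{(a, y, P1)}, 0, .nil, 0, [], ?_, by simp, by simp, ?_, ?_, by simp, .inr rfl⟩
    · simpa [srcPre] using Ext.out a y P1
    · rw [← hE]; simp [tgtPre, encT]
    · rw [prod_zero]; exact (SC.unit _).symm
  | @par P Q L1 L2 R1 R2 e1 e2 hc ih1 ih2 =>
    cases S <;> simp only [encT, reduceCtorEq, Term.par.injEq] at hE
    rename_i S1 S2
    obtain ⟨rfl, rfl⟩ := hE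
    obtain ⟨_, _, _, _, _, h1⟩ := ih1 rfl
    obtain ⟨_, _, _, _, ts1, h1, ht1⟩ := h1.exists_avoiding (fnX_finite L2 R2)
    obtain ⟨_, _, _, _, _, h2⟩ := ih2 rfl
    obtain ⟨_, _, _, _, ts2, h2, ht2⟩ :=
      h2.exists_avoiding ((fnX_finite L1 R1).union ts1.finite_toSet)
    have f1 := e1.fn_subset
    have f2 := e2.fn_subset
    rw [fn_encT] at f1 f2
    rw [fn_encT, fn_encT] at hc
    exact ⟨_, _, _, _, _, h1.par h2 f2 f1 hc ht1 fun t ht => not_or.1 (ht2 t ht)⟩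
  | @opened v P L R h hv hz ih =>
    cases S <;> simp only [encT, reduceCtorEq] at hE
    · rename_i x P1
      obtain ⟨L', h'⟩ := inpCase (P := P1) hE h hv
      exact ⟨_, _, _, _, _, h'⟩
    · rename_i S1
      simp only [Term.nu.injEq] at hE
      subst hE
      obtain ⟨_, _, _, _, _, h'⟩ := ih (encT_inst S1 v)
      obtain ⟨O, I, T, L', ts, h', ht⟩ := h'.exists_avoiding (Set.finite_singleton v)
      have hv' : v ∉ (Term.nu S1).fn := by rwa [← fn_encT (.nu S1)]
      refine ⟨O, I, T, L', ts, .opened v h'.ext hv' fun hvs => ?_, h'.nodup, h'.fresh, h'.eq, h'.sc,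
        fun t ht => ⟨(h'.kept t ht).1, fun h => (h'.kept t ht).2 (Term.mem_fn_inst.2 (.inl h))⟩,
        h'.closed⟩
      rw [← fn_encT]
      exact hz ((h'.mem_fnX_iff v).2 ⟨.inl hvs, fun h => ht v h rfl⟩)
  -- On the source side the restriction is opened, or is the auxiliary name of an extracted input;
  -- `v` is recorded in `ts`.
  | @closed hb v P L R h hv hz hL ih =>
    cases S <;> simp only [encT, reduceCtorEq] at hE
    · rename_i x P1
      obtain ⟨L', h'⟩ := inpCase (P := P1) hE h hv
      exact ⟨_, _, _, _, [v], h'.ext, h'.nodup, h'.fresh, h'.eq, h'.sc.nuA v, by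
        have := h'.fresh v (by simp)
        simpa using ⟨hL, fun h => this (h'.ext.fn_subset h)⟩, .inl hb⟩
    · rename_i S1
      simp only [Term.nu.injEq] at hE
      subst hE
      obtain ⟨_, _, _, _, _, h'⟩ := ih (encT_inst S1 v)
      obtain ⟨O, I, T, L', ts, h', ht⟩ := h'.exists_avoiding (Set.finite_singleton v)
      have hv' : v ∉ (Term.nu S1).fn := by rwa [← fn_encT (.nu S1)]
      refine ⟨O, I, T, L', v :: ts, .opened v h'.ext hv' fun hvs => ?_, h'.nodup, h'.fresh, h'.eq,
        h'.sc.nuA v, fun t ht => ?_, .inl hb⟩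
      · rw [← fn_encT]
        exact hz ((h'.mem_fnX_iff v).2 ⟨.inl hvs, fun h => ht v h rfl⟩)
      · rcases List.mem_cons.1 ht with rfl | ht
        · exact ⟨hL, hv'⟩
        · exact ⟨(h'.kept t ht).1, fun h => (h'.kept t ht).2 (Term.mem_fn_inst.2 (.inl h))⟩
  | @bang P L R hb h ih =>
    cases S <;> simp only [encT, reduceCtorEq] at hE
    rename_i S1
    simp only [Term.bang.injEq] at hE
    subst hE
    obtain ⟨O, I, T, L', ts, h'⟩ := ih (S := .par S1 (.bang S1)) rfl
    exact ⟨O, I, T, L', ts, .bang hb h'.ext, h'.nodup, h'.fresh, h'.eq, h'.sc,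
      fun t ht => ⟨(h'.kept t ht).1, fun h => (h'.kept t ht).2 (.inl h)⟩, h'.closed⟩

/-- The encoding of prefixes, with the auxiliary names of the inputs pulled to the front. -/
theorem SC.encT_prod {b : Prop} (O I : Multiset (V × V × Term V)) {us : List V}
    (hus : (us : Multiset V) = I.map (·.1)) (hn : us.Nodup)
    (hf : ∀ u ∈ us, u ∉ fnM (srcPre O I)) :
    SC b (HondaTokoro.encT (prod (srcPre O I))) (.nuAs us (prod (tgtPre O I))) := by
  induction us generalizing I with
  | nil =>
    obtain rfl : I = 0 := by simpa using hus.symm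
    simp only [srcPre, tgtPre, Multiset.map_zero, add_zero, Term.nuAs_nil]
    clear hus hf
    induction O using Multiset.induction_on with
    | empty => simp only [Multiset.map_zero, prod_zero]; exact .refl _
    | cons o O ih =>
      rw [Multiset.map_cons, Multiset.map_cons]
      exact (SC.prod_cons _ _).encT.trans ((SC.parr ih _).trans (SC.prod_cons _ _).symm)
  | cons u us ih =>
    have hu : u ∈ I.map (·.1) := by rw [← hus]; simp
    obtain ⟨i, hi, rfl⟩ := Multiset.mem_map.1 hu
    obtain ⟨I, rfl⟩ := Multiset.exists_cons_of_mem hi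
    rw [← Multiset.cons_coe, Multiset.map_cons, Multiset.cons_inj_right] at hus
    rw [List.nodup_cons] at hn
    have e1 : srcPre O (i ::ₘ I) = .inp i.2.1 i.2.2 ::ₘ srcPre O I := by simp [srcPre]
    have e2 : tgtPre O (i ::ₘ I) =
        .out i.2.1 i.1 .nil ::ₘ .inp i.1 (HondaTokoro.encT i.2.2) ::ₘ tgtPre O I := by
      simp only [tgtPre, Multiset.map_cons, Multiset.add_cons, Multiset.cons_add]
      exact Multiset.cons_swap _ _ _
    rw [e1, fnM_cons] at hf
    have hu' := not_or.1 (hf i.1 (by simp))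
    have hf' : ∀ u ∈ us, u ∉ (Term.inp i.2.1 i.2.2).fn ∧ u ∉ fnM (srcPre O I) :=
      fun u hu => not_or.1 (hf u (by simp [hu]))
    have ih := ih I hus hn.2 fun u hu => (hf' u hu).2
    rw [e1, e2]
    refine (SC.prod_cons _ _).encT.trans ?_
    -- Only the clause for parallel composition is unfolded; the encoded input stays folded for
    -- `encT_inp`.
    simp only [HondaTokoro.encT.eq_5]
    rw [encT_inp hu'.1]
    refine (SC.nuA_scope' ?_ _).symm.trans (.nuA ?_ _)
    · rw [fn_encT, fn_prod]; exact hu'.2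
    · refine (SC.parr ih _).trans ((SC.nuAs_scope ?_ _).symm.trans (.nuAs ?_ us))
      · intro w hw
        have h1 := (hf' w hw).1
        have h2 : w ≠ i.1 := by rintro rfl; exact hn.1 hw
        simp only [Term.fn, Set.mem_union, Set.mem_singleton_iff, Set.mem_preimage,
          Set.mem_insert_iff, Set.notMem_empty, not_or, fn_encT] at h1 ⊢
        exact ⟨⟨⟨h1.1, h2⟩, not_false⟩, h2, h1.2⟩
      · exact (SC.assoc _ _ _).symm.trans ((SC.parr (SC.prod_cons _ _).symm _).trans
          (SC.prod_cons _ _).symm)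

/-- What an encoded term that offers a communication looks like. -/
theorem Ext.enc_pair {b : Prop} {S N R U : Term V} {x u : V}
    (h : Ext b (encT S) {.out x u N, .inp x R} U) :
    ∃ (y : V) (P1 P2 T W : Term V) (ss us ts : List V),
      N = .nil ∧ R = .par (.out z0 (sh y) .nil) ((encT P1).ren sh) ∧
      SC b S (.nuAs ss (redex x y P1 P2 T)) ∧
      SC b U (.nuAs ts (.par W (.inp u (encT P2)))) ∧
      SC b (encT T) (.nuAs us W) ∧ W.Async ∧
      (∀ t ∈ ts, t ∉ fnM {.out x u N, .inp x R} ∧ t ∉ S.fn) ∧ (b ∨ ts = []) ∧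
      (ss ++ us ++ [u]).Nodup ∧ (∀ a ∈ u :: us, a ∉ (redex x y P1 P2 T).fn) ∧
      ∀ a, a ∈ ss ++ us ++ [u] ↔
        ((a ∈ fnX {.out x u N, .inp x R} U ∨ a ∈ ts ∧ a ∈ (redex x y P1 P2 T).fn ∪ {a | a ∈ us}
          ∪ {u}) ∧ a ∉ S.fn) := by
  obtain ⟨O, I, T, L', ts, h'⟩ := h.exists_sourceExt
  have ho : Term.out x u N ∈ tgtPre O I := by rw [← h'.eq]; simp
  have hi : Term.inp x R ∈ tgtPre O I := by rw [← h'.eq]; simp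
  simp only [tgtPre, encT, Multiset.mem_add, Multiset.mem_map, reduceCtorEq, and_false, exists_false,
    false_or, or_false, Term.out.injEq, Term.inp.injEq] at ho hi
  -- Encoded outputs are inputs, so the output must announce the auxiliary name `u'` of an encoded
  -- input.
  obtain ⟨⟨u', x', P2⟩, hI, hx', hu', rfl⟩ := ho
  dsimp only at hx' hu'
  subst hx' hu'
  have hx : x' ∈ fnX (srcPre O I) T := by
    refine .inl ⟨.inp x' P2, ?_, by simp [Term.fn]⟩
    rw [srcPre, Multiset.mem_add]
    exact .inr (Multiset.mem_map.2 ⟨_, hI, rfl⟩)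
  -- The input is an encoded output or listens on an auxiliary name. The latter is impossible: its
  -- subject occurs in a source prefix, and auxiliary names are fresh for those.
  rcases hi with ⟨⟨x, y, P1⟩, hO, hx'', hR⟩ | ⟨i, hi, rfl, -⟩
  swap
  · exact absurd hx (h'.fresh _ (Multiset.mem_map_of_mem _ hi))
  dsimp only at hx'' hR
  subst hx''
  obtain ⟨O, rfl⟩ := Multiset.exists_cons_of_mem hO
  obtain ⟨I, rfl⟩ := Multiset.exists_cons_of_mem hI
  have eL : L' = .inp u' (encT P2) ::ₘ tgtPre O I := by
    have := h'.eq
    simp only [tgtPre, Multiset.map_cons, encT, hR] at this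
    refine add_left_cancel (this.trans ?_)
    simp only [tgtPre, encT, Multiset.insert_eq_cons, ← Multiset.singleton_add]
    abel
  subst eL
  have eS : srcPre ((x, y, P1) ::ₘ O) ((u', x, P2) ::ₘ I) =
      {.out x y P1, .inp x P2} + srcPre O I := by
    simp only [srcPre, Multiset.map_cons]
    simp only [Multiset.insert_eq_cons, ← Multiset.singleton_add]
    abel
  obtain ⟨ss, hss, hss'⟩ := h'.ext.exists_opened
  have hn := h'.nodup
  have hfr := h'.fresh
  have hiff := h'.mem_fnX_iff
  simp only [Multiset.map_cons, Multiset.nodup_cons] at hn hfr hiff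
  -- `us` collects the auxiliary names of the other extracted inputs, whose prefixes are put back
  -- into `W`.
  obtain ⟨us, hus⟩ : ∃ us : List V, (us : Multiset V) = I.map (·.1) := Quotient.exists_rep _
  have husn : us.Nodup := by rw [← Multiset.coe_nodup, hus]; exact hn.2
  have hmem : ∀ a, a ∈ I.map (·.1) ↔ a ∈ us := by intro a; rw [← hus]; simp
  have hfn : fnX (srcPre ((x, y, P1) ::ₘ O) ((u', x, P2) ::ₘ I)) T =
      (redex x y P1 P2 (.par (prod (srcPre O I)) T)).fn := by
    rw [eS, ← fnX_redex, fnX, fnX, fnM_add, Set.union_assoc, Term.fn, fn_prod]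
  have hfr' : ∀ a ∈ u' :: us, a ∉ (redex x y P1 P2 (.par (prod (srcPre O I)) T)).fn := by
    intro a ha
    rw [← hfn]
    refine hfr a ?_
    rw [Multiset.mem_cons, hmem]
    simpa using ha
  have hfu : ∀ a ∈ us, a ∉ fnM (srcPre O I) ∧ a ∉ T.fn := by
    intro a ha
    have := hfr' a (by simp [ha])
    simp only [Term.fn, Set.mem_union, not_or, fn_prod] at this
    exact this.2
  refine ⟨y, P1, P2, .par (prod (srcPre O I)) T, .par (prod (tgtPre O I)) (encT T), ss, us, ts,
    rfl, hR.symm, ?_, ?_, ?_, ?_, h'.kept, h'.closed, ?_, hfr', ?_⟩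
  · refine (h'.ext.sc (fun a ha => ((hss' a).1 ha).2) fun a ha ha' => (hss' a).2 ⟨ha, ha'⟩).trans
      (.nuAs ?_ _)
    rw [eS]
    exact (SC.parl ((SC.prod_add _ _).trans (.parl (.prod_pair _ _) _)) _).trans
      (SC.assoc _ _ _).symm
  · refine h'.sc.trans (.nuAs ?_ _)
    exact (SC.parl (.prod_cons _ _) _).trans ((SC.assoc _ _ _).symm.trans (.comm _ _))
  · refine (SC.parl (SC.encT_prod O I hus husn fun a ha => (hfu a ha).1) _).trans
      (SC.nuAs_scope' ?_ _).symm
    intro a ha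
    rw [fn_encT]
    exact (hfu a ha).2
  · refine ⟨.prod ?_, encT_async _⟩
    simp only [tgtPre, Multiset.mem_add, Multiset.mem_map]
    rintro p ((⟨o, -, rfl⟩ | ⟨i, -, rfl⟩) | ⟨i, -, rfl⟩)
    exacts [encT_async _, rfl, encT_async i.2.2]
  · have hd : ∀ a ∈ ss, a ∉ u' :: us := by
      intro a ha ha'
      refine hfr' a ha' ?_
      rw [← hfn]
      exact ((hss' a).1 ha).1
    rw [List.append_assoc, List.nodup_append]
    refine ⟨hss, ?_, ?_⟩
    · rw [List.nodup_append]
      refine ⟨husn, by simp, ?_⟩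
      rintro a ha c hc rfl
      simp only [List.mem_singleton] at hc
      subst hc
      exact hn.1 ((hmem _).2 ha)
    · rintro a ha c hc rfl
      refine hd a ha ?_
      simpa [or_comm] using hc
  · intro a
    have hS : a ∈ S.fn → a ∉ us ∧ a ≠ u' := by
      intro ha
      have := h'.ext.fn_subset ha
      rw [hfn] at this
      exact ⟨fun h => hfr' a (by simp [h]) this, fun h => hfr' a (by simp [h]) this⟩
    rw [hiff, List.mem_append, List.mem_append, hss', hfn, Multiset.mem_cons, hmem]
    simp only [List.mem_singleton, Set.mem_union, Set.mem_ofPred_eq, Set.mem_singleton_iff]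
    tauto

end Decomposition


/-! ### Operational correspondence for single steps -/

section Correspondence

variable {V : Type*} [Infinite V] [DecidableEq V]

/-- `P` is the state reached from an encoded term after the first half of a communication whose
result is the encoding of `Q`. -/
def Halfway (P Q : Term V) : Prop :=
  ∃ (ss : List V) (u y : V) (A B C : Term V), u ∉ (reduct y A B C).fn ∧
    SC True P (.nuAs ss (.nuA u (redex u y .nil (encT B) (.par (encT A) (encT C))))) ∧
    SC True Q (.nuAs ss (reduct y A B C))

theorem sc_encT_reduct {b : Prop} (y : V) (A B C : Term V) :
    SC b (encT (reduct y A B C))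
      (reduct y .nil (encT B) (.par (encT A) (encT C))) := by
  simp only [encT.eq_5, encT_inst]
  exact (SC.parl (.comm _ _) _).trans ((SC.assoc _ _ _).symm.trans (.parl (SC.unit' _).symm _))

namespace Halfway

variable {P Q : Term V}

theorem inertN (h : Halfway P Q) : InertN P (encT Q) := by
  obtain ⟨ss, u, y, A, B, C, hu, h1, h2⟩ := h
  have e := sc_encT_reduct (b := True) y A B C
  refine ⟨ss, u, y, _, _, _, ?_, h1, ?_⟩
  · rwa [← e.fn_eq, fn_encT]
  · have := h2.encT
    rw [encT_nuAs] at this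
    exact this.trans (e.nuAs ss)

theorem inert (c : FreshChoice V) {P : AProc V} {Q : Proc V} (h : Halfway (tr P.toProc) (tr Q)) :
    P.Inert (enc c Q) := by
  obtain ⟨ss, u, y, A, B, C, hu, h1, h2⟩ := h
  have e := sc_encT_reduct (b := True) y A B C
  refine AProc.inert_of_sc (encT_async B) (C := .par (encT A) (encT C))
    ⟨encT_async A, encT_async C⟩ ?_ h1 ?_
  · rwa [← e.fn_eq, fn_encT]
  · have := h2.encT
    rw [encT_nuAs, ← tr_enc c] at this
    exact this.trans (e.nuAs ss)

end Halfway

theorem inst_encT_out (u y : V) (A : Term V) :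
    Term.inst u (.par (.out z0 (sh y) .nil) (A.ren sh)) = .par (.out u y .nil) A := by
  conv_rhs => rw [← Term.inst_ren_sh A u]
  simp [Term.inst, Term.ren]

/-- The encoded input announces its name `u` to the encoded output, which then offers `y` on `u`: a
redex on a restricted channel, met by the waiting input. -/
theorem RedN.exists_halfway {P Q : Term V} (h : RedN P Q) :
    ∃ T, T.Async ∧ RedN (encT P) T ∧ Halfway T Q := by
  obtain ⟨ss, x, y, A, B, C, h1, h2⟩ := h
  obtain ⟨u, -, hu⟩ := Term.exists_notMem ∅ Set.finite_empty (redex x y A B C)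
  have hu' : u ∉ (reduct y A B C).fn := fun h => hu (fn_reduct_subset x y A B C h)
  have hasync : (Term.nuA u (redex u y .nil (encT B) (.par (encT A) (encT C)))).Async :=
    Term.Async.ren (t := redex u y .nil (encT B) (.par (encT A) (encT C)))
      ⟨⟨rfl, encT_async B⟩, encT_async A, encT_async C⟩ _
  refine ⟨.nuAs ss (.nuA u (redex u y .nil (encT B) (.par (encT A) (encT C)))),
    .nuAs hasync ss, ?_, ss, u, y, A, B, C, hu', .refl _, h2⟩
  simp only [Term.fn, Set.mem_union, not_or] at hu
  refine ⟨ss ++ [u], x, u, .nil, .par (.out z0 (sh y) .nil) ((encT A).ren sh),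
    .par (.inp u (encT B)) (encT C), ?_, ?_⟩
  · have h1 := h1.encT
    rw [encT_nuAs] at h1
    rw [Term.nuAs_append]
    refine h1.trans (.nuAs ?_ ss)
    simp only [encT.eq_5]
    rw [encT_inp (u := u) (by simpa [Term.fn] using hu.1.2)]
    refine (SC.parl (SC.nuA_scope ?_ _).symm _).trans ((SC.nuA_scope' ?_ _).symm.trans (.nuA ?_ u))
    · rw [fn_encT]; simpa [Term.fn] using hu.1.1
    · rw [fn_encT]; exact hu.2
    · exact (SC.parl (SC.assoc _ _ _) _).trans ((SC.assoc _ _ _).symm.trans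
        (.parl (.comm _ _) _))
  · rw [Term.nuAs_append]
    refine .nuAs (.nuA ?_ u) ss
    simp only [reduct, inst_encT_out]
    exact ((SC.parl (SC.unit' _) _).trans (SC.parComm4 _ _ _ _)).symm

/-- The extraction behind the reduction is that of a communicating pair, for which `Ext.enc_pair`
exhibits the source redex; the remaining work is the rearrangement of restrictions. -/
theorem RedN.exists_source {P T : Term V} (h : RedN (encT P) T) :
    ∃ Q, RedN P Q ∧ Halfway T Q := by
  obtain ⟨x, u, N, R, U, he, hs⟩ := h.exists_ext
  obtain ⟨ws, -, hws⟩ := he.exists_opened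
  replace hs := hs ws (fun a ha => ((hws a).1 ha).2) fun a ha ha' => (hws a).2 ⟨ha, ha'⟩
  obtain ⟨y, A, B, C, W, ss, us, ts, rfl, rfl, hP, hU, hC, -, hts, -, hn, hf, hmem⟩ := he.enc_pair
  have hf' : ∀ a ∈ u :: us, a ∉ (reduct y A B C).fn :=
    fun a ha h => hf a ha (fn_reduct_subset x y A B C h)
  refine ⟨_, ⟨ss, x, y, A, B, C, hP, .refl _⟩, ss, u, y, A, B, C, hf' u (by simp), ?_, .refl _⟩
  refine hs.trans ?_
  have hsub : ∀ a ∈ (Term.par .nil (.par (.out u y .nil) (encT A))).fn,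
      a ∈ fnM {.out x u .nil, .inp x (.par (.out z0 (sh y) .nil) ((encT A).ren sh))} := by
    intro a ha
    simp only [Term.fn, Set.mem_union, Set.mem_insert_iff, Set.mem_singleton_iff,
      Set.notMem_empty, or_false, false_or, Multiset.insert_eq_cons, fnM_cons, fnM_singleton,
      Set.mem_preimage, sh_inj, sh_ne_z0] at ha ⊢
    rcases ha with (rfl | rfl) | ha
    · simp
    · simp
    · exact .inr (.inr (.inr (Term.mem_fn_ren.2 ⟨a, ha, rfl⟩)))
  -- the body of the reduct, all its restrictions being at the front
  have hbody : SC True (reduct u .nil (.par (.out z0 (sh y) .nil) ((encT A).ren sh)) U)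
      (.nuAs ts (redex u y .nil (encT B) (.par (encT A) W))) := by
    simp only [reduct, inst_encT_out]
    refine (SC.parr hU _).trans ((SC.nuAs_scope (fun t ht h => (hts t ht).1 (hsub t h)) _).symm.trans
      (.nuAs ?_ ts))
    exact (SC.parl (SC.unit' _) _).trans ((SC.parr (.comm _ _) _).trans (SC.parComm4 _ _ _ _))
  refine (hbody.nuAs ws).trans ?_
  rw [← Term.nuAs_append]
  -- On the names that occur, those opened in or still restricted by the extraction are exactly the
  -- source restrictions, `u` and the other auxiliary names.
  have hset : SC True
      ((redex u y .nil (encT B) (.par (encT A) W)).nuAs (ws ++ ts))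
      ((redex u y .nil (encT B) (.par (encT A) W)).nuAs (ss ++ u :: us)) := by
    refine .nuAs_congr fun a ha => ?_
    have hW : a ∈ W.fn → a ∈ C.fn ∨ a ∈ us := by
      intro h
      by_cases ha : a ∈ us
      · exact .inr ha
      · left
        rw [← fn_encT, hC.fn_eq]
        exact Term.mem_fn_nuAs.2 ⟨h, ha⟩
    have ha' : a ∈ (redex x y A B C).fn ∪ {a | a ∈ us} ∪ {u} := by
      simp only [Term.fn, Set.mem_union, Set.mem_insert_iff, Set.mem_singleton_iff,
        Set.notMem_empty, Set.mem_preimage, Set.mem_ofPred_eq, fn_encT] at ha ⊢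
      tauto
    have hsu : a ∈ ss ++ u :: us ↔ a ∈ ss ++ us ++ [u] := by
      simp only [List.mem_append, List.mem_cons, List.not_mem_nil, or_false]; tauto
    rw [hsu, hmem, List.mem_append, hws, fn_encT]
    constructor
    · rintro (h | h)
      · exact ⟨.inl h.1, h.2⟩
      · exact ⟨.inr ⟨h, ha'⟩, (hts a h).2⟩
    · rintro ⟨h | h, h'⟩
      exacts [.inl ⟨h, h'⟩, .inr h.1]
  refine hset.trans ?_
  rw [Term.nuAs_append]
  refine .nuAs (.nuA ?_ u) ss
  refine (SC.nuAs_scope ?_ _).trans (.parr ((SC.nuAs_scope ?_ _).trans (.parr hC.symm _)) _)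
  · intro a ha h
    have hau : a ≠ u := by
      rintro rfl
      rw [List.nodup_append] at hn
      exact hn.2.2 a (by simp [ha]) a (by simp) rfl
    have := hf a (by simp [ha])
    simp only [Term.fn, Set.mem_union, Set.mem_insert_iff, Set.mem_singleton_iff,
      Set.notMem_empty, Set.mem_preimage, fn_encT] at h this
    tauto
  · intro a ha h
    have := hf a (by simp [ha])
    rw [fn_encT] at h
    simp only [Term.fn, Set.mem_union] at this
    tauto

/-- The decomposition of an encoded term that offers a communication. -/
theorem enc_decomposition (c : FreshChoice V) {S : Proc V} {ws : List V} {U R : AProc V}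
    {x u r : V} (hws : ws.Nodup) (hU : U.Plain)
    (hfn : ∀ w ∈ ws, w ∈ (AProc.par (.par U (.out x u)) (.inp x r R)).fn)
    (h : (enc c S).StaticCong (.nus ws (.par (.par U (.out x u)) (.inp x r R)))) :
    ∃ (T R₁ R₂ : Proc V) (W : AProc V) (y z : V) (ss ts : List V),
      StaticCong S (.nus ss (.par (.par T (.out x y R₁)) (.inp x z R₂))) ∧
      ws.Perm (ss ++ ts ++ [u]) ∧
      U.StaticCong (.par W (.inp u z (enc c R₂))) ∧
      u ∉ (enc c R₂).fn.erase z ∧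
      (enc c T).StaticCong (.nus ts W) ∧
      r ≠ y ∧
      R.StaticCong (.par (.out r y) (enc c R₁)) ∧
      r ∉ (enc c R₁).fn := by
  -- A plain term has no unguarded restriction to open, hence is its own residual even when `b` is
  -- false.
  have hplain : Ext False (tr U.toProc) 0 (tr U.toProc) := by
    clear h hfn
    induction hU with
    | nil => exact .refl _ (.inr trivial)
    | tick => exact .refl _ (.inr trivial)
    | out x y => exact .refl _ (.inr trivial)
    | inp x z P => exact .refl _ (.inr trivial)
    | bang P => exact .refl _ (.inr trivial)
    | par _ _ ih1 ih2 =>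
      exact (Ext.par_of_subset ih1 ih2 (by simp [fnX]) (by simp [fnX])).1
  set Q : AProc V := .par (.par U (.out x u)) (.inp x r R) with hQ
  obtain ⟨e1, e1'⟩ := Ext.par_of_subset hplain (.out x u .nil) (by simp [fnX])
    (by simp [fnX, Term.fn])
  obtain ⟨e2, e2'⟩ := Ext.par_of_subset e1 (.inp x ((tr R.toProc).ren (cl r))) e1'
    (by simp [fnX, Term.fn])
  change Ext False (tr Q.toProc) _ _ at e2
  change _ ⊆ (tr Q.toProc).fn at e2'
  rw [zero_add, Multiset.singleton_add] at e2 e2'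
  have hsc : SC False (encT (tr S)) (.nuAs ws (tr Q.toProc)) := by
    have := staticCong_iff.1 h
    rwa [tr_enc, AProc.toProc_nus, tr_nus] at this
  obtain ⟨M, U', e3, hrel, hU'⟩ := hsc.symm.sim _ _ (e2.nuAs e2' hws)
  obtain ⟨N, R', rfl, hN, hR'⟩ := rel_pair hrel
  have hX := Sim.fnX_eq hrel hU'
  -- Since `b` is false, all restrictions had to be opened: `ts` is empty, and the auxiliary names
  -- `us` play the part of the set called `ts` in the statement.
  obtain ⟨y, A, B, C, W, ss, us, ts, rfl, rfl, hS, hUW, hC, hW, -, hts, hn, hf, hmem⟩ := e3.enc_pair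
  obtain rfl : ts = [] := hts.resolve_left id
  obtain ⟨W, rfl⟩ := exists_aproc_tr_eq hW
  obtain ⟨A, rfl, -⟩ := exists_tr_eq A Set.finite_empty
  obtain ⟨C, rfl, -⟩ := exists_tr_eq C Set.finite_empty
  obtain ⟨z, B, -, rfl, -, -⟩ := exists_tr_inp_eq B u
  refine ⟨C, A, B, W, y, z, ss, us, ?_, ?_, ?_, ?_, ?_, ?_, ?_, ?_⟩
  · rw [staticCong_iff, tr_nus]
    exact hS.trans (.nuAs ((SC.comm _ _).trans (.assoc _ _ _)) ss)
  -- Both lists consist of the names that occur in the opened term and are not free in `S`; this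
  -- uses that all of `ws` occurs.
  · rw [List.perm_ext_iff_of_nodup hws hn]
    intro a
    have hQfn : a ∈ (tr Q.toProc).fn ↔
        a ∈ fnX {.out x u .nil, .inp x (.par (.out z0 (sh y) .nil) ((encT (tr A)).ren sh))} U' := by
      rw [← hX]
      exact ⟨fun h => e2.fn_subset h, fun h => e2' h⟩
    have hSfn : a ∈ (tr S).fn ↔ a ∈ (tr Q.toProc).fn ∧ a ∉ ws := by
      rw [← fn_encT, hsc.fn_eq, Term.mem_fn_nuAs]
    have := fun h => mem_fn_tr.2 (hfn a h)
    change _ → a ∈ (tr Q.toProc).fn at this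
    rw [hmem, hSfn, ← hQfn]
    simp only [List.not_mem_nil, false_and, or_false]
    tauto
  · refine staticCong_iff.2 ?_
    simp only [AProc.toProc, tr, tr_enc]
    rw [← encT_ren]
    exact (SC.unit _).symm.trans ((SC.unit _).symm.trans (hU'.trans hUW))
  · intro hu
    rw [Finset.mem_erase] at hu
    have : u ∈ (tr (enc c B).toProc).fn := mem_fn_tr.2 hu.2
    rw [tr_enc, fn_encT] at this
    refine hf u (by simp) ?_
    simp only [Term.fn, Set.mem_union, Set.mem_preimage]
    exact .inl (.inr (.inr (Term.sh_mem_fn_ren_cl.2 ⟨this, hu.1⟩)))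
  · refine staticCong_iff.2 ?_
    rw [tr_enc, AProc.toProc_nus, tr_nus]
    exact hC
  -- Under the binder of the input `y` is an outer name, whereas `r` has become `z0`.
  · have : sh y ∈ ((tr R.toProc).ren (cl r)).fn := by rw [hR'.fn_eq]; simp [Term.fn]
    exact (Term.sh_mem_fn_ren_cl.1 this).2.symm
  · refine staticCong_iff.2 ?_
    have := hR'.inst r
    rw [Term.inst_ren_cl_self, inst_encT_out] at this
    simpa only [AProc.toProc, tr, tr_enc] using this
  · intro hr
    have : r ∈ (tr (enc c A).toProc).fn := mem_fn_tr.2 hr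
    rw [tr_enc] at this
    have : sh r ∈ ((tr R.toProc).ren (cl r)).fn := by
      rw [hR'.fn_eq]
      exact .inr (Term.mem_fn_ren.2 ⟨r, this, rfl⟩)
    exact (Term.sh_mem_fn_ren_cl.1 this).2 rfl

theorem enc_complete (c : FreshChoice V) {S S' : Proc V} (h : Red S S') :
    ∃ T : AProc V, (enc c S).Red T ∧ T.Red (enc c S') ∧ T.Inert (enc c S') := by
  obtain ⟨T, hT, h1, h2⟩ := h.redN.exists_halfway
  obtain ⟨T, rfl⟩ := exists_aproc_tr_eq hT
  refine ⟨T, AProc.red_iff.2 ?_, AProc.red_iff.2 ?_, h2.inert c⟩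
  · rwa [tr_enc]
  · rw [tr_enc]; exact h2.inertN.redN

theorem enc_sound (c : FreshChoice V) {S : Proc V} {T : AProc V} (h : (enc c S).Red T) :
    ∃ S' : Proc V, Red S S' ∧ T.Red (enc c S') ∧ T.Inert (enc c S') := by
  have h' := AProc.red_iff.1 h
  rw [tr_enc] at h'
  obtain ⟨Q, h1, h2⟩ := h'.exists_source
  obtain ⟨S', rfl, -⟩ := exists_tr_eq Q Set.finite_empty
  refine ⟨S', red_iff.2 h1, AProc.red_iff.2 ?_, h2.inert c⟩
  rw [tr_enc]; exact h2.inertN.redN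

end Correspondence

/-! ### Validity -/

section Validity

variable {V : Type*} [Infinite V] [DecidableEq V]

/-! ### Chains of pending inert reductions and sequences of steps -/

/-- Sequences of inert reductions. -/
def InertIter : ℕ → Term V → Term V → Prop
  | 0, P, Q => SC True P Q
  | n + 1, P, Q => ∃ M, InertN P M ∧ InertIter n M Q

namespace InertIter

variable {n : ℕ} {P P' Q R : Term V}

theorem sc_left (h : InertIter n P Q) (h' : SC True P' P) : InertIter n P' Q := by
  cases n with
  | zero => exact h'.trans h
  | succ n =>
    obtain ⟨M, h1, h2⟩ := h
    exact ⟨M, h1.sc_left h', h2⟩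

theorem snoc (h : InertIter n P Q) (h' : InertN Q R) : InertIter (n + 1) P R := by
  induction n generalizing P with
  | zero => exact ⟨R, h'.sc_left h, .refl _⟩
  | succ n ih =>
    obtain ⟨M, h1, h2⟩ := h
    exact ⟨M, h1, ih h2⟩

/-- The commuting squares are pasted along the chain; the step is absorbed if it coincides with a
pending inert reduction. -/
theorem diamond (h : InertIter n P Q) (h' : RedN P P') :
    (∃ m, n = m + 1 ∧ InertIter m P' Q) ∨ ∃ Q', RedN Q Q' ∧ InertIter n P' Q' := by
  induction n generalizing P P' with
  | zero => exact .inr ⟨P', h'.sc h.symm (.refl _), .refl _⟩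
  | succ n ih =>
    obtain ⟨M, h1, h2⟩ := h
    rcases h1.diamond h' with h3 | ⟨M', h3, h4⟩
    · exact .inl ⟨n, rfl, h2.sc_left h3⟩
    · rcases ih h2 h3 with ⟨m, rfl, h5⟩ | ⟨Q', h5, h6⟩
      · exact .inl ⟨m + 1, rfl, M', h4, h5⟩
      · exact .inr ⟨Q', h5, M', h4, h6⟩

/-- A step of a term on its way to an encoded term is either one of the pending inert reductions or
starts a step of the source term. -/
theorem step (h : InertIter n P (encT Q)) (h' : RedN P P') :
    (∃ m, n = m + 1 ∧ InertIter m P' (encT Q)) ∨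
      ∃ Q', RedN Q Q' ∧ InertIter (n + 1) P' (encT Q') := by
  rcases h.diamond h' with h | ⟨R, h1, h2⟩
  · exact .inl h
  · obtain ⟨Q', h3, h4⟩ := h1.exists_source
    exact .inr ⟨Q', h3, h2.snoc h4.inertN⟩

/-- The chain lives on arbitrary classes; each intermediate term is replaced by a congruent
asynchronous one. -/
theorem exists_reflTransGen {P : AProc V} (h : InertIter n (tr P.toProc) Q) :
    ∃ P', Relation.ReflTransGen AProc.Red P P' ∧ SC True (tr P'.toProc) Q := by
  induction n generalizing P with
  | zero => exact ⟨P, .refl, h⟩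
  | succ n ih =>
    obtain ⟨M, h1, h2⟩ := h
    obtain ⟨M', h3, h4⟩ := h1.redN.exists_async P.async_tr
    obtain ⟨M', rfl⟩ := exists_aproc_tr_eq h3
    obtain ⟨P', h5, h6⟩ := ih (h2.sc_left h4.symm)
    exact ⟨P', .head (AProc.red_iff.2 (h1.redN.sc (.refl _) h4)) h5, h6⟩

end InertIter

theorem enc_complete_reflTransGen (c : FreshChoice V) {S S' : Proc V}
    (h : Relation.ReflTransGen Red S S') :
    Relation.ReflTransGen AProc.Red (enc c S) (enc c S') := by
  induction h with
  | refl => exact .refl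
  | tail _ h ih =>
    obtain ⟨T, h1, h2, -⟩ := enc_complete c h
    exact (ih.tail h1).tail h2

/-- The invariant of a target computation: `n` counts the communications whose second half is still
pending. -/
theorem enc_sound_reflTransGen (c : FreshChoice V) {S : Proc V} {T : AProc V}
    (h : Relation.ReflTransGen AProc.Red (enc c S) T) :
    ∃ S' n, Relation.ReflTransGen Red S S' ∧ InertIter n (tr T.toProc) (encT (tr S')) := by
  induction h with
  | refl => exact ⟨S, 0, .refl, by rw [tr_enc]; exact .refl _⟩
  | tail _ h ih =>
    obtain ⟨S', n, h1, h2⟩ := ih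
    rcases h2.step (AProc.red_iff.1 h) with ⟨m, -, h3⟩ | ⟨Q, h3, h4⟩
    · exact ⟨S', m, h1, h3⟩
    · obtain ⟨S'', rfl, -⟩ := exists_tr_eq Q Set.finite_empty
      exact ⟨S'', _, h1.tail (red_iff.2 h3), h4⟩

/-- A step without source progress lowers the number of pending inert reductions, so progress occurs
after at most `n` of them. -/
theorem enc_diverges (c : FreshChoice V) {S : Proc V} (h : Diverges AProc.Red (enc c S)) :
    Diverges Red S := by
  obtain ⟨f, h0, hf⟩ := h
  have step : ∀ (n i : ℕ) (S : Proc V), InertIter n (tr (f i).toProc) (encT (tr S)) →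
      ∃ S', Red S S' ∧ ∃ n i, InertIter n (tr (f i).toProc) (encT (tr S')) := by
    intro n
    induction n with
    | zero =>
      intro i S h
      rcases h.step (AProc.red_iff.1 (hf i)) with ⟨m, h, -⟩ | ⟨Q, h3, h4⟩
      · cases h
      · obtain ⟨S', rfl, -⟩ := exists_tr_eq Q Set.finite_empty
        exact ⟨S', red_iff.2 h3, _, _, h4⟩
    | succ n ih =>
      intro i S h
      rcases h.step (AProc.red_iff.1 (hf i)) with ⟨m, h, h3⟩ | ⟨Q, h3, h4⟩
      · cases h
        exact ih _ S h3
      · obtain ⟨S', rfl, -⟩ := exists_tr_eq Q Set.finite_empty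
        exact ⟨S', red_iff.2 h3, _, _, h4⟩
  -- `X` holds the source terms matched to some stage of the target sequence; each has a reduct in
  -- `X`, and iterating a choice of reducts gives the infinite sequence.
  let X := {S : Proc V // ∃ n i, InertIter n (tr (f i).toProc) (encT (tr S))}
  have next : ∀ S : X, ∃ S' : X, Red S.1 S'.1 := by
    rintro ⟨S, n, i, h⟩
    obtain ⟨S', h1, h2⟩ := step n i S h
    exact ⟨⟨S', h2⟩, h1⟩
  choose g hg using next
  let S0 : X := ⟨S, 0, 0, by rw [h0, tr_enc]; exact .refl _⟩
  refine ⟨fun i => (g^[i] S0).1, rfl, fun i => ?_⟩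
  change Red (g^[i] S0).1 (g^[i + 1] S0).1
  rw [Function.iterate_succ_apply']
  exact hg _

/-! ### Success -/

/-- An unguarded occurrence of the success constant. -/
def Term.Reports : Term V → Prop
  | .tick => True
  | .par P Q => P.Reports ∨ Q.Reports
  | .nu P => P.Reports
  | .bang P => P.Reports
  | _ => False

theorem Term.reports_ren (P : Term V) (f : V → V) : (P.ren f).Reports ↔ P.Reports := by
  induction P generalizing f with
  | _ => simp_all [Term.ren, Term.Reports]

theorem Term.reports_nuAs (ws : List V) (P : Term V) : (P.nuAs ws).Reports ↔ P.Reports := by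
  induction ws with
  | nil => rfl
  | cons w ws ih => simpa only [nuAs_cons, nuA, Reports, reports_ren] using ih

theorem Term.reports_encT (P : Term V) : (encT P).Reports ↔ P.Reports := by
  induction P with
  | _ => simp_all [encT, Term.Reports]

theorem SC.reports_iff {b : Prop} {P Q : Term V} (h : SC b P Q) : P.Reports ↔ Q.Reports := by
  induction h with
  | refl P => rfl
  | symm _ ih => exact ih.symm
  | trans _ _ ih1 ih2 => exact ih1.trans ih2
  | _ => simp_all [Term.Reports, Term.reports_ren, or_assoc, or_comm]

/-- A communication consumes two prefixes, and an unguarded success constant lies in neither. -/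
theorem RedN.reports {P Q : Term V} (h : RedN P Q) (hP : P.Reports) : Q.Reports := by
  obtain ⟨ws, x, y, A, B, C, h1, h2⟩ := h
  rw [h2.reports_iff, Term.reports_nuAs]
  rw [h1.reports_iff, Term.reports_nuAs] at hP
  exact .inr (hP.resolve_left fun h => h.elim id id)

theorem InertIter.reports {n : ℕ} {P Q : Term V} (h : InertIter n P Q) (hP : P.Reports) :
    Q.Reports := by
  induction n generalizing P with
  | zero => exact h.reports_iff.1 hP
  | succ n ih =>
    obtain ⟨M, h1, h2⟩ := h
    exact ih h2 (h1.redN.reports hP)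

theorem reports_tr {P : Proc V} : (tr P).Reports ↔ Reports P := by
  constructor
  · intro h
    induction P with
    | nil => exact h.elim
    | tick => exact .tick
    | out x y P ih => exact h.elim
    | inp x z P ih => exact h.elim
    | par P Q ih1 ih2 => exact h.elim (fun h => .parLeft (ih1 h)) fun h => .parRight (ih2 h)
    | nu z P ih => exact .nu (ih ((Term.reports_ren _ _).1 h))
    | bang P ih => exact .bang (ih h)
  · intro h
    induction h with
    | tick => trivial
    | parLeft _ ih => exact .inl ih
    | parRight _ ih => exact .inr ih
    | nu _ ih => exact (Term.reports_ren _ _).2 ih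
    | bang _ ih => exact ih

theorem reports_enc (c : FreshChoice V) {S : Proc V} : (enc c S).Reports ↔ Reports S := by
  rw [AProc.Reports, ← reports_tr, tr_enc, Term.reports_encT, reports_tr]

/-- A successful target term keeps its success along the pending inert steps, so the encoded source
term that they reach is successful as well. -/
theorem mayReport_enc (c : FreshChoice V) (S : Proc V) :
    MayReport Red Reports S ↔ MayReport AProc.Red AProc.Reports (enc c S) := by
  constructor
  · rintro ⟨S', h1, h2⟩
    exact ⟨_, enc_complete_reflTransGen c h1, (reports_enc c).2 h2⟩
  · rintro ⟨T, h1, h2⟩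
    obtain ⟨S', n, h3, h4⟩ := enc_sound_reflTransGen c h1
    refine ⟨S', h3, ?_⟩
    have := h4.reports (reports_tr.2 h2)
    rwa [Term.reports_encT, reports_tr] at this

/-! ### Compositionality and the five criteria -/

theorem enc_compositional (c : FreshChoice V) (o : Op V) (N : Set V) :
    ∃ C : ACtx V o.arity, (∀ i, C.count i = 1) ∧
      ∀ S : Fin o.arity → Proc V, (⋃ i, ((S i).fn : Set V)) = N →
        enc c (o.app S) = C.fill (fun i => enc c (S i)) := by
  -- The auxiliary name depends on the continuation only through its free names, which `N` fixes. If
  -- `N` is infinite, no arguments qualify and `∅` is a dummy value.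
  obtain ⟨F, hF⟩ : ∃ F : Finset V, ∀ G : Finset V, (G : Set V) = N → G = F := by
    by_cases h : ∃ F : Finset V, (F : Set V) = N
    · obtain ⟨F, rfl⟩ := h
      exact ⟨F, fun G hG => Finset.coe_injective hG⟩
    · exact ⟨∅, fun G hG => absurd ⟨G, hG⟩ h⟩
  have one : ∀ S : Fin 1 → Proc V, (⋃ i, ((S i).fn : Set V)) = N → (S 0).fn = F := by
    intro S hS
    refine hF _ ?_
    rw [← hS]
    ext a
    simp
  cases o with
  | nil => exact ⟨.nil, fun i => i.elim0, fun S _ => rfl⟩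
  | tick => exact ⟨.tick, fun i => i.elim0, fun S _ => rfl⟩
  | out x y =>
    refine ⟨.inp x (c.outName x y F) (.par (.out (c.outName x y F) y) (.hole (0 : Fin 1))),
      fun i => ?_, fun S hS => ?_⟩
    · obtain rfl : i = (0 : Fin 1) := Subsingleton.elim (α := Fin 1) _ _
      rfl
    · simp only [Op.app, enc, ACtx.fill, one S hS]
  | inp x z =>
    refine ⟨.nu (c.inpName x z F) (.par (.out x (c.inpName x z F))
      (.inp (c.inpName x z F) z (.hole (0 : Fin 1)))), fun i => ?_, fun S hS => ?_⟩
    · obtain rfl : i = (0 : Fin 1) := Subsingleton.elim (α := Fin 1) _ _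
      rfl
    · simp only [Op.app, enc, ACtx.fill, one S hS]
  | par =>
    refine ⟨.par (.hole (0 : Fin 2)) (.hole (1 : Fin 2)), fun i => ?_, fun S _ => rfl⟩
    change Fin 2 at i
    fin_cases i <;> rfl
  | nu z =>
    refine ⟨.nu z (.hole (0 : Fin 1)), fun i => ?_, fun S _ => rfl⟩
    obtain rfl : i = (0 : Fin 1) := Subsingleton.elim (α := Fin 1) _ _
    rfl
  | bang =>
    refine ⟨.bang (.hole (0 : Fin 1)), fun i => ?_, fun S _ => rfl⟩
    obtain rfl : i = (0 : Fin 1) := Subsingleton.elim (α := Fin 1) _ _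
    rfl

theorem enc_gorlaValid (c : FreshChoice V) :
    GorlaValid (enc c) (fun a (_ : Fin 1) => a) AProc.StructCong where
  equivalence := ⟨fun _ => .refl _, fun h => .symm h, fun h h' => .trans h h'⟩
  policy := fun _ _ h _ _ => h
  compositionality := enc_compositional c
  name_invariance := fun S σ => ⟨σ, fun _ _ => rfl, fun _ => enc_ren_alphaEq c S σ, fun _ => by
    rw [AProc.structCong_iff, tr_enc_ren]
    exact .refl _⟩
  completeness := fun _ S' h => ⟨enc c S', enc_complete_reflTransGen c h, .refl _⟩
  soundness := fun S T h => by
    obtain ⟨S', n, h1, h2⟩ := enc_sound_reflTransGen c h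
    obtain ⟨T', h3, h4⟩ := h2.exists_reflTransGen
    exact ⟨S', h1, T', h3, AProc.structCong_iff.2 (by rwa [tr_enc])⟩
  divergence_reflection := fun _ => enc_diverges c
  tick := rfl
  success_sensitiveness := mayReport_enc c

end Validity

end HondaTokoro

theorem mainTheorem7 {Name : Type*} [DecidableEq Name] [Infinite Name]
    (c : HondaTokoro.FreshChoice Name) :
    -- operational completeness: one step is matched by two, the second of which is inert
    (∀ S S' : HondaTokoro.Proc Name, HondaTokoro.Red S S' →
      ∃ T : HondaTokoro.AProc Name, (HondaTokoro.enc c S).Red T ∧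
        T.Red (HondaTokoro.enc c S') ∧ T.Inert (HondaTokoro.enc c S')) ∧
    -- decomposition of translated terms that offer a communication
    (∀ (S : HondaTokoro.Proc Name) (ws : List Name) (U R : HondaTokoro.AProc Name)
        (x u r : Name),
      ws.Nodup → U.Plain →
      (∀ w ∈ ws, w ∈ (HondaTokoro.AProc.par (.par U (.out x u)) (.inp x r R)).fn) →
      (HondaTokoro.enc c S).StaticCong (.nus ws (.par (.par U (.out x u)) (.inp x r R))) →
      ∃ (V R₁ R₂ : HondaTokoro.Proc Name) (W : HondaTokoro.AProc Name) (y z : Name)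
        (ss ts : List Name),
        HondaTokoro.StaticCong S (.nus ss (.par (.par V (.out x y R₁)) (.inp x z R₂))) ∧
        ws.Perm (ss ++ ts ++ [u]) ∧
        U.StaticCong (.par W (.inp u z (HondaTokoro.enc c R₂))) ∧
        u ∉ (HondaTokoro.enc c R₂).fn.erase z ∧
        (HondaTokoro.enc c V).StaticCong (.nus ts W) ∧
        r ≠ y ∧
        R.StaticCong (.par (.out r y) (HondaTokoro.enc c R₁)) ∧
        r ∉ (HondaTokoro.enc c R₁).fn) ∧
    -- one-step operational soundness, the remaining step being inert
    (∀ (S : HondaTokoro.Proc Name) (T : HondaTokoro.AProc Name),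
      (HondaTokoro.enc c S).Red T →
      ∃ S' : HondaTokoro.Proc Name, HondaTokoro.Red S S' ∧
        T.Red (HondaTokoro.enc c S') ∧ T.Inert (HondaTokoro.enc c S')) ∧
    -- invariance under arbitrary renamings, injective or not, up to alpha-conversion
    (∀ (S : HondaTokoro.Proc Name) (σ : Name → Name),
      (HondaTokoro.enc c (S.ren σ)).AlphaEq ((HondaTokoro.enc c S).ren σ)) ∧
    -- the five criteria, with the identity as renaming policy
    HondaTokoro.GorlaValid (HondaTokoro.enc c) (fun a (_ : Fin 1) => a)
      HondaTokoro.AProc.StructCong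
 :=
  ⟨fun _ _ h => HondaTokoro.enc_complete c h,
    fun _ _ _ _ _ _ _ hws hU hfn h => HondaTokoro.enc_decomposition c hws hU hfn h,
    fun _ _ h => HondaTokoro.enc_sound c h,
    HondaTokoro.enc_ren_alphaEq c, HondaTokoro.enc_gorlaValid c⟩
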